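/- Let $Sp(2)=\{A\in M_2(\mathbb H): AA^*=A^*A=1\}$ act on the unit sphere $S^7\subset\mathbb H^2$ by $x\mapsto Ax$, let $o=(0,1)$ and $Sp(1)=\{\mathrm{diag}(h,1)\}\subset Sp(2)$. Let $\mathfrak p\subset\mathfrak{sp}(2)$ be the space of skew-Hermitian quaternionic $2\times2$ matrices $X$ with $X_{11}=0$, with basis $$e_1,e_2,e_3=\begin{pmatrix}0&0\\0&i\end{pmatrix},\begin{pmatrix}0&0\\0&j\end{pmatrix},\begin{pmatrix}0&0\\0&k\end{pmatrix},\qquad e_4,e_5,e_6=\tfrac1{\sqrt2}\begin{pmatrix}0&i\\i&0\end{pmatrix},\tfrac1{\sqrt2}\begin{pmatrix}0&j\\j&0\end{pmatrix},\tfrac1{\sqrt2}\begin{pmatrix}0&k\\k&0\end{pmatrix},\qquad e_7=\tfrac1{\sqrt2}\begin{pmatrix}0&1\\-1&0\end{pmatrix},$$ identified with $T_oS^7$ by $X\mapsto Xo$, and put $\omega_1=e^{47}+e^{56}$, $\omega_2=e^{46}-e^{57}$, $\omega_3=e^{45}+e^{67}$ and $\varphi_0=e^{123}+\sum_{l=1}^3e^l\wedge\omega_l$.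 For $a>0$ and $D\in GL^+(3,\mathbb R)$ let $$\varphi_{a,D}=a^3e^{123}+\sum_{l,m=1}^3(D^{-1})_{lm}\,e^m\wedge\omega_l .$$ A $G_2$-structure on a $7$-dimensional space is a $3$-form linearly equivalent to $\varphi_0$. Let $\Lambda^3_+(\mathfrak p^*)$ be the set of those on $\mathfrak p$ inducing the orientation $e_1,\dots,e_7$, and $\Omega^3_+(S^7)$ the set of $G_2$-structures on $S^7$ inducing the corresponding orientation. The metric $g_\varphi$ of a $G_2$-structure is $g_{ij}=6^{-2/9}B_{ij}\det(B)^{-1/9}$ with $B_{ij}=\big((e_i\lrcorner\varphi)\wedge(e_j\lrcorner\varphi)\wedge\varphi\big)(e_1,\dots,e_7)$. Then $Sp(2)$ acts transitively on $S^7$ with stabiliser $Sp(1)$ at $o$, so $S^7=Sp(2)/Sp(1)$, and the following hold. (1) Restriction to $T_oS^7\simeq\mathfrak p$ is a linear isomorphism from the smooth $Sp(2)$-invariant $3$-forms on $S^7$ onto $\Lambda^3(\mathfrak p^*)^{\mathrm{Ad}(Sp(1))}$, which has dimension $10$, and it carries $\Omega^3_+(S^7)^{Sp(2)}$ onto $\Lambda^3_+(\mathfrak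 p^*)^{\mathrm{Ad}(Sp(1))}$. The latter is open in $\Lambda^3(\mathfrak p^*)^{\mathrm{Ad}(Sp(1))}$, and $\Phi(a,D)=\varphi_{a,D}$ is a diffeomorphism $$\Phi:\mathbb R^+\times GL^+(3,\mathbb R)\to\Lambda^3_+(\mathfrak p^*)^{\mathrm{Ad}(Sp(1))}.$$ Moreover $\varphi_{a,D}=(D(a)^{-1})^*\varphi_0$, where $D(a)^{-1}$ is the block map equal to $a\det(D^{-1})^{-1/3}D^{-1}$ on $\mathrm{span}(e_1,e_2,e_3)$ and to $\det(D^{-1})^{1/6}a^{-1/2}$ times the identity on $\mathrm{span}(e_4,\dots,e_7)$. (2) Every $\varphi\in\Omega^3_+(S^7)^{Sp(2)}$ has a well-defined smooth metric $g_\varphi$, and $g_\varphi$ is $Sp(2)$-invariant. The $Sp(2)$-invariant metrics on $S^7$ correspond, by restriction to $\mathfrak p$, to the positive definite elements of the $7$-dimensional space $\mathrm{Sym}^2(\mathfrak p^*)^{\mathrm{Ad}(Sp(1))}$, which form an open subset. The map $(a,D)\mapsto g_{\varphi_{a,D}}$ is a smooth submersion onto this subset, and two pairs $(a,D)$, $(a',D')$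 have the same image if and only if $a'=a$ and $D'\in D\cdot SO(3)$. It induces a homeomorphism $$\mathrm{Sym}^2_+(T^*S^7)^{Sp(2)}\simeq\mathbb R^+\times\big(GL^+(3,\mathbb R)/SO(3)\big).$$ (3) Let $\mathrm{Aut}(S^7)$ be the group of $Sp(2)$-equivariant diffeomorphisms $f$ of $S^7$, acting on invariant metrics by $g\mapsto(f^{-1})^*g$. The homeomorphism of (2) induces a homeomorphism $$\mathrm{Aut}(S^7)\backslash\mathrm{Sym}^2_+(T^*S^7)^{Sp(2)}\simeq\mathbb R^+\times SO(3)\backslash\big(GL^+(3,\mathbb R)/SO(3)\big).$$ This space is $4$-dimensional: $(a,r)\mapsto[a,\mathrm{diag}(r_1,r_2,r_3)]$ is a homeomorphism onto it from $\mathbb R^+\times\{r\in\mathbb R^3: r_1\ge r_2\ge r_3>0\}$. -/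

import Mathlib

open scoped Manifold ContDiff Quaternion Matrix MatrixGroups
open Module

noncomputable section

namespace SpSphere

/-! ### The groups `Sp(2)`, `Sp(1)` and the sphere `S⁷ = Sp(2)/Sp(1)` -/

/-- `ℍ²` with its Euclidean norm. -/
abbrev H2 : Type := PiLp 2 (fun _ : Fin 2 => ℍ[ℝ])

instance finrank_H2 : Fact (finrank ℝ H2 = 7 + 1) := ⟨by
  rw [LinearEquiv.finrank_eq (WithLp.linearEquiv 2 ℝ (Fin 2 → ℍ[ℝ])), Module.finrank_pi_fintype]
  simp [Quaternion.finrank_eq_four]⟩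

/-- The unit sphere of `ℍ²`, with its standard smooth structure. -/
abbrev S7 : Type := Metric.sphere (0 : H2) 1

/-- `Sp(2)`: quaternionic `2 × 2` matrices with `A Aᴴ = Aᴴ A = 1`. -/
abbrev Sp2 : Type := unitary (Matrix (Fin 2) (Fin 2) ℍ[ℝ])

/-- The subgroup `Sp(1)` of matrices `diag(h, 1)`. -/
def Sp1 : Subgroup Sp2 where
  carrier := {A | ∃ h : ℍ[ℝ], (A : Matrix (Fin 2) (Fin 2) ℍ[ℝ]) = !![h, 0; 0, 1]}
  one_mem' := ⟨1, by simp [Matrix.one_fin_two]⟩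
  mul_mem' := by
    rintro A B ⟨h, hA⟩ ⟨k, hB⟩
    exact ⟨h * k, by simp [hA, hB]⟩
  inv_mem' := by
    rintro A ⟨h, hA⟩
    refine ⟨star h, ?_⟩
    have h1 : ((A⁻¹ : Sp2) : Matrix (Fin 2) (Fin 2) ℍ[ℝ]) = star (A : Matrix (Fin 2) (Fin 2) ℍ[ℝ]) :=
      rfl
    rw [h1, hA]
    ext i j : 1
    fin_cases i <;> fin_cases j <;> simp [Matrix.star_apply]

/-- A quaternionic matrix applied to a column vector. -/
def act (A : Matrix (Fin 2) (Fin 2) ℍ[ℝ]) (x : H2) : H2 := WithLp.toLp 2 (A *ᵥ x.ofLp)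

theorem norm_sq_eq (x : H2) :
    ((‖x‖ ^ 2 : ℝ) : ℍ[ℝ]) = star x.ofLp ⬝ᵥ x.ofLp := by
  have h : ∀ q : ℍ[ℝ], star q * q = ((‖q‖ ^ 2 : ℝ) : ℍ[ℝ]) := fun q => by
    rw [Quaternion.star_mul_self, Quaternion.normSq_eq_norm_mul_self, sq]
  rw [PiLp.norm_sq_eq_of_L2]
  simp only [Fin.sum_univ_two, dotProduct, Pi.star_apply, h]
  push_cast
  rfl

theorem norm_act (A : Sp2) (x : H2) : ‖act A x‖ = ‖x‖ := by
  have hA : (A : Matrix (Fin 2) (Fin 2) ℍ[ℝ])ᴴ * (A : Matrix (Fin 2) (Fin 2) ℍ[ℝ]) = 1 :=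
    A.2.1
  have key : ((‖act A x‖ ^ 2 : ℝ) : ℍ[ℝ]) = ((‖x‖ ^ 2 : ℝ) : ℍ[ℝ]) := by
    rw [norm_sq_eq, norm_sq_eq]
    simp only [act, Matrix.star_mulVec]
    rw [← Matrix.dotProduct_mulVec, Matrix.mulVec_mulVec, hA, Matrix.one_mulVec]
  have h2 : ‖act A x‖ ^ 2 = ‖x‖ ^ 2 := Quaternion.coe_injective key
  exact (sq_eq_sq₀ (norm_nonneg _) (norm_nonneg _)).1 h2

/-- The standard action of `Sp(2)` on the sphere, `(A, x) ↦ A x`. -/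
instance : MulAction Sp2 S7 where
  smul A x := ⟨act A x, by
    have hx : ‖(x : H2)‖ = 1 := by simp
    simp [norm_act, hx]⟩
  one_smul x := Subtype.ext (by
    change act ((1 : Sp2) : Matrix (Fin 2) (Fin 2) ℍ[ℝ]) x = x
    simp [act])
  mul_smul A B x := Subtype.ext (by
    change act ((A * B : Sp2) : Matrix (Fin 2) (Fin 2) ℍ[ℝ]) x = act A (act B x)
    rw [act, act, act, Submonoid.coe_mul, ← Matrix.mulVec_mulVec])

/-- The base point `o = (0, 1)`, whose stabiliser is `Sp(1)`. -/
def o : S7 := ⟨WithLp.toLp 2 ![0, 1], by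
  rw [mem_sphere_zero_iff_norm, ← sq_eq_sq₀ (norm_nonneg _) zero_le_one,
    PiLp.norm_sq_eq_of_L2]
  simp [Fin.sum_univ_two]⟩

/-! ### The reductive complement `𝔭` and the isotropy representation -/

/-- `𝔭 ⊂ 𝔰𝔭(2)`: the skew-Hermitian quaternionic matrices orthogonal to
`𝔰𝔭(1) = {diag(q, 0) : q imaginary}` for `⟨A, B⟩ = Re tr (A Bᴴ)`. -/
def 𝔭 : Submodule ℝ (Matrix (Fin 2) (Fin 2) ℍ[ℝ]) where
  carrier := {X | X + Xᴴ = 0 ∧ X 0 0 = 0}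
  add_mem' := by
    rintro X Y ⟨h1, h2⟩ ⟨h3, h4⟩
    refine ⟨?_, by simp [h2, h4]⟩
    rw [Matrix.conjTranspose_add, add_add_add_comm, h1, h3, add_zero]
  zero_mem' := by simp
  smul_mem' := by
    rintro c X ⟨h1, h2⟩
    refine ⟨?_, by simp [h2]⟩
    have h : (c • X)ᴴ = c • Xᴴ := by
      refine Matrix.ext fun i j => ?_
      exact Quaternion.star_smul c (X j i)
    rw [h, ← smul_add, h1, smul_zero]

/-- The quaternion `a + b i + c j + d k`. -/
def quat (a b c d : ℝ) : ℍ[ℝ] := ⟨a, b, c, d⟩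

@[simp] theorem quat_re (a b c d : ℝ) : (quat a b c d).re = a := rfl

@[simp] theorem quat_imI (a b c d : ℝ) : (quat a b c d).imI = b := rfl

@[simp] theorem quat_imJ (a b c d : ℝ) : (quat a b c d).imJ = c := rfl

@[simp] theorem quat_imK (a b c d : ℝ) : (quat a b c d).imK = d := rfl

/-- The basis `e₁, …, e₇` of `𝔭` (indices are shifted by one). -/
def frameMatrix : Fin 7 → Matrix (Fin 2) (Fin 2) ℍ[ℝ] :=
  ![!![0, 0; 0, quat 0 1 0 0], !![0, 0; 0, quat 0 0 1 0], !![0, 0; 0, quat 0 0 0 1],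
    !![0, quat 0 (√2)⁻¹ 0 0; quat 0 (√2)⁻¹ 0 0, 0],
    !![0, quat 0 0 (√2)⁻¹ 0; quat 0 0 (√2)⁻¹ 0, 0],
    !![0, quat 0 0 0 (√2)⁻¹; quat 0 0 0 (√2)⁻¹, 0],
    !![0, quat (√2)⁻¹ 0 0 0; quat (-(√2)⁻¹) 0 0 0, 0]]

theorem frameMatrix_mem (i : Fin 7) : frameMatrix i ∈ 𝔭 := by
  refine ⟨?_, ?_⟩
  · ext a b <;> fin_cases i <;> fin_cases a <;> fin_cases b <;>
      simp [frameMatrix, Matrix.conjTranspose_apply]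
  · fin_cases i <;> simp [frameMatrix]

/-- `e₁, …, e₇` as elements of `𝔭`. -/
def frame (i : Fin 7) : 𝔭 := ⟨frameMatrix i, frameMatrix_mem i⟩

/-- The dual basis `e¹, …, e⁷` of `𝔭*`. -/
def coframe (i : Fin 7) : 𝔭 →ₗ[ℝ] ℝ where
  toFun X := ![((X : Matrix (Fin 2) (Fin 2) ℍ[ℝ]) 1 1).imI, (X.1 1 1).imJ, (X.1 1 1).imK,
    √2 * (X.1 0 1).imI, √2 * (X.1 0 1).imJ, √2 * (X.1 0 1).imK, √2 * (X.1 0 1).re] i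
  map_add' X Y := by fin_cases i <;> simp [mul_add]
  map_smul' c X := by fin_cases i <;> simp [mul_left_comm]

theorem coframe_frame (i j : Fin 7) : coframe i (frame j) = if i = j then 1 else 0 := by
  fin_cases i <;> fin_cases j <;>
    simp [coframe, frame, frameMatrix]

/-- `Ad(h) X = h X h⁻¹` for `h ∈ Sp(1)`, `X ∈ 𝔭`. -/
def Ad (h : Sp1) : 𝔭 →ₗ[ℝ] 𝔭 where
  toFun X := ⟨(h : Sp2) * (X : Matrix (Fin 2) (Fin 2) ℍ[ℝ]) *
      ((h : Sp2) : Matrix (Fin 2) (Fin 2) ℍ[ℝ])ᴴ, by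
    obtain ⟨⟨h, hh⟩, q, hq⟩ := h
    obtain ⟨X, h1, h2⟩ := X
    refine ⟨?_, ?_⟩
    · simp only [Matrix.conjTranspose_mul, Matrix.conjTranspose_conjTranspose, ← Matrix.mul_assoc]
      rw [← Matrix.add_mul, ← Matrix.mul_add, h1, Matrix.mul_zero, Matrix.zero_mul]
    · change h = _ at hq
      simp [hq, Matrix.mul_apply, Matrix.vecMul, dotProduct, Fin.sum_univ_two, h2]⟩
  map_add' X Y := Subtype.ext (by simp [Matrix.mul_add, Matrix.add_mul])
  map_smul' c X := Subtype.ext (by simp)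

/-! ### Three-forms and inner products on `𝔭` -/

/-- `eⁱ ∧ eʲ ∧ eᵏ` on `𝔭`. -/
def e3 (i j k : Fin 7) : 𝔭 [⋀^Fin 3]→ₗ[ℝ] ℝ :=
  Matrix.detRowAlternating.compLinearMap (LinearMap.pi ![coframe i, coframe j, coframe k])

/-- `eᵐ ∧ ω₁`, `eᵐ ∧ ω₂`, `eᵐ ∧ ω₃`, where `ω₁ = e⁴⁷ + e⁵⁶`, `ω₂ = e⁴⁶ - e⁵⁷`,
`ω₃ = e⁴⁵ + e⁶⁷`. -/
def eWedgeOmega (m : Fin 7) : Fin 3 → 𝔭 [⋀^Fin 3]→ₗ[ℝ] ℝ :=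
  ![e3 m 3 6 + e3 m 4 5, e3 m 3 5 - e3 m 4 6, e3 m 3 4 + e3 m 5 6]

/-- `φ₀ = e¹²³ + e¹ ∧ ω₁ + e² ∧ ω₂ + e³ ∧ ω₃`. -/
def φ₀ : 𝔭 [⋀^Fin 3]→ₗ[ℝ] ℝ :=
  e3 0 1 2 + eWedgeOmega 0 0 + eWedgeOmega 1 1 + eWedgeOmega 2 2

/-- `φ_{a,D} = a³ e¹²³ + ∑ₗ (∑ₘ (D⁻¹)ₗₘ eᵐ) ∧ ωₗ`. -/
def phi (a : ℝ) (D : Matrix (Fin 3) (Fin 3) ℝ) : 𝔭 [⋀^Fin 3]→ₗ[ℝ] ℝ :=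
  a ^ 3 • e3 0 1 2 + ∑ l : Fin 3, ∑ m : Fin 3, D⁻¹ l m • eWedgeOmega (Fin.castLE (by norm_num) m) l

/-- The block endomorphism of `𝔭` which is `a (det D⁻¹)^(-1/3) D⁻¹` on `span (e₁, e₂, e₃)` and
`(det D⁻¹)^(1/6) a^(-1/2)` times the identity on `span (e₄, …, e₇)`. -/
def blockMap (a : ℝ) (D : Matrix (Fin 3) (Fin 3) ℝ) : 𝔭 →ₗ[ℝ] 𝔭 :=
  (∑ l : Fin 3, ∑ m : Fin 3, (a / D⁻¹.det ^ (1 / 3 : ℝ) * D⁻¹ l m) •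
    (coframe (Fin.castLE (by norm_num) m)).smulRight (frame (Fin.castLE (by norm_num) l))) +
  (D⁻¹.det ^ (1 / 6 : ℝ) / a ^ (1 / 2 : ℝ)) •
    ∑ k : Fin 4, (coframe (Fin.natAdd 3 k)).smulRight (frame (Fin.natAdd 3 k))

/-- A `G₂`-structure on a (7-dimensional) real vector space: a 3-form linearly equivalent
to `φ₀`. -/
def IsG2Form {V : Type*} [AddCommGroup V] [Module ℝ V] (φ : V [⋀^Fin 3]→ₗ[ℝ] ℝ) : Prop :=
  ∃ L : V ≃ₗ[ℝ] 𝔭, φ = φ₀.compLinearMap (L : V →ₗ[ℝ] 𝔭)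

/-- `Λ³₊(𝔭*)`: the `G₂`-structures on `𝔭` inducing the orientation for which `e₁, …, e₇` is
positive, i.e. the orbit of `φ₀` under the orientation-preserving linear group. -/
def IsPositive (φ : 𝔭 [⋀^Fin 3]→ₗ[ℝ] ℝ) : Prop :=
  ∃ L : 𝔭 ≃ₗ[ℝ] 𝔭, 0 < LinearMap.det (L : 𝔭 →ₗ[ℝ] 𝔭) ∧ φ = φ₀.compLinearMap (L : 𝔭 →ₗ[ℝ] 𝔭)

/-- The exterior product of real-valued alternating forms. -/
def wedge {V ι κ : Type*} [AddCommGroup V] [Module ℝ V] [Fintype ι] [Fintype κ] [DecidableEq ι]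
    [DecidableEq κ] (α : V [⋀^ι]→ₗ[ℝ] ℝ) (β : V [⋀^κ]→ₗ[ℝ] ℝ) : V [⋀^ι ⊕ κ]→ₗ[ℝ] ℝ :=
  (LinearMap.mul' ℝ ℝ).compAlternatingMap (α.domCoprod β)

/-- `B_{ij} = ((bᵢ ⌟ φ) ∧ (bⱼ ⌟ φ) ∧ φ)(b₁, …, b₇)`. -/
def BMatrix {V : Type*} [AddCommGroup V] [Module ℝ V] (φ : V [⋀^Fin 3]→ₗ[ℝ] ℝ)
    (b : Fin 7 → V) : Matrix (Fin 7) (Fin 7) ℝ :=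
  Matrix.of fun i j => wedge (wedge (φ.curryLeft (b i)) (φ.curryLeft (b j))) φ
    (Sum.elim (Sum.elim ![b 0, b 1] ![b 2, b 3]) ![b 4, b 5, b 6])

/-- `g` is the inner product `g_φ` of the `G₂`-structure `φ`:
`g_{ij} = 6^(-2/9) B_{ij} / det(B)^(1/9)` in every basis (with the real ninth root). -/
def IsMetricOf {V : Type*} [AddCommGroup V] [Module ℝ V] (φ : V [⋀^Fin 3]→ₗ[ℝ] ℝ)
    (g : V → V → ℝ) : Prop :=
  ∀ b : Basis (Fin 7) ℝ V, ∃ r : ℝ, r ^ 9 = (BMatrix φ b).det ∧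
    ∀ i j, g (b i) (b j) = BMatrix φ b i j / ((6 : ℝ) ^ (2 / 9 : ℝ) * r)

/-- `Λ³(𝔭*)^{Ad(Sp(1))}`. -/
def InvForm𝔭 : Submodule ℝ (𝔭 [⋀^Fin 3]→ₗ[ℝ] ℝ) where
  carrier := {φ | ∀ h : Sp1, φ.compLinearMap (Ad h) = φ}
  add_mem' := fun {φ ψ} hφ hψ h => by rw [AlternatingMap.add_compLinearMap, hφ h, hψ h]
  zero_mem' := fun h => AlternatingMap.zero_compLinearMap _
  smul_mem' := fun c φ hφ h => by
    ext v
    have := congrArg (fun ψ => c • ψ v) (hφ h)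
    simpa using this

/-- `Sym²(𝔭*)^{Ad(Sp(1))}`. -/
def InvSym𝔭 : Submodule ℝ (LinearMap.BilinForm ℝ 𝔭) where
  carrier := {b | (∀ X Y, b X Y = b Y X) ∧ ∀ (h : Sp1) (X Y : 𝔭), b (Ad h X) (Ad h Y) = b X Y}
  add_mem' := by
    rintro b b' ⟨h1, h2⟩ ⟨h3, h4⟩
    exact ⟨fun X Y => by simp [h1 X Y, h3 X Y], fun h X Y => by simp [h2, h4]⟩
  zero_mem' := ⟨fun _ _ => rfl, fun _ _ _ => rfl⟩
  smul_mem' := by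
    rintro c b ⟨h1, h2⟩
    exact ⟨fun X Y => by simp [h1 X Y], fun h X Y => by simp [h2]⟩

/-- Positive definiteness. -/
def PosDef (b : LinearMap.BilinForm ℝ 𝔭) : Prop := ∀ X, X ≠ 0 → 0 < b X X

/-! ### Invariant three-forms and Riemannian metrics on `S⁷` -/

/-- The tangent space of the sphere. -/
abbrev T (x : S7) : Type := TangentSpace (𝓡 7) x

/-- The derivative `T_x S⁷ → T_{Ax} S⁷` of the action of `A ∈ Sp(2)`. -/
abbrev dAct (A : Sp2) (x : S7) : T x →L[ℝ] T (A • x) :=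
  mfderiv (𝓡 7) (𝓡 7) (fun y : S7 => A • y) x

/-- The derivative at `x` of the inclusion `S⁷ → ℍ²`, as a linear map. -/
def dIncl (x : S7) : T x →ₗ[ℝ] H2 :=
  ((mvfderiv (𝓡 7) (Subtype.val : S7 → H2) x : T x →L[ℝ] H2) : T x →ₗ[ℝ] H2)

theorem dIncl_injective (x : S7) : Function.Injective (dIncl x) :=
  injective_mvfderiv_subtypeVal_sphere x

/-- `X ↦ X o`, the velocity at `t = 0` of `exp(tX) o` in `ℍ²`. -/
def velocity : 𝔭 →ₗ[ℝ] H2 where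
  toFun X := act X o
  map_add' X Y := by
    rw [act, Submodule.coe_add, Matrix.add_mulVec, WithLp.toLp_add]
    rfl
  map_smul' c X := by
    rw [act, Submodule.coe_smul, Matrix.smul_mulVec, WithLp.toLp_smul]
    rfl

theorem velocity_mem (X : 𝔭) : velocity X ∈ LinearMap.range (dIncl o) := by
  have h : LinearMap.range (dIncl o) = (Submodule.span ℝ {(o : H2)})ᗮ :=
    range_mvfderiv_subtypeVal o
  obtain ⟨X, h1, h2⟩ := X
  have h3 : X 1 1 + star (X 1 1) = 0 := congrFun (congrFun h1 1) 1
  have h4 : (X 1 1).re = 0 := by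
    have := congrArg (fun q : ℍ[ℝ] => q.re) h3
    simp at this
    linarith
  rw [h, Submodule.mem_orthogonal_singleton_iff_inner_right]
  simp [velocity, act, o, PiLp.inner_apply, Fin.sum_univ_two, Quaternion.inner_def, h4]

/-- The identification `𝔭 ≃ T_o S⁷`: `θ X` is the tangent vector at `o` whose image in `ℍ²` is
`X o`. -/
def θ : 𝔭 →ₗ[ℝ] T o :=
  (LinearEquiv.ofInjective (dIncl o) (dIncl_injective o)).symm.toLinearMap ∘ₗ
    velocity.codRestrict (LinearMap.range (dIncl o)) velocity_mem

theorem dIncl_θ (X : 𝔭) : dIncl o (θ X) = velocity X :=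
  congrArg Subtype.val ((LinearEquiv.ofInjective (dIncl o) (dIncl_injective o)).apply_symm_apply
    (velocity.codRestrict (LinearMap.range (dIncl o)) velocity_mem X))

/-- Smooth vector fields on `S⁷`. -/
def SmoothField (X : ∀ x : S7, T x) : Prop :=
  ContMDiff (𝓡 7) (𝓡 7).tangent ∞ (fun x : S7 => (⟨x, X x⟩ : TangentBundle (𝓡 7) S7))

/-- `Ω³(S⁷)^{Sp(2)}`: smooth `Sp(2)`-invariant 3-forms on `S⁷`. A family of alternating forms is
smooth if it takes smooth vector fields to smooth functions. -/
def InvForm : Submodule ℝ (∀ x : S7, T x [⋀^Fin 3]→ₗ[ℝ] ℝ) where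
  carrier := {φ |
    (∀ X : Fin 3 → ∀ x : S7, T x, (∀ i, SmoothField (X i)) →
      ContMDiff (𝓡 7) 𝓘(ℝ, ℝ) ∞ (fun x => φ x (fun i => X i x))) ∧
    ∀ (A : Sp2) (x : S7) (v : Fin 3 → T x), φ (A • x) (fun i => dAct A x (v i)) = φ x v}
  add_mem' := by
    rintro φ ψ ⟨h1, h2⟩ ⟨h3, h4⟩
    exact ⟨fun X hX => (h1 X hX).add (h3 X hX), fun A x v => by
      simp [h2, h4]⟩
  zero_mem' := ⟨fun _ _ => contMDiff_const, fun _ _ _ => rfl⟩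
  smul_mem' := by
    rintro c φ ⟨h1, h2⟩
    exact ⟨fun X hX => contMDiff_const.mul (h1 X hX), fun A x v => by
      simp [h2]⟩

/-- Membership in `Ω³₊(S⁷)^{Sp(2)}`: an invariant 3-form which is a `G₂`-structure on every
tangent space, and which induces the orientation of the connected manifold `S⁷` for which
`e₁, …, e₇` is positive in `𝔭 ≃ T_o S⁷`. -/
def IsG2Structure (φ : InvForm) : Prop :=
  (∀ x, IsG2Form (φ.1 x)) ∧ IsPositive ((φ.1 o).compLinearMap θ)

/-- Smooth Riemannian metrics on `S⁷`. -/
abbrev Metric7 : Type :=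
  Bundle.ContMDiffRiemannianMetric (𝓡 7) ∞ (EuclideanSpace ℝ (Fin 7)) (fun x : S7 => T x)

/-- `Sp(2)`-invariant Riemannian metrics on `S⁷`. -/
def InvMetric : Type :=
  {g : Metric7 // ∀ (A : Sp2) (x : S7) (v w : T x),
    g.inner (A • x) (dAct A x v) (dAct A x w) = g.inner x v w}

/-- The topology of pointwise convergence on invariant metrics. -/
instance : TopologicalSpace InvMetric :=
  TopologicalSpace.induced (fun g => fun (p : Σ x : S7, T x × T x) => g.1.inner p.1 p.2.1 p.2.2)
    Pi.topologicalSpace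

/-- `f ∈ Aut(S⁷)`: the diffeomorphism `f` commutes with the action of `Sp(2)`. -/
def IsEquivariant (f : Diffeomorph (𝓡 7) (𝓡 7) S7 S7 ∞) : Prop :=
  ∀ (A : Sp2) (x : S7), f (A • x) = A • f x

/-- `g = f^* g'`, i.e. `g' = (f⁻¹)^* g`. -/
def IsPullback (f : Diffeomorph (𝓡 7) (𝓡 7) S7 S7 ∞) (g g' : InvMetric) : Prop :=
  ∀ (x : S7) (v w : T x), g'.1.inner (f x) (mfderiv (𝓡 7) (𝓡 7) f x v) (mfderiv (𝓡 7) (𝓡 7) f x w) =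
    g.1.inner x v w

/-- Two invariant metrics are equivalent if they lie in the same orbit of the group `Aut(S⁷)`
of `Sp(2)`-equivariant diffeomorphisms, acting by `g ↦ (f⁻¹)^* g`. -/
def autSetoid : Setoid InvMetric where
  r g g' := ∃ f, IsEquivariant f ∧ IsPullback f g g'
  iseqv := by
    have hd : ∀ (f : Diffeomorph (𝓡 7) (𝓡 7) S7 S7 ∞) (x : S7),
        MDifferentiableAt (𝓡 7) (𝓡 7) f x := fun f x => f.mdifferentiable (by simp) x
    have hinv : ∀ (f : Diffeomorph (𝓡 7) (𝓡 7) S7 S7 ∞) (x : S7) (v : T x),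
        HEq (mfderiv (𝓡 7) (𝓡 7) f (f.symm x) (mfderiv (𝓡 7) (𝓡 7) f.symm x v)) v := by
      intro f x v
      have h := mfderiv_comp_apply x (hd f (f.symm x)) (hd f.symm x) v
      have h2 : (f ∘ f.symm : S7 → S7) = id := funext f.apply_symm_apply
      rw [← h, h2, mfderiv_id]
      rfl
    refine ⟨fun g => ⟨Diffeomorph.refl _ _ _, fun _ _ => rfl, fun x v w => ?_⟩, ?_, ?_⟩
    · have h : ∀ u : T x, mfderiv (𝓡 7) (𝓡 7) (Diffeomorph.refl (𝓡 7) S7 ∞) x u = u := by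
        intro u
        rw [Diffeomorph.coe_refl, mfderiv_id]
        rfl
      rw [h, h]
      rfl
    · rintro g g' ⟨f, h1, h2⟩
      refine ⟨f.symm, fun A x => ?_, fun x v w => ?_⟩
      · apply f.toEquiv.injective
        change f (f.symm (A • x)) = f (A • f.symm x)
        rw [h1]
        exact (f.apply_symm_apply _).trans (congrArg (A • ·) (f.apply_symm_apply x).symm)
      · rw [← h2]
        have : ∀ (y z : S7) (v w : T y) (v' w' : T z), y = z → HEq v v' → HEq w w' →
            g'.1.inner y v w = g'.1.inner z v' w' := by
          rintro y z v w v' w' rfl hv hw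
          rw [eq_of_heq hv, eq_of_heq hw]
        exact this _ _ _ _ _ _ (f.apply_symm_apply x) (hinv f x v) (hinv f x w)
    · rintro g g' g'' ⟨f, h1, h2⟩ ⟨k, h3, h4⟩
      refine ⟨f.trans k, fun A x => ?_, fun x v w => ?_⟩
      · simp [h1 A x, h3 A (f x)]
      · have h : ∀ u : T x, mfderiv (𝓡 7) (𝓡 7) (f.trans k) x u =
            mfderiv (𝓡 7) (𝓡 7) k (f x) (mfderiv (𝓡 7) (𝓡 7) f x u) := fun u =>
          mfderiv_comp_apply x (hd k (f x)) (hd f x) u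
        rw [h, h, ← h2, ← h4]
        rfl

/-- `Aut(S⁷) \ Sym²₊(T*S⁷)^{Sp(2)}`, with the quotient topology. -/
abbrev Moduli : Type := Quotient autSetoid

/-! ### The parameter spaces -/

/-- `ℝ⁺`. -/
abbrev Rpos : Type := Set.Ioi (0 : ℝ)

/-- `SO(3)` as a subgroup of `GL⁺(3, ℝ)`. -/
def SO3 : Subgroup GL(3, ℝ)⁺ where
  carrier := {D | ((D : GL (Fin 3) ℝ) : Matrix (Fin 3) (Fin 3) ℝ) ∈
    Matrix.specialOrthogonalGroup (Fin 3) ℝ}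
  one_mem' := by simp
  mul_mem' := by
    intro A B hA hB
    simpa using mul_mem hA hB
  inv_mem' := by
    intro A hA
    have h := Matrix.mem_specialOrthogonalGroup_iff.1 hA
    have h1 := (Matrix.mem_orthogonalGroup_iff (Fin 3) ℝ).1 h.1
    have h2 : (((A⁻¹ : GL(3, ℝ)⁺) : GL (Fin 3) ℝ) : Matrix (Fin 3) (Fin 3) ℝ) =
        star ((A : GL (Fin 3) ℝ) : Matrix (Fin 3) (Fin 3) ℝ) := by
      rw [Subgroup.coe_inv, Matrix.coe_units_inv]
      exact Matrix.inv_eq_right_inv h1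
    change (((A⁻¹ : GL(3, ℝ)⁺) : GL (Fin 3) ℝ) : Matrix (Fin 3) (Fin 3) ℝ) ∈
      Matrix.specialOrthogonalGroup (Fin 3) ℝ
    rw [h2]
    refine Matrix.mem_specialOrthogonalGroup_iff.2 ⟨Unitary.star_mem h.1, ?_⟩
    rw [Matrix.star_eq_conjTranspose, Matrix.det_conjTranspose, h.2, star_one]

/-- `GL⁺(3, ℝ) / SO(3)`, the space of cosets `D · SO(3)`. -/
abbrev GLmodSO : Type := GL(3, ℝ)⁺ ⧸ SO3

/-- `SO(3) \ (GL⁺(3, ℝ) / SO(3))`. -/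
abbrev SOGLmodSO : Type := Quotient (MulAction.orbitRel SO3 GLmodSO)

/-- The domain `ℝ⁺ × GL⁺(3, ℝ)` as an open subset of `ℝ × ℝ^{3 × 3}`. -/
def ParamDomain : Set (ℝ × (Fin 3 → Fin 3 → ℝ)) :=
  {q | 0 < q.1 ∧ 0 < (Matrix.of q.2).det}

/-- `{(r₁, r₂, r₃) : r₁ ≥ r₂ ≥ r₃ > 0}`. -/
abbrev Chamber : Type := {r : Fin 3 → ℝ // r 1 ≤ r 0 ∧ r 2 ≤ r 1 ∧ 0 < r 2}

end SpSphere

end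

/-! ### Linear algebra of `φ₀` on `𝔭`: volume-valued form, metric, nondegeneracy. -/

noncomputable section

namespace SpSphere

/-! ### Coordinates on `𝔭` -/

/-! By homogeneity everything happens on `𝔭`. An element of `𝔭` is a pair `(η, x)`, with `η = X₁₁`
imaginary and `x = X₀₁` an arbitrary quaternion (matrix entries numbered from 0), and `h ∈ Sp(1)`
acts by `(η, h x)`. The components of `η` and the hermitian product `x* y` are therefore unchanged.
Every invariant 3-form is `p e¹²³ + ∑ Mₗₘ eᵐ ∧ ωₗ` (`formEquiv`, ten parameters), since the `ωₗ` are
the imaginary components of `x* y` up to scale. Every invariant symmetric form is `S` on the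
vertical part plus `ν` times the standard form on the horizontal part (`symEquiv`, seven
parameters). The elements `i`, `j`, `-1` of `Sp(1)` already force this.

A block map `(N, μ)` pulls `(p, M)` back to `(p det N, μ² M N)` (`genForm_comp_blockEnd`), so every
form with `p, det M > 0` is a block pullback of `φ₀`. Conversely, for a `G₂`-form two vectors whose
joint contraction vanishes are dependent, because `|u × w|² = |u|²|w|² - ⟨u, w⟩²`; this excludes
`det M = 0` and `p / det M ≤ 0`, and the stabiliser of `φ₀` preserves orientation, which excludes
`det M < 0` (`isPositive_genForm_iff`).

The metric of `φ₀` is the standard one and metrics are natural under pullback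
(`isMetricOf_φ₀_comp`). Hence `φ_{a,D}` has `ν = det(D⁻¹)^(1/3) / a` and `S = ν⁻² D⁻ᵀ D⁻¹`. Equality
of two such pairs means that `D` changes by `SO(3)` on the right and `a` stays
(`metricParam_eq_iff`). Cholesky factorisation inverts the correspondence smoothly; twisting it by
elements of `SO(3)` gives local sections through every point, so the map is a submersion.

On the sphere, `x* u` and `u* w - (x* u)* (x* w)` are smooth and `Sp(2)`-invariant, and at `o` they
restrict to the two invariants above. Every invariant tensor on `𝔭` thus extends to a smooth
invariant tensor, uniquely by transitivity.

An equivariant diffeomorphism is right multiplication by a unit quaternion `q`, since it must send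
`o` to a point fixed by `Sp(1)` (`eq_sphereMul_of_isEquivariant`). It conjugates vertical components
by `q`, and all of `SO(3)` arises in this way (`exists_rotMat_eq`). So `Aut(S⁷)` acts on `D` by left
multiplication by `SO(3)`, and singular values classify the double cosets, continuously in both
directions (`chamberHomeo`). -/

theorem mem_𝔭_im {X : Matrix (Fin 2) (Fin 2) ℍ[ℝ]} (hX : X ∈ 𝔭) :
    X 0 0 = 0 ∧ (X 1 1).re = 0 ∧ X 1 0 = -star (X 0 1) := by
  obtain ⟨h1, h2⟩ := hX
  refine ⟨h2, ?_, ?_⟩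
  · have h3 : X 1 1 + star (X 1 1) = 0 := congrFun (congrFun h1 1) 1
    have := congrArg (fun q : ℍ[ℝ] => q.re) h3
    simp at this
    linarith
  · have h3 : X 1 0 + star (X 0 1) = 0 := congrFun (congrFun h1 1) 0
    exact eq_neg_of_add_eq_zero_left h3

theorem ext_coframe {X Y : 𝔭} (h : ∀ i, coframe i X = coframe i Y) : X = Y := by
  obtain ⟨h1, h2, h3⟩ := mem_𝔭_im X.2
  obtain ⟨h4, h5, h6⟩ := mem_𝔭_im Y.2
  have hs : (√2 : ℝ) ≠ 0 := by positivity
  have a0 := h 0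
  have a1 := h 1
  have a2 := h 2
  have a3 := h 3
  have a4 := h 4
  have a5 := h 5
  have a6 := h 6
  simp [coframe] at a0 a1 a2 a3 a4 a5 a6
  have h01 : X.1 0 1 = Y.1 0 1 := by ext <;> assumption
  have h11 : X.1 1 1 = Y.1 1 1 := by ext <;> first | assumption | rw [h2, h5]
  apply Subtype.ext
  ext i j : 1
  fin_cases i <;> fin_cases j
  · exact h1.trans h4.symm
  · exact h01
  · exact h3.trans (by rw [h01]; exact h6.symm)
  · exact h11

/-- The coordinates of `𝔭` with respect to `e₁, …, e₇`. -/
def coordEquiv : 𝔭 ≃ₗ[ℝ] (Fin 7 → ℝ) :=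
  { LinearMap.pi coframe with
    invFun := fun t => ∑ i, t i • frame i
    left_inv := fun X => ext_coframe fun j => by
      simp [map_sum, coframe_frame]
    right_inv := fun t => by
      funext j
      simp [map_sum, coframe_frame] }

@[simp] theorem coordEquiv_apply (X : 𝔭) (i : Fin 7) : coordEquiv X i = coframe i X := rfl

/-- `e₁, …, e₇` as a basis. -/
def frameBasis : Basis (Fin 7) ℝ 𝔭 := Basis.ofEquivFun coordEquiv

@[simp] theorem frameBasis_apply (i : Fin 7) : frameBasis i = frame i := by
  refine ext_coframe fun j => ?_
  have : coordEquiv (frameBasis i) = Pi.single i 1 := by simp [frameBasis]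
  rw [← coordEquiv_apply, this, coframe_frame, Pi.single_apply]

@[simp] theorem frameBasis_repr (X : 𝔭) (i : Fin 7) : frameBasis.repr X i = coframe i X := rfl

/-! ### Elementary forms and their exterior products -/

section

variable {ι κ : Type*} [Fintype ι] [Fintype κ] [DecidableEq ι] [DecidableEq κ]

/-- The exterior product of the coordinate forms `e^{f r}`. -/
def elemForm (f : ι → Fin 7) : 𝔭 [⋀^ι]→ₗ[ℝ] ℝ :=
  Matrix.detRowAlternating.compLinearMap (LinearMap.pi fun r => coframe (f r))

theorem elemForm_apply (f : ι → Fin 7) (v : ι → 𝔭) :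
    elemForm f v = Matrix.det (Matrix.of fun a r => coframe (f r) (v a)) := rfl

theorem e3_eq_elemForm (i j k : Fin 7) : e3 i j k = elemForm ![i, j, k] := by
  rw [e3, elemForm]
  congr 2
  funext r
  fin_cases r <;> rfl

/-- The product of the coordinate forms `e^{f r}`. -/
def prodForm (f : ι → Fin 7) : MultilinearMap ℝ (fun _ : ι => 𝔭) ℝ :=
  (MultilinearMap.mkPiAlgebra ℝ ι ℝ).compLinearMap fun r => coframe (f r)

theorem elemForm_eq_alternatization (f : ι → Fin 7) :
    elemForm f = MultilinearMap.alternatization (prodForm f) := by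
  ext v
  rw [elemForm_apply, Matrix.det_apply, MultilinearMap.alternatization_apply]
  refine Finset.sum_congr rfl fun σ _ => ?_
  simp [prodForm]

/-- Alternatization turns the product of multilinear maps into the shuffle product of alternating
maps without any factorials, and both sides alternatize the same product of coordinates. -/
theorem wedge_elemForm (f : ι → Fin 7) (g : κ → Fin 7) :
    wedge (elemForm f) (elemForm g) = elemForm (Sum.elim f g) := by
  rw [elemForm_eq_alternatization f, elemForm_eq_alternatization g, wedge,
    ← MultilinearMap.domCoprod_alternization, elemForm_eq_alternatization]
  rw [← LinearMap.compMultilinearMap_alternatization]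
  congr 1
  ext v
  simp [prodForm, MultilinearMap.domCoprod_apply, Fintype.prod_sum_type]

section wedge

variable {V W : Type*} [AddCommGroup V] [Module ℝ V] [AddCommGroup W] [Module ℝ W]

/-- The exterior product as a bilinear map. -/
def wedgeₗ : (V [⋀^ι]→ₗ[ℝ] ℝ) →ₗ[ℝ] (V [⋀^κ]→ₗ[ℝ] ℝ) →ₗ[ℝ] V [⋀^ι ⊕ κ]→ₗ[ℝ] ℝ :=
  (TensorProduct.mk ℝ _ _).compr₂
    (((LinearMap.mul' ℝ ℝ).compAlternatingMapₗ (ι := ι ⊕ κ) (M := V) (R := ℝ) (S := ℝ)) ∘ₗ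
      AlternatingMap.domCoprod')

theorem wedgeₗ_apply (α : V [⋀^ι]→ₗ[ℝ] ℝ) (β : V [⋀^κ]→ₗ[ℝ] ℝ) : wedgeₗ α β = wedge α β := rfl

theorem wedge_compLinearMap (α : V [⋀^ι]→ₗ[ℝ] ℝ) (β : V [⋀^κ]→ₗ[ℝ] ℝ) (L : W →ₗ[ℝ] V) :
    wedge (α.compLinearMap L) (β.compLinearMap L) = (wedge α β).compLinearMap L := by
  ext v
  simp only [wedge, LinearMap.compAlternatingMap_apply, AlternatingMap.compLinearMap_apply,
    AlternatingMap.domCoprod_apply, _root_.sum_apply]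
  congr 1
  refine Finset.sum_congr rfl fun σ _ => ?_
  induction σ using Quotient.inductionOn'
  simp [AlternatingMap.domCoprod.summand_mk'', MultilinearMap.domCoprod_apply]

end wedge

end

/-! ### The Levi-Civita symbol -/

/-- The sign of `b - a`. -/
def sgn (a b : Fin 7) : ℤ := if a < b then 1 else if b < a then -1 else 0

/-- The Levi-Civita symbol. -/
def leviCivita (s : Fin 7 → Fin 7) : ℤ :=
  sgn (s 0) (s 1) * sgn (s 0) (s 2) * sgn (s 0) (s 3) * sgn (s 0) (s 4) * sgn (s 0) (s 5) *
  sgn (s 0) (s 6) * sgn (s 1) (s 2) * sgn (s 1) (s 3) * sgn (s 1) (s 4) * sgn (s 1) (s 5) *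
  sgn (s 1) (s 6) * sgn (s 2) (s 3) * sgn (s 2) (s 4) * sgn (s 2) (s 5) * sgn (s 2) (s 6) *
  sgn (s 3) (s 4) * sgn (s 3) (s 5) * sgn (s 3) (s 6) * sgn (s 4) (s 5) * sgn (s 4) (s 6) *
  sgn (s 5) (s 6)

/-- The expanded product is what the kernel evaluates in `sum_leviCivita`; the product over pairs `i
< j` is the form that meets the formula for the sign of a permutation. -/
theorem leviCivita_eq_prod (s : Fin 7 → Fin 7) :
    leviCivita s = ∏ i, ∏ j ∈ Finset.Ioi i, sgn (s i) (s j) := by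
  have h0 : Finset.Ioi (0 : Fin 7) = {1, 2, 3, 4, 5, 6} := by decide
  have h1 : Finset.Ioi (1 : Fin 7) = {2, 3, 4, 5, 6} := by decide
  have h2 : Finset.Ioi (2 : Fin 7) = {3, 4, 5, 6} := by decide
  have h3 : Finset.Ioi (3 : Fin 7) = {4, 5, 6} := by decide
  have h4 : Finset.Ioi (4 : Fin 7) = {5, 6} := by decide
  have h5 : Finset.Ioi (5 : Fin 7) = {6} := by decide
  have h6 : Finset.Ioi (6 : Fin 7) = ∅ := by decide
  rw [Fin.prod_univ_seven, h0, h1, h2, h3, h4, h5, h6]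
  simp [leviCivita, mul_assoc]

/-- An injective `s` is a permutation applied to the columns of the identity. Otherwise two columns
agree, and the factor `sgn` of that pair is `0`. -/
theorem det_eq_leviCivita (s : Fin 7 → Fin 7) :
    Matrix.det (Matrix.of fun a r => if s r = a then (1 : ℝ) else 0) = leviCivita s := by
  rw [leviCivita_eq_prod]
  by_cases hs : Function.Injective s
  · set σ : Equiv.Perm (Fin 7) := Equiv.ofBijective s (Finite.injective_iff_bijective.1 hs) with hσ
    have h1 : (Matrix.of fun a r => if s r = a then (1 : ℝ) else 0) =
        ((1 : Matrix (Fin 7) (Fin 7) ℝ).submatrix id σ) := by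
      ext a r
      simp [Matrix.one_apply, hσ, eq_comm]
    have h2 : ∏ i, ∏ j ∈ Finset.Ioi i, sgn (s i) (s j) = (Equiv.Perm.sign σ : ℤ) := by
      rw [Equiv.Perm.sign_eq_prod_prod_Ioi]
      push_cast
      refine Finset.prod_congr rfl fun i _ => Finset.prod_congr rfl fun j hj => ?_
      have hij : s i ≠ s j := fun h => (Finset.mem_Ioi.1 hj).ne (hs h)
      change sgn (s i) (s j) = (((if s i < s j then 1 else -1 : ℤˣ)) : ℤ)
      rcases lt_or_gt_of_ne hij with h | h
      · simp [sgn, h]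
      · simp [sgn, h, h.not_gt]
    rw [h1, Matrix.det_permute', h2]
    simp
  · simp only [Function.Injective, not_forall] at hs
    obtain ⟨i, j, h, hij⟩ := hs
    rw [Matrix.det_zero_of_column_eq hij (by intro a; simp [h])]
    rcases lt_or_gt_of_ne hij with hl | hl
    · rw [Finset.prod_eq_zero (Finset.mem_univ i)
        (Finset.prod_eq_zero (Finset.mem_Ioi.2 hl) (by simp [sgn, h]))]
      simp
    · rw [Finset.prod_eq_zero (Finset.mem_univ j)
        (Finset.prod_eq_zero (Finset.mem_Ioi.2 hl) (by simp [sgn, h]))]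
      simp

/-- The positions of the arguments in a product of two 2-forms and a 3-form. -/
def slot : Fin 7 → (Fin 2 ⊕ Fin 2) ⊕ Fin 3 :=
  ![.inl (.inl 0), .inl (.inl 1), .inl (.inr 0), .inl (.inr 1), .inr 0, .inr 1, .inr 2]

/-- `slot` as an equivalence. -/
def slotEquiv : Fin 7 ≃ (Fin 2 ⊕ Fin 2) ⊕ Fin 3 :=
  Equiv.ofBijective slot (by decide)

/-- Seven vectors as arguments of a product of two 2-forms and a 3-form. -/
def slotVec {V : Type*} (b : Fin 7 → V) : (Fin 2 ⊕ Fin 2) ⊕ Fin 3 → V :=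
  Sum.elim (Sum.elim ![b 0, b 1] ![b 2, b 3]) ![b 4, b 5, b 6]

theorem slotVec_slot {V : Type*} (b : Fin 7 → V) (i : Fin 7) : slotVec b (slotEquiv i) = b i := by
  fin_cases i <;> rfl

theorem elemForm_slotVec (s : (Fin 2 ⊕ Fin 2) ⊕ Fin 3 → Fin 7) :
    elemForm s (slotVec frame) = leviCivita (s ∘ slot) := by
  rw [elemForm_apply, ← Matrix.det_submatrix_equiv_self slotEquiv, ← det_eq_leviCivita]
  congr 1
  ext a r
  simp only [Matrix.submatrix_apply, Matrix.of_apply, slotVec_slot, coframe_frame]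
  rfl

theorem BMatrix_apply {V : Type*} [AddCommGroup V] [Module ℝ V] (φ : V [⋀^Fin 3]→ₗ[ℝ] ℝ)
    (b : Fin 7 → V) (i j : Fin 7) : BMatrix φ b i j =
      wedge (wedge (φ.curryLeft (b i)) (φ.curryLeft (b j))) φ (slotVec b) := by
  rw [BMatrix, Matrix.of_apply, slotVec]

/-! ### The form `φ₀` -/

/-- The seven terms of `φ₀`. -/
def tripleIdx : Fin 7 → Fin 3 → Fin 7 :=
  -- The minus sign of `-e²⁵⁷` is absorbed by the order of the indices, as `![1, 6, 4]`.
  ![![0, 1, 2], ![0, 3, 6], ![0, 4, 5], ![1, 3, 5], ![1, 6, 4], ![2, 3, 4], ![2, 5, 6]]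

/-- The three terms of `eᵢ ⌟ φ₀`. -/
def pairIdx : Fin 7 → Fin 3 → Fin 2 → Fin 7 :=
  ![![![1, 2], ![3, 6], ![4, 5]], ![![2, 0], ![3, 5], ![6, 4]], ![![0, 1], ![3, 4], ![5, 6]],
    ![![6, 0], ![5, 1], ![4, 2]], ![![5, 0], ![1, 6], ![2, 3]], ![![0, 4], ![1, 3], ![6, 2]],
    ![![0, 3], ![4, 1], ![2, 5]]]

theorem e3_apply (i j k : Fin 7) (v : Fin 3 → 𝔭) : e3 i j k v =
    coframe i (v 0) * coframe j (v 1) * coframe k (v 2) -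
    coframe i (v 0) * coframe k (v 1) * coframe j (v 2) -
    coframe j (v 0) * coframe i (v 1) * coframe k (v 2) +
    coframe j (v 0) * coframe k (v 1) * coframe i (v 2) +
    coframe k (v 0) * coframe i (v 1) * coframe j (v 2) -
    coframe k (v 0) * coframe j (v 1) * coframe i (v 2) := by
  rw [e3_eq_elemForm, elemForm_apply, Matrix.det_fin_three]
  simp

theorem elemForm_two_apply (f : Fin 2 → Fin 7) (v : Fin 2 → 𝔭) : elemForm f v =
    coframe (f 0) (v 0) * coframe (f 1) (v 1) - coframe (f 1) (v 0) * coframe (f 0) (v 1) := by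
  rw [elemForm_apply, Matrix.det_fin_two]
  simp

theorem φ₀_eq_sum : φ₀ = ∑ t, elemForm (tripleIdx t) := by
  have h : ∀ i j k, elemForm ![i, j, k] = e3 i j k := fun i j k => (e3_eq_elemForm i j k).symm
  ext v
  simp only [φ₀, eWedgeOmega, tripleIdx, Fin.sum_univ_seven, Matrix.cons_val, h,
    AlternatingMap.add_apply, AlternatingMap.sub_apply, e3_apply]
  ring

theorem curryLeft_φ₀ (i : Fin 7) : φ₀.curryLeft (frame i) = ∑ r, elemForm (pairIdx i r) := by
  ext v
  rw [AlternatingMap.curryLeft_apply_apply]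
  simp only [φ₀, eWedgeOmega, pairIdx, Fin.sum_univ_three, Matrix.cons_val,
    AlternatingMap.add_apply, AlternatingMap.sub_apply, e3_apply, elemForm_two_apply,
    coframe_frame]
  fin_cases i <;> simp <;> ring

/-- This is `(eᵢ ⌟ φ₀) ∧ (eⱼ ⌟ φ₀) ∧ φ₀ = 6 δᵢⱼ e¹…⁷` as an integer identity: for each `i`, `j` a
sum of `3 · 3 · 7` symbols. -/
theorem sum_leviCivita : ∀ i j : Fin 7,
    ∑ r, ∑ s, ∑ t, leviCivita (Sum.elim (Sum.elim (pairIdx i r) (pairIdx j s)) (tripleIdx t) ∘ slot)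
      = if i = j then 6 else 0 := by
  decide +kernel

theorem alternating_sum_apply {V ι δ : Type*} [AddCommGroup V] [Module ℝ V] (s : Finset δ)
    (f : δ → V [⋀^ι]→ₗ[ℝ] ℝ) (v : ι → V) : (∑ x ∈ s, f x) v = ∑ x ∈ s, f x v := by
  classical
  induction s using Finset.induction_on with
  | empty => simp
  | insert a s ha ih => rw [Finset.sum_insert ha, Finset.sum_insert ha, ← ih]; rfl

theorem wedge_sum_left {V ι κ δ : Type*} [AddCommGroup V] [Module ℝ V] [Fintype ι] [Fintype κ]
    [DecidableEq ι] [DecidableEq κ] [Fintype δ] (f : δ → V [⋀^ι]→ₗ[ℝ] ℝ) (β : V [⋀^κ]→ₗ[ℝ] ℝ) :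
    wedge (∑ x, f x) β = ∑ x, wedge (f x) β := by
  simp only [← wedgeₗ_apply, map_sum, LinearMap.sum_apply]

theorem wedge_sum_right {V ι κ δ : Type*} [AddCommGroup V] [Module ℝ V] [Fintype ι] [Fintype κ]
    [DecidableEq ι] [DecidableEq κ] [Fintype δ] (α : V [⋀^ι]→ₗ[ℝ] ℝ) (f : δ → V [⋀^κ]→ₗ[ℝ] ℝ) :
    wedge α (∑ x, f x) = ∑ x, wedge α (f x) := by
  simp only [← wedgeₗ_apply, map_sum]

theorem wedge_sum_elemForm_slotVec {α β γ : Type*} [Fintype α] [Fintype β] [Fintype γ]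
    (p : α → Fin 2 → Fin 7) (q : β → Fin 2 → Fin 7) (k : γ → Fin 3 → Fin 7) :
    wedge (wedge (∑ r, elemForm (p r)) (∑ s, elemForm (q s))) (∑ t, elemForm (k t))
      (slotVec frame) =
    ((∑ r, ∑ s, ∑ t, leviCivita (Sum.elim (Sum.elim (p r) (q s)) (k t) ∘ slot) : ℤ) : ℝ) := by
  rw [wedge_sum_left, wedge_sum_left, alternating_sum_apply, Int.cast_sum]
  refine Finset.sum_congr rfl fun r _ => ?_
  rw [wedge_sum_right (elemForm (p r)), wedge_sum_left, alternating_sum_apply, Int.cast_sum]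
  refine Finset.sum_congr rfl fun s _ => ?_
  rw [wedge_sum_right, alternating_sum_apply, Int.cast_sum]
  refine Finset.sum_congr rfl fun t _ => ?_
  rw [wedge_elemForm, wedge_elemForm, elemForm_slotVec]

theorem BMatrix_φ₀_frame : BMatrix φ₀ frame = (6 : ℝ) • (1 : Matrix (Fin 7) (Fin 7) ℝ) := by
  ext i j
  rw [BMatrix_apply, curryLeft_φ₀, curryLeft_φ₀]
  conv_lhs => rw [φ₀_eq_sum]
  rw [wedge_sum_elemForm_slotVec, sum_leviCivita i j, Matrix.smul_apply, Matrix.one_apply]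
  simp

end SpSphere
end

noncomputable section

namespace SpSphere

/-! ### The metric of a `G₂`-form -/

/-- The inner product on `𝔭` for which `e₁, …, e₇` is orthonormal. -/
def stdIP : 𝔭 →ₗ[ℝ] 𝔭 →ₗ[ℝ] ℝ := ∑ i, (LinearMap.mul ℝ ℝ).compl₁₂ (coframe i) (coframe i)

theorem stdIP_apply (X Y : 𝔭) : stdIP X Y = ∑ i, coframe i X * coframe i Y := by
  simp [stdIP]

theorem stdIP_self_nonneg (X : 𝔭) : 0 ≤ stdIP X X := by
  rw [stdIP_apply]
  exact Finset.sum_nonneg fun i _ => mul_self_nonneg _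

theorem stdIP_self_eq_zero {X : 𝔭} (h : stdIP X X = 0) : X = 0 := by
  rw [stdIP_apply, Finset.sum_eq_zero_iff_of_nonneg fun i _ => mul_self_nonneg _] at h
  refine ext_coframe fun i => ?_
  rw [map_zero]
  exact mul_self_eq_zero.1 (h i (Finset.mem_univ i))

theorem stdIP_self_pos {X : 𝔭} (h : X ≠ 0) : 0 < stdIP X X :=
  (stdIP_self_nonneg X).lt_of_ne fun h' => h (stdIP_self_eq_zero h'.symm)

theorem slotVec_comp {V W : Type*} (L : V → W) (b : Fin 7 → V) :
    slotVec (fun i => L (b i)) = fun x => L (slotVec b x) := by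
  funext x
  obtain ⟨i, rfl⟩ := slotEquiv.surjective x
  rw [slotVec_slot, slotVec_slot]

theorem slotVec_eq_comp {V : Type*} (b : Fin 7 → V) :
    slotVec b = fun x => b (slotEquiv.symm x) := by
  funext x
  obtain ⟨i, rfl⟩ := slotEquiv.surjective x
  rw [slotVec_slot, Equiv.symm_apply_apply]

section

variable {V W : Type*} [AddCommGroup V] [Module ℝ V] [AddCommGroup W] [Module ℝ W]

theorem BMatrix_compLinearMap (φ : W [⋀^Fin 3]→ₗ[ℝ] ℝ) (L : V →ₗ[ℝ] W) (b : Fin 7 → V) :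
    BMatrix (φ.compLinearMap L) b = BMatrix φ (fun i => L (b i)) := by
  ext i j
  rw [BMatrix_apply, BMatrix_apply, AlternatingMap.curryLeft_compLinearMap,
    AlternatingMap.curryLeft_compLinearMap, wedge_compLinearMap, wedge_compLinearMap, slotVec_comp L b,
    AlternatingMap.compLinearMap_apply]

/-- The bilinear form `A u ∧ B v ∧ γ` evaluated on `x`. -/
def tripleForm {ι κ μ : Type*} [Fintype ι] [Fintype κ] [Fintype μ] [DecidableEq ι]
    [DecidableEq κ] [DecidableEq μ] (A : V →ₗ[ℝ] V [⋀^ι]→ₗ[ℝ] ℝ) (B : V →ₗ[ℝ] V [⋀^κ]→ₗ[ℝ] ℝ)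
    (γ : V [⋀^μ]→ₗ[ℝ] ℝ) (x : (ι ⊕ κ) ⊕ μ → V) : V →ₗ[ℝ] V →ₗ[ℝ] ℝ :=
  LinearMap.mk₂ ℝ (fun u v => wedge (wedge (A u) (B v)) γ x)
    (fun u u' v => by simp [← wedgeₗ_apply])
    (fun c u v => by simp [← wedgeₗ_apply])
    (fun u v v' => by simp [← wedgeₗ_apply])
    (fun c u v => by simp [← wedgeₗ_apply])

theorem tripleForm_apply {ι κ μ : Type*} [Fintype ι] [Fintype κ] [Fintype μ] [DecidableEq ι]
    [DecidableEq κ] [DecidableEq μ] (A : V →ₗ[ℝ] V [⋀^ι]→ₗ[ℝ] ℝ) (B : V →ₗ[ℝ] V [⋀^κ]→ₗ[ℝ] ℝ)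
    (γ : V [⋀^μ]→ₗ[ℝ] ℝ) (x : (ι ⊕ κ) ⊕ μ → V) (u v : V) :
    tripleForm A B γ x u v = wedge (wedge (A u) (B v)) γ x := rfl

/-- The bilinear form `(u ⌟ φ) ∧ (v ⌟ φ) ∧ φ` evaluated on `w`. -/
def BForm (φ : V [⋀^Fin 3]→ₗ[ℝ] ℝ) (w : Fin 7 → V) : V →ₗ[ℝ] V →ₗ[ℝ] ℝ :=
  tripleForm φ.curryLeft φ.curryLeft φ (slotVec w)

theorem BMatrix_eq_BForm (φ : V [⋀^Fin 3]→ₗ[ℝ] ℝ) (b : Fin 7 → V) (i j : Fin 7) :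
    BMatrix φ b i j = BForm φ b (b i) (b j) := by
  rw [BMatrix_apply, BForm, tripleForm_apply]

end

theorem coe_frameBasis : (frameBasis : Fin 7 → 𝔭) = frame := funext frameBasis_apply

theorem alternating_apply_eq_det {κ : Type*} (e : Fin 7 ≃ κ) (ψ : 𝔭 [⋀^κ]→ₗ[ℝ] ℝ)
    (w : Fin 7 → 𝔭) :
    ψ (fun x => w (e.symm x)) = frameBasis.det w * ψ (fun x => frame (e.symm x)) := by
  have h := AlternatingMap.eq_smul_basis_det frameBasis (ψ.domDomCongr e.symm)
  have h1 := congrArg (fun f => f w) h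
  rw [coe_frameBasis] at h1
  simp only [AlternatingMap.smul_apply, smul_eq_mul, AlternatingMap.domDomCongr_apply] at h1
  rw [mul_comm]
  exact h1

/-- For fixed `u`, `v` this is a 7-form on a 7-dimensional space. `BForm` separates the vectors
contracted with `φ` from the frame on which the 7-form is evaluated. -/
theorem BForm_eq_det (φ : 𝔭 [⋀^Fin 3]→ₗ[ℝ] ℝ) (w : Fin 7 → 𝔭) (u v : 𝔭) :
    BForm φ w u v = frameBasis.det w * BForm φ frame u v := by
  rw [BForm, BForm, tripleForm_apply, tripleForm_apply, slotVec_eq_comp w, slotVec_eq_comp frame,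
    alternating_apply_eq_det]

theorem BForm_φ₀_frame (u v : 𝔭) : BForm φ₀ frame u v = 6 * stdIP u v := by
  have h : BForm φ₀ frame = (6 : ℝ) • stdIP := by
    refine LinearMap.ext_basis frameBasis frameBasis fun i j => ?_
    rw [frameBasis_apply, frameBasis_apply, ← BMatrix_eq_BForm, BMatrix_φ₀_frame]
    simp [stdIP_apply, coframe_frame, Matrix.one_apply, eq_comm]
  rw [h]
  rfl

section

variable {V : Type*} [AddCommGroup V] [Module ℝ V]

theorem BMatrix_φ₀_comp (L : V →ₗ[ℝ] 𝔭) (b : Fin 7 → V) (i j : Fin 7) :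
    BMatrix (φ₀.compLinearMap L) b i j =
      6 * frameBasis.det (fun i => L (b i)) * stdIP (L (b i)) (L (b j)) := by
  rw [BMatrix_compLinearMap, BMatrix_eq_BForm, BForm_eq_det, BForm_φ₀_frame]
  ring

/-- With `δ` the determinant of the vectors `L (b i)` in the frame, the matrix is `6δ` times a Gram
matrix of determinant `δ²`, so the exponent of `δ` is `7 + 2`. -/
theorem det_BMatrix_φ₀_comp (L : V →ₗ[ℝ] 𝔭) (b : Fin 7 → V) :
    (BMatrix (φ₀.compLinearMap L) b).det = 6 ^ 7 * frameBasis.det (fun i => L (b i)) ^ 9 := by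
  have h : BMatrix (φ₀.compLinearMap L) b = (6 * frameBasis.det (fun i => L (b i))) •
      ((frameBasis.toMatrix (fun i => L (b i)))ᵀ * frameBasis.toMatrix (fun i => L (b i))) := by
    ext i j
    rw [BMatrix_φ₀_comp, stdIP_apply, Matrix.smul_apply, Matrix.mul_apply]
    rfl
  rw [h, Matrix.det_smul, Matrix.det_mul, Matrix.det_transpose, ← Basis.det_apply, Fintype.card_fin]
  ring

theorem frameBasis_det_ne_zero (L : V ≃ₗ[ℝ] 𝔭) (b : Basis (Fin 7) ℝ V) :
    frameBasis.det (fun i => L (b i)) ≠ 0 := by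
  have h := frameBasis.isUnit_det (b.map L)
  have h2 : ((b.map L : Basis (Fin 7) ℝ 𝔭) : Fin 7 → 𝔭) = fun i => L (b i) := by
    funext i
    simp
  rw [h2] at h
  exact h.ne_zero

theorem isMetricOf_φ₀_comp_aux (L : V ≃ₗ[ℝ] 𝔭) (g : V → V → ℝ) :
    IsMetricOf (φ₀.compLinearMap (L : V →ₗ[ℝ] 𝔭)) g ↔
      ∀ (b : Basis (Fin 7) ℝ V) (i j : Fin 7), g (b i) (b j) = stdIP (L (b i)) (L (b j)) := by
  refine forall_congr' fun b => ?_
  have hδ := frameBasis_det_ne_zero L b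
  set δ := frameBasis.det (fun i => L (b i)) with hδ'
  -- The real ninth root is unique because `r ↦ r⁹` is strictly increasing. Since `6^(2/9) · 6^(7/9)
  -- = 6`, the whole factor `6δ` cancels, sign included: the metric does not see the orientation.
  have hr : ∀ r : ℝ, r ^ 9 = (6 : ℝ) ^ 7 * δ ^ 9 ↔ r = (6 : ℝ) ^ (7 / 9 : ℝ) * δ := by
    intro r
    have h6 : ((6 : ℝ) ^ (7 / 9 : ℝ)) ^ 9 = 6 ^ 7 := by
      rw [← Real.rpow_natCast, ← Real.rpow_mul (by norm_num)]
      norm_num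
    rw [← h6, ← mul_pow]
    exact (Odd.strictMono_pow (by decide : Odd 9)).injective.eq_iff
  have h7 : (6 : ℝ) ^ (2 / 9 : ℝ) * (6 : ℝ) ^ (7 / 9 : ℝ) = 6 := by
    rw [← Real.rpow_add (by norm_num)]
    norm_num
  have hB : ∀ i j, BMatrix (φ₀.compLinearMap (L : V →ₗ[ℝ] 𝔭)) b i j =
      6 * δ * stdIP (L (b i)) (L (b j)) := BMatrix_φ₀_comp (L : V →ₗ[ℝ] 𝔭) b
  have hdet : (BMatrix (φ₀.compLinearMap (L : V →ₗ[ℝ] 𝔭)) b).det = 6 ^ 7 * δ ^ 9 :=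
    det_BMatrix_φ₀_comp (L : V →ₗ[ℝ] 𝔭) b
  simp only [hdet, hr, exists_eq_left, hB]
  refine forall_congr' fun i => forall_congr' fun j => ?_
  rw [← mul_assoc, h7, mul_div_cancel_left₀ _ (mul_ne_zero (by norm_num) hδ)]

theorem isMetricOf_φ₀_comp (L : V ≃ₗ[ℝ] 𝔭) (g : V →ₗ[ℝ] V →ₗ[ℝ] ℝ) :
    IsMetricOf (φ₀.compLinearMap (L : V →ₗ[ℝ] 𝔭)) (fun v w => g v w) ↔
      ∀ v w, g v w = stdIP (L v) (L w) := by
  rw [isMetricOf_φ₀_comp_aux]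
  refine ⟨fun h => ?_, fun h b i j => h _ _⟩
  have : g = stdIP.compl₁₂ (L : V →ₗ[ℝ] 𝔭) (L : V →ₗ[ℝ] 𝔭) :=
    LinearMap.ext_basis (frameBasis.map L.symm) (frameBasis.map L.symm) fun i j => h _ i j
  intro v w
  rw [this]
  rfl

end

/-! ### Stability of `φ₀` -/

/-- Comparing the `(0, 0)` entries of the `B`-matrices gives `6 = 6 det L · |L e₁|²`. -/
theorem det_pos_of_stabilizer (L : 𝔭 →ₗ[ℝ] 𝔭) (h : φ₀.compLinearMap L = φ₀) :
    0 < LinearMap.det L := by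
  have h1 := BMatrix_φ₀_comp L frame 0 0
  have h3 : frameBasis.det (fun i => L (frame i)) = LinearMap.det L := by
    have := Basis.det_comp frameBasis L frameBasis
    rwa [Basis.det_self, mul_one, coe_frameBasis] at this
  rw [h, BMatrix_φ₀_frame, h3] at h1
  simp only [Matrix.smul_apply, Matrix.one_apply_eq, smul_eq_mul, mul_one] at h1
  have h4 := stdIP_self_nonneg (L (frame 0))
  by_contra h5
  nlinarith

/-- The cross product identity `|u × w|² = |u|²|w|² - ⟨u, w⟩²`, where `⟨u × w, z⟩ = φ₀(u, w, z)`. -/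
theorem sum_φ₀_sq (u w : 𝔭) : ∑ k, φ₀ ![u, w, frame k] ^ 2 =
    stdIP u u * stdIP w w - stdIP u w ^ 2 := by
  simp only [φ₀, eWedgeOmega, Matrix.cons_val, Fin.sum_univ_seven,
    AlternatingMap.add_apply, AlternatingMap.sub_apply, e3_apply, coframe_frame, stdIP_apply]
  simp
  ring

/-- A vanishing cross product means equality in Cauchy–Schwarz: the difference of the two sides has
squared length `|u|² (|u|²|w|² - ⟨u, w⟩²)`. -/
theorem smul_eq_smul_of_φ₀_eq_zero (u w : 𝔭) (h : ∀ z, φ₀ ![u, w, z] = 0) :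
    stdIP u u • w = stdIP u w • u := by
  have h1 := sum_φ₀_sq u w
  simp only [h] at h1
  have hs : stdIP w u = stdIP u w := by simp [stdIP_apply, mul_comm]
  rw [← sub_eq_zero]
  apply stdIP_self_eq_zero
  simp only [map_sub, LinearMap.sub_apply, map_smul, LinearMap.smul_apply, smul_eq_mul, hs]
  simp at h1
  linear_combination (-stdIP u u) * h1

end SpSphere
end

/-! ### Invariant tensors on `𝔭` and the positive invariant 3-forms. -/

noncomputable section

namespace SpSphere

/-! ### The isotropy representation in quaternionic coordinates -/

theorem Ad_apply_11 (h : Sp1) (X : 𝔭) : (Ad h X).1 1 1 = X.1 1 1 := by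
  obtain ⟨⟨h, hh⟩, q, hq⟩ := h
  change h = _ at hq
  change (h * X.1 * hᴴ) 1 1 = _
  simp [hq, Matrix.mul_apply, Matrix.vecMul, dotProduct, Fin.sum_univ_two]

theorem Ad_apply_01 (h : Sp1) (X : 𝔭) : (Ad h X).1 0 1 = (h : Sp2).1 0 0 * X.1 0 1 := by
  obtain ⟨⟨h, hh⟩, q, hq⟩ := h
  change h = _ at hq
  change (h * X.1 * hᴴ) 0 1 = h 0 0 * X.1 0 1
  simp [hq, Matrix.mul_apply, Matrix.vecMul, dotProduct, Fin.sum_univ_two]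

theorem star_mul_self_of_Sp1 (h : Sp1) : star ((h : Sp2).1 0 0) * (h : Sp2).1 0 0 = 1 := by
  obtain ⟨⟨h, hh⟩, q, hq⟩ := h
  change h = _ at hq
  have h1 := congrFun (congrFun hh.1 0) 0
  simpa [hq, Matrix.mul_apply, Matrix.star_apply] using h1

/-- The element `diag(q, 1)` of `Sp(1)`. -/
def toSp1 (q : unitary ℍ[ℝ]) : Sp1 :=
  ⟨⟨!![(q : ℍ[ℝ]), 0; 0, 1], by
    have h1 := q.2.1
    have h2 := q.2.2
    constructor <;> ext i j : 1 <;> fin_cases i <;> fin_cases j <;>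
      simp [Matrix.mul_apply, Matrix.star_apply, h1, h2]⟩, q, rfl⟩

theorem toSp1_apply (q : unitary ℍ[ℝ]) : (toSp1 q : Sp2).1 0 0 = q := rfl

/-- The unit quaternions `1, i, j, k`. -/
def unitQuat (a : Fin 4) : unitary ℍ[ℝ] :=
  ⟨![quat 1 0 0 0, quat 0 1 0 0, quat 0 0 1 0, quat 0 0 0 1] a, by
    constructor <;> ext <;> fin_cases a <;> simp⟩

/-- The images of the frame under `Ad(i)` up to sign. -/
def permI : Fin 7 → Fin 7 := ![0, 1, 2, 6, 5, 4, 3]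

/-- The signs of the images of the frame under `Ad(i)`. -/
def signI : Fin 7 → ℝ := ![1, 1, 1, -1, 1, -1, 1]

/-- The images of the frame under `Ad(j)` up to sign. -/
def permJ : Fin 7 → Fin 7 := ![0, 1, 2, 5, 6, 3, 4]

/-- The signs of the images of the frame under `Ad(j)`. -/
def signJ : Fin 7 → ℝ := ![1, 1, 1, -1, -1, 1, 1]

/-- The eigenvalues of `Ad(-1)`. -/
def signNeg : Fin 7 → ℝ := ![1, 1, 1, -1, -1, -1, -1]

theorem ext_entries {X Y : 𝔭} (h1 : X.1 1 1 = Y.1 1 1) (h2 : X.1 0 1 = Y.1 0 1) : X = Y :=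
  ext_coframe fun i => by fin_cases i <;> simp [coframe, h1, h2]

theorem Ad_I_frame (a : Fin 7) :
    Ad (toSp1 (unitQuat 1)) (frame a) = signI a • frame (permI a) := by
  refine ext_entries ?_ ?_
  · rw [Ad_apply_11]
    fin_cases a <;> ext <;> simp [frame, frameMatrix, signI, permI]
  · rw [Ad_apply_01, toSp1_apply]
    fin_cases a <;> ext <;> simp [frame, frameMatrix, signI, permI, unitQuat]

theorem Ad_J_frame (a : Fin 7) :
    Ad (toSp1 (unitQuat 2)) (frame a) = signJ a • frame (permJ a) := by
  refine ext_entries ?_ ?_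
  · rw [Ad_apply_11]
    fin_cases a <;> ext <;> simp [frame, frameMatrix, signJ, permJ]
  · rw [Ad_apply_01, toSp1_apply]
    fin_cases a <;> ext <;> simp [frame, frameMatrix, signJ, permJ, unitQuat]

/-- Since `i² = -1`, applying `Ad(i)` twice fixes the vertical vectors and negates the horizontal
ones. -/
theorem Ad_neg_frame (a : Fin 7) :
    Ad (toSp1 (unitQuat 1)) (Ad (toSp1 (unitQuat 1)) (frame a)) = signNeg a • frame a := by
  rw [Ad_I_frame, map_smul, Ad_I_frame, smul_smul]
  fin_cases a <;> simp [signI, permI, signNeg] <;> exact (neg_one_smul ℝ _).symm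

/-! ### Invariant 3-forms -/

/-- The imaginary components of a quaternion. -/
def imc (l : Fin 3) : ℍ[ℝ] →ₗ[ℝ] ℝ where
  toFun q := ![q.imI, q.imJ, q.imK] l
  map_add' p q := by fin_cases l <;> simp
  map_smul' c q := by fin_cases l <;> simp

@[simp] theorem imc_zero (q : ℍ[ℝ]) : imc 0 q = q.imI := rfl

@[simp] theorem imc_one (q : ℍ[ℝ]) : imc 1 q = q.imJ := rfl

@[simp] theorem imc_two (q : ℍ[ℝ]) : imc 2 q = q.imK := rfl

/-- The 3-form `p e¹²³ + ∑ₗₘ Mₗₘ eᵐ ∧ ωₗ`. -/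
def genForm (p : ℝ) (M : Matrix (Fin 3) (Fin 3) ℝ) : 𝔭 [⋀^Fin 3]→ₗ[ℝ] ℝ :=
  p • e3 0 1 2 + ∑ l : Fin 3, ∑ m : Fin 3, M l m • eWedgeOmega (Fin.castLE (by norm_num) m) l

theorem phi_eq_genForm (a : ℝ) (D : Matrix (Fin 3) (Fin 3) ℝ) : phi a D = genForm (a ^ 3) D⁻¹ := rfl

/-- The 2-form `ωₗ` in terms of the hermitian product of two vectors. -/
def omegaC (l : Fin 3) (χ : ℍ[ℝ]) : ℝ := ![-2, 2, -2] l * imc l χ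

/-- The value of the 3-form with parameters `p`, `M` on three vectors, in terms of their vertical
components `η` and the hermitian products `χ` of their horizontal components. -/
def formValue (p : ℝ) (M : Matrix (Fin 3) (Fin 3) ℝ) (η : Fin 3 → ℍ[ℝ]) (χ : Fin 3 → Fin 3 → ℍ[ℝ]) :
    ℝ :=
  p * (Matrix.of fun i l => imc l (η i)).det +
    ∑ l, ∑ m, M l m * (imc m (η 0) * omegaC l (χ 1 2) - imc m (η 1) * omegaC l (χ 0 2) +
      imc m (η 2) * omegaC l (χ 0 1))

/-- The `ωₗ` are components of the quaternion `x* y`; the constants `-2, 2, -2` in `omegaC` combine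
the normalisation `1/√2` of `e₄, …, e₇` with signs. Invariance under `x ↦ h x` becomes evident. -/
theorem eWedgeOmega_apply (m : Fin 3) (l : Fin 3) (v : Fin 3 → 𝔭) :
    eWedgeOmega (Fin.castLE (by norm_num) m) l v =
      imc m ((v 0).1 1 1) * omegaC l (star ((v 1).1 0 1) * (v 2).1 0 1) -
      imc m ((v 1).1 1 1) * omegaC l (star ((v 0).1 0 1) * (v 2).1 0 1) +
      imc m ((v 2).1 1 1) * omegaC l (star ((v 0).1 0 1) * (v 1).1 0 1) := by
  have h : ∀ X, coframe (Fin.castLE (by norm_num) m) X = imc m (X.1 1 1) := fun X => by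
    fin_cases m <;> rfl
  have hs : √2 * √2 = (2 : ℝ) := Real.mul_self_sqrt (by norm_num)
  have hs' : √2 ^ 2 = (2 : ℝ) := Real.sq_sqrt (by norm_num)
  generalize (Fin.castLE _ m : Fin 7) = m' at h
  fin_cases l <;>
  · simp [eWedgeOmega, e3_apply, omegaC, h]
    simp [coframe]
    ring_nf
    rw [hs']
    ring

theorem genForm_apply (p : ℝ) (M : Matrix (Fin 3) (Fin 3) ℝ) (v : Fin 3 → 𝔭) :
    genForm p M v = formValue p M (fun i => (v i).1 1 1)
      (fun i j => star ((v i).1 0 1) * (v j).1 0 1) := by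
  rw [genForm, AlternatingMap.add_apply, AlternatingMap.smul_apply, alternating_sum_apply, formValue]
  have h1 : e3 0 1 2 v = (Matrix.of fun i l => imc l ((v i).1 1 1)).det := by
    rw [e3_apply, Matrix.det_fin_three]
    simp [coframe]
  rw [smul_eq_mul, h1]
  congr 1
  refine Finset.sum_congr rfl fun l _ => ?_
  exact (alternating_sum_apply _ _ _).trans (Finset.sum_congr rfl fun m _ =>
    (AlternatingMap.smul_apply _ _ _).trans (congrArg (M l m • ·) (eWedgeOmega_apply m l v)))

theorem star_Ad_mul_Ad (h : Sp1) (X Y : 𝔭) :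
    star ((Ad h X).1 0 1) * (Ad h Y).1 0 1 = star (X.1 0 1) * Y.1 0 1 := by
  rw [Ad_apply_01, Ad_apply_01, star_mul, mul_assoc, ← mul_assoc (star ((h : Sp2).1 0 0)),
    star_mul_self_of_Sp1, one_mul]

theorem genForm_mem (p : ℝ) (M : Matrix (Fin 3) (Fin 3) ℝ) : genForm p M ∈ InvForm𝔭 := by
  intro h
  ext v
  rw [AlternatingMap.compLinearMap_apply, genForm_apply, genForm_apply]
  simp only [star_Ad_mul_Ad, Ad_apply_11]

theorem InvForm𝔭.apply_Ad {ψ : 𝔭 [⋀^Fin 3]→ₗ[ℝ] ℝ} (hψ : ψ ∈ InvForm𝔭) (h : Sp1) (v : Fin 3 → 𝔭) :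
    ψ (fun i => Ad h (v i)) = ψ v := by
  have := congrArg (fun f => f v) (hψ h)
  simpa using this

/-- A group element which permutes the frame up to signs turns invariance into relations between
single coefficients. -/
theorem InvForm𝔭.apply_frame_signed {ψ : 𝔭 [⋀^Fin 3]→ₗ[ℝ] ℝ} {h : 𝔭 → 𝔭}
    (hψ : ∀ v : Fin 3 → 𝔭, ψ (fun i => h (v i)) = ψ v) {s : Fin 7 → ℝ} {π : Fin 7 → Fin 7}
    (hh : ∀ a, h (frame a) = s a • frame (π a)) (a b c : Fin 7) :
    ψ ![frame a, frame b, frame c] =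
      s a * s b * s c * ψ ![frame (π a), frame (π b), frame (π c)] := by
  have h1 := hψ ![frame a, frame b, frame c]
  have h2 : (fun i => h (![frame a, frame b, frame c] i)) =
      fun i => ![s a, s b, s c] i • ![frame (π a), frame (π b), frame (π c)] i := by
    funext i
    fin_cases i <;> simp [hh]
  rw [h2, AlternatingMap.map_smul_univ, Fin.prod_univ_three] at h1
  exact h1.symm

/-- The cases sort by the number of horizontal indices: one or three (killed by `-1`), none, and
two. -/
theorem triple_cases : ∀ a b c : Fin 7, a < b → b < c →
    ((a < 3 ∧ b < 3 ∧ 3 ≤ c) ∨ (3 ≤ a ∧ 3 ≤ b ∧ 3 ≤ c)) ∨ (a = 0 ∧ b = 1 ∧ c = 2) ∨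
    (a < 3 ∧ ((b = 3 ∧ c = 4) ∨ (b = 3 ∧ c = 5) ∨ (b = 3 ∧ c = 6) ∨ (b = 4 ∧ c = 5) ∨
      (b = 4 ∧ c = 6) ∨ (b = 5 ∧ c = 6))) := by
  decide

theorem ext_of_sorted {ψ ψ' : 𝔭 [⋀^Fin 3]→ₗ[ℝ] ℝ}
    (h : ∀ a b c, a < b → b < c →
      ψ ![frame a, frame b, frame c] = ψ' ![frame a, frame b, frame c]) : ψ = ψ' := by
  refine Basis.ext_alternating frameBasis fun v hv => ?_
  set σ := Tuple.sort v
  have hm : StrictMono (v ∘ σ) :=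
    (Tuple.monotone_sort v).strictMono_of_injective (hv.comp σ.injective)
  have h1 : (fun i => frameBasis (v (σ i))) =
      ![frame (v (σ 0)), frame (v (σ 1)), frame (v (σ 2))] := by
    funext i
    fin_cases i <;> simp
  have h2 := h _ _ _ (hm (show (0 : Fin 3) < 1 by decide)) (hm (show (1 : Fin 3) < 2 by decide))
  simp only [Function.comp_apply] at h2
  rw [← h1] at h2
  have h3 := AlternatingMap.map_perm ψ (fun i => frameBasis (v i)) σ
  have h4 := AlternatingMap.map_perm ψ' (fun i => frameBasis (v i)) σ
  have h5 : Equiv.Perm.sign σ • ψ (fun i => frameBasis (v i)) =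
      Equiv.Perm.sign σ • ψ' (fun i => frameBasis (v i)) := by
    rw [← h3, ← h4]
    exact h2
  exact smul_left_cancel _ h5

theorem swap_last (ψ : 𝔭 [⋀^Fin 3]→ₗ[ℝ] ℝ) (X Y Z : 𝔭) : ψ ![X, Y, Z] = -ψ ![X, Z, Y] := by
  have h := AlternatingMap.map_swap ψ ![X, Z, Y] (show (1 : Fin 3) ≠ 2 by decide)
  rw [← h]
  congr 1
  funext i
  fin_cases i <;> rfl

/-- Coefficients with an odd number of horizontal indices vanish by `-1`. In the numbering from 0,
`i` exchanges the pairs `34`, `56` and the pairs `35`, `46` up to sign, and `j` exchanges `36`,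
`45`. So for each vertical index only three coefficients are free, and nine plus that of `e¹²³`
remain. -/
theorem eq_zero_of_mem_InvForm𝔭 {ψ : 𝔭 [⋀^Fin 3]→ₗ[ℝ] ℝ} (hψ : ψ ∈ InvForm𝔭)
    (h0 : ψ ![frame 0, frame 1, frame 2] = 0)
    (h1 : ∀ m, ψ ![frame m, frame 3, frame 4] = 0) (h2 : ∀ m, ψ ![frame m, frame 3, frame 5] = 0)
    (h3 : ∀ m, ψ ![frame m, frame 3, frame 6] = 0) : ψ = 0 := by
  have hI := InvForm𝔭.apply_frame_signed (InvForm𝔭.apply_Ad hψ (toSp1 (unitQuat 1))) Ad_I_frame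
  have hJ := InvForm𝔭.apply_frame_signed (InvForm𝔭.apply_Ad hψ (toSp1 (unitQuat 2))) Ad_J_frame
  have hN := InvForm𝔭.apply_frame_signed (π := id)
    (h := fun X => Ad (toSp1 (unitQuat 1)) (Ad (toSp1 (unitQuat 1)) X))
    (fun v => by rw [InvForm𝔭.apply_Ad hψ, InvForm𝔭.apply_Ad hψ]) Ad_neg_frame
  refine ext_of_sorted fun a b c hab hbc => ?_
  have hs1 : ∀ a : Fin 7, a < 3 → signNeg a = 1 ∧ signI a = 1 ∧ signJ a = 1 ∧ permI a = a ∧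
      permJ a = a := by
    intro a ha
    fin_cases a <;> first | (exact absurd ha (by decide)) | simp [signNeg, signI, signJ, permI, permJ]
  have hs2 : ∀ a : Fin 7, 3 ≤ a → signNeg a = -1 := by
    intro a ha
    fin_cases a <;> first | (exact absurd ha (by decide)) | simp [signNeg]
  rw [AlternatingMap.zero_apply]
  rcases triple_cases a b c hab hbc with (⟨ha, hb, hc⟩ | ⟨ha, hb, hc⟩) | ⟨rfl, rfl, rfl⟩ | ⟨ha, h⟩
  · have := hN a b c
    rw [(hs1 a ha).1, (hs1 b hb).1, hs2 c hc] at this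
    simp only [id] at this
    linarith
  · have := hN a b c
    rw [hs2 a ha, hs2 b hb, hs2 c hc] at this
    simp only [id] at this
    linarith
  · exact h0
  · obtain ⟨-, hi1, hj1, hi2, hj2⟩ := hs1 a ha
    have i34 := hI a 3 4
    have i35 := hI a 3 5
    have j36 := hJ a 3 6
    simp [signI, signJ, permI, permJ] at i34 i35 j36
    simp only [signI, signJ, permI, permJ] at hi1 hi2 hj1 hj2
    rw [hi1, hi2, h1] at i34
    rw [hi1, hi2, h2] at i35
    rw [hj1, hj2, h3] at j36
    have s1 := swap_last ψ (frame a) (frame 6) (frame 5)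
    have s2 := swap_last ψ (frame a) (frame 6) (frame 4)
    have s3 := swap_last ψ (frame a) (frame 5) (frame 4)
    rcases h with ⟨rfl, rfl⟩ | ⟨rfl, rfl⟩ | ⟨rfl, rfl⟩ | ⟨rfl, rfl⟩ | ⟨rfl, rfl⟩ | ⟨rfl, rfl⟩
    · exact h1 a
    · exact h2 a
    · exact h3 a
    · linarith
    · linarith
    · linarith

/-- The parameters of an invariant 3-form. -/
def formParam (ψ : 𝔭 [⋀^Fin 3]→ₗ[ℝ] ℝ) : ℝ × Matrix (Fin 3) (Fin 3) ℝ :=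
  -- The covector `e⁴` occurs in one term of each `ωₗ`, paired with `e⁷`, `e⁶`, `e⁵` respectively,
  -- so these values isolate the entries of `M`.
  (ψ ![frame 0, frame 1, frame 2], Matrix.of fun l m =>
    ψ ![frame (Fin.castLE (by norm_num) m), frame 3, frame (![6, 5, 4] l)])

theorem frame_00 (i : Fin 7) : (frame i).1 0 1 = ![0, 0, 0, quat 0 (√2)⁻¹ 0 0, quat 0 0 (√2)⁻¹ 0,
    quat 0 0 0 (√2)⁻¹, quat (√2)⁻¹ 0 0 0] i := by
  fin_cases i <;> simp [frame, frameMatrix]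

theorem frame_11 (i : Fin 7) : (frame i).1 1 1 =
    ![quat 0 1 0 0, quat 0 0 1 0, quat 0 0 0 1, 0, 0, 0, 0] i := by
  fin_cases i <;> simp [frame, frameMatrix]

theorem genForm_zero_one_two (p : ℝ) (M : Matrix (Fin 3) (Fin 3) ℝ) :
    genForm p M ![frame 0, frame 1, frame 2] = p := by
  rw [genForm_apply, formValue, Matrix.det_fin_three]
  simp [frame_00, frame_11, omegaC]

theorem genForm_frame (p : ℝ) (M : Matrix (Fin 3) (Fin 3) ℝ) (l m : Fin 3) :
    genForm p M ![frame (Fin.castLE (by norm_num) m), frame 3, frame (![6, 5, 4] l)] = M l m := by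
  have hs : (√2)⁻¹ * (√2)⁻¹ = (2 : ℝ)⁻¹ := by
    rw [← mul_inv, Real.mul_self_sqrt (by norm_num)]
  rw [genForm_apply, formValue, Matrix.det_fin_three]
  fin_cases l <;> fin_cases m <;>
    simp [frame_00, frame_11, omegaC, Fin.sum_univ_three, hs]

theorem formParam_genForm (p : ℝ) (M : Matrix (Fin 3) (Fin 3) ℝ) :
    formParam (genForm p M) = (p, M) :=
  Prod.ext (genForm_zero_one_two p M) (Matrix.ext fun l m => genForm_frame p M l m)

theorem genForm_formParam {ψ : 𝔭 [⋀^Fin 3]→ₗ[ℝ] ℝ} (hψ : ψ ∈ InvForm𝔭) :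
    genForm (formParam ψ).1 (formParam ψ).2 = ψ := by
  set p := (formParam ψ).1 with hp
  set M := (formParam ψ).2 with hM
  have hmem := InvForm𝔭.sub_mem (genForm_mem p M) hψ
  rw [← sub_eq_zero]
  have h3 : ∀ a : Fin 7, 3 ≤ a → signNeg a = -1 := by
    intro a ha
    fin_cases a <;> first | (exact absurd ha (by decide)) | simp [signNeg]
  have hN := InvForm𝔭.apply_frame_signed (π := id)
    (h := fun X => Ad (toSp1 (unitQuat 1)) (Ad (toSp1 (unitQuat 1)) X))
    (fun v => by rw [InvForm𝔭.apply_Ad hmem, InvForm𝔭.apply_Ad hmem]) Ad_neg_frame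
  have key : ∀ l : Fin 3, ∀ m : Fin 7,
      (genForm p M - ψ) ![frame m, frame 3, frame (![6, 5, 4] l)] = 0 := by
    intro l m
    by_cases hm : m < 3
    · have : m = Fin.castLE (by norm_num) (⟨m, hm⟩ : Fin 3) := rfl
      rw [this, AlternatingMap.sub_apply, genForm_frame, sub_eq_zero]
      rfl
    -- For horizontal `m` all three indices are horizontal and `-1` kills the coefficient.
    · have := hN m 3 (![6, 5, 4] l)
      rw [h3 m (not_lt.1 hm), h3 3 le_rfl, h3 _ (by fin_cases l <;> decide)] at this
      simp only [id] at this
      linarith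
  refine eq_zero_of_mem_InvForm𝔭 hmem ?_ (key 2) (key 1) (key 0)
  rw [AlternatingMap.sub_apply, genForm_zero_one_two, sub_eq_zero]
  rfl

theorem genForm_add (p q : ℝ) (M N : Matrix (Fin 3) (Fin 3) ℝ) :
    genForm (p + q) (M + N) = genForm p M + genForm q N := by
  simp only [genForm, Matrix.add_apply, add_smul, Finset.sum_add_distrib]
  abel

theorem genForm_smul (c p : ℝ) (M : Matrix (Fin 3) (Fin 3) ℝ) :
    genForm (c * p) (c • M) = c • genForm p M := by
  simp only [genForm, Matrix.smul_apply, smul_add, Finset.smul_sum, smul_smul, smul_eq_mul]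

/-- The invariant 3-forms are parametrised by `ℝ × ℝ^{3 × 3}`. -/
def formEquiv : (ℝ × Matrix (Fin 3) (Fin 3) ℝ) ≃ₗ[ℝ] InvForm𝔭 where
  toFun q := ⟨genForm q.1 q.2, genForm_mem _ _⟩
  map_add' _ _ := Subtype.ext (genForm_add _ _ _ _)
  map_smul' _ _ := Subtype.ext (genForm_smul _ _ _)
  invFun ψ := formParam ψ.1
  left_inv _ := formParam_genForm _ _
  right_inv ψ := Subtype.ext (genForm_formParam ψ.2)

/-- Ten real numbers as a number and a `3 × 3` matrix. -/
def tenEquiv : (Fin 10 → ℝ) ≃ₗ[ℝ] ℝ × Matrix (Fin 3) (Fin 3) ℝ where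
  toFun t := (t 0, Matrix.of fun l m => t (Fin.succ (finProdFinEquiv (m := 3) (n := 3) (l, m))))
  map_add' _ _ := rfl
  map_smul' _ _ := rfl
  invFun q := Fin.cons (α := fun _ => ℝ) q.1 fun k : Fin 9 => q.2
    ((finProdFinEquiv (m := 3) (n := 3)).symm k).1 ((finProdFinEquiv (m := 3) (n := 3)).symm k).2
  left_inv t := by
    funext i
    refine Fin.cases rfl (fun k => ?_) i
    exact congrArg (fun x => t (Fin.succ x))
      (Equiv.apply_symm_apply (finProdFinEquiv (m := 3) (n := 3)) k)
  right_inv q := by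
    refine Prod.ext rfl (Matrix.ext fun l m => ?_)
    exact congrArg (fun x : Fin 3 × Fin 3 => q.2 x.1 x.2)
      (Equiv.symm_apply_apply (finProdFinEquiv (m := 3) (n := 3)) (l, m))

/-! ### Invariant symmetric bilinear forms -/

/-- The value of the symmetric form with parameters `S`, `ν` on two vectors, in terms of their
vertical components and the hermitian product of their horizontal components. -/
def symValue (S : Matrix (Fin 3) (Fin 3) ℝ) (ν : ℝ) (η η' χ : ℍ[ℝ]) : ℝ :=
  -- The factor `2` undoes the normalisation `1/√2` of `e₄, …, e₇`.
  (∑ l, ∑ m, S l m * (imc l η * imc m η')) + 2 * ν * χ.re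

/-- The bilinear form `∑ₗₘ Sₗₘ eˡ eᵐ + ν (e⁴e⁴ + ⋯ + e⁷e⁷)`. -/
def genSym (S : Matrix (Fin 3) (Fin 3) ℝ) (ν : ℝ) : LinearMap.BilinForm ℝ 𝔭 :=
  LinearMap.mk₂ ℝ
    (fun X Y => symValue S ν (X.1 1 1) (Y.1 1 1) (star (X.1 0 1) * Y.1 0 1))
    (fun X X' Y => by
      simp [symValue, Fin.sum_univ_three]
      ring)
    (fun c X Y => by
      simp [symValue, Fin.sum_univ_three]
      ring)
    (fun X Y Y' => by
      simp [symValue, Fin.sum_univ_three]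
      ring)
    (fun c X Y => by
      simp [symValue, Fin.sum_univ_three]
      ring)

theorem genSym_apply (S : Matrix (Fin 3) (Fin 3) ℝ) (ν : ℝ) (X Y : 𝔭) : genSym S ν X Y =
    symValue S ν (X.1 1 1) (Y.1 1 1) (star (X.1 0 1) * Y.1 0 1) := rfl

theorem symValue_coframe (S : Matrix (Fin 3) (Fin 3) ℝ) (ν : ℝ) (X Y : 𝔭) : genSym S ν X Y =
    (∑ l, ∑ m, S l m * (imc l (X.1 1 1) * imc m (Y.1 1 1))) +
    ν * (coframe 3 X * coframe 3 Y + coframe 4 X * coframe 4 Y + coframe 5 X * coframe 5 Y +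
      coframe 6 X * coframe 6 Y) := by
  have hs' : √2 ^ 2 = (2 : ℝ) := Real.sq_sqrt (by norm_num)
  rw [genSym_apply, symValue]
  congr 1
  simp [coframe]
  ring_nf
  rw [hs']

theorem genSym_mem {S : Matrix (Fin 3) (Fin 3) ℝ} (hS : S.IsSymm) (ν : ℝ) : genSym S ν ∈ InvSym𝔭 := by
  refine ⟨fun X Y => ?_, fun h X Y => ?_⟩
  · rw [symValue_coframe, symValue_coframe, Finset.sum_comm]
    congr 1
    · refine Finset.sum_congr rfl fun l _ => Finset.sum_congr rfl fun m _ => ?_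
      rw [← hS.apply l m]
      ring
    · ring
  · rw [genSym_apply, genSym_apply, star_Ad_mul_Ad, Ad_apply_11, Ad_apply_11]

/-- The parameters of an invariant symmetric form. -/
def symParam (b : LinearMap.BilinForm ℝ 𝔭) : Matrix (Fin 3) (Fin 3) ℝ × ℝ :=
  (Matrix.of fun l m => b (frame (Fin.castLE (by norm_num) l)) (frame (Fin.castLE (by norm_num) m)),
    b (frame 6) (frame 6))

theorem symParam_genSym (S : Matrix (Fin 3) (Fin 3) ℝ) (ν : ℝ) :
    symParam (genSym S ν) = (S, ν) := by
  refine Prod.ext (Matrix.ext fun l m => ?_) ?_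
  · change genSym S ν _ _ = _
    rw [symValue_coframe]
    fin_cases l <;> fin_cases m <;> simp [Fin.sum_univ_three, frame_11, coframe_frame]
  · change genSym S ν _ _ = _
    rw [symValue_coframe]
    simp [frame_11, coframe_frame]

theorem symParam_isSymm {b : LinearMap.BilinForm ℝ 𝔭} (hb : b ∈ InvSym𝔭) :
    (symParam b).1.IsSymm := by
  ext l m
  exact hb.1 _ _

/-- As in Schur's lemma: `-1` removes the mixed terms, while the relations from `i` and `j`, with
symmetry, make the horizontal block a multiple of the identity. -/
theorem genSym_symParam {b : LinearMap.BilinForm ℝ 𝔭} (hb : b ∈ InvSym𝔭) :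
    genSym (symParam b).1 (symParam b).2 = b := by
  have key : ∀ {h : 𝔭 → 𝔭} {s : Fin 7 → ℝ} {π : Fin 7 → Fin 7}
      (_ : ∀ X Y, b (h X) (h Y) = b X Y) (_ : ∀ a, h (frame a) = s a • frame (π a)) (x y : Fin 7),
      b (frame x) (frame y) = s x * s y * b (frame (π x)) (frame (π y)) := by
    intro h s π h1 h2 x y
    rw [← h1, h2, h2]
    simp
    ring
  have hI := key (hb.2 (toSp1 (unitQuat 1))) Ad_I_frame
  have hJ := key (hb.2 (toSp1 (unitQuat 2))) Ad_J_frame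
  have hN := key (h := fun X => Ad (toSp1 (unitQuat 1)) (Ad (toSp1 (unitQuat 1)) X)) (π := id)
    (fun X Y => by rw [hb.2, hb.2]) Ad_neg_frame
  have hc := hb.1
  refine LinearMap.ext_basis frameBasis frameBasis fun x y => ?_
  rw [frameBasis_apply, frameBasis_apply, symValue_coframe]
  have i34 := hI 3 4
  have j35 := hJ 3 5
  have j46 := hJ 4 6
  have i36 := hI 3 6
  have i45 := hI 4 5
  have i56 := hI 5 6
  have j56 := hJ 5 6
  have i33 := hI 3 3
  have j36 := hJ 3 3
  have i44 := hI 4 4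
  have j34 := hJ 3 4
  have c := fun x y => hc (frame x) (frame y)
  have c1 := c 3 4
  have c2 := c 3 5
  have c3 := c 3 6
  have c4 := c 4 5
  have c5 := c 4 6
  have c6 := c 5 6
  have hN' := hN x y
  have hN'' := hN y x
  simp [signI, permI, signJ, permJ] at i34 j35 j46 i36 i45 i56 j56 i33 j36 i44 j34
  fin_cases x <;> fin_cases y <;>
    simp [signNeg, Fin.sum_univ_three, frame_11, coframe_frame, symParam] at hN' hN'' ⊢ <;>
    linarith

/-- The invariant symmetric forms are parametrised by symmetric matrices and numbers. -/
def symMat (t : Fin 7 → ℝ) : Matrix (Fin 3) (Fin 3) ℝ :=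
  !![t 0, t 1, t 2; t 1, t 3, t 4; t 2, t 4, t 5]

theorem symMat_isSymm (t : Fin 7 → ℝ) : (symMat t).IsSymm := by
  ext i j
  fin_cases i <;> fin_cases j <;> rfl

/-- The entries of a symmetric matrix and a number. -/
def symVec (q : Matrix (Fin 3) (Fin 3) ℝ × ℝ) : Fin 7 → ℝ :=
  ![q.1 0 0, q.1 0 1, q.1 0 2, q.1 1 1, q.1 1 2, q.1 2 2, q.2]

theorem symMat_symVec {S : Matrix (Fin 3) (Fin 3) ℝ} (hS : S.IsSymm) (ν : ℝ) :
    symMat (symVec (S, ν)) = S := by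
  have h01 := hS.apply 0 1
  have h02 := hS.apply 0 2
  have h12 := hS.apply 1 2
  ext i j
  fin_cases i <;> fin_cases j <;> simp [symMat, symVec, h01, h02, h12]

theorem symVec_symMat (t : Fin 7 → ℝ) : symVec (symMat t, t 6) = t := by
  funext i
  fin_cases i <;> simp [symMat, symVec]

/-- The invariant symmetric forms are parametrised by `ℝ⁷`. -/
def symEquiv : (Fin 7 → ℝ) ≃ₗ[ℝ] InvSym𝔭 where
  toFun t := ⟨genSym (symMat t) (t 6), genSym_mem (symMat_isSymm t) _⟩
  map_add' t u := Subtype.ext <| LinearMap.ext₂ fun X Y => by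
    simp [genSym_apply, symValue, symMat, Fin.sum_univ_three]
    ring
  map_smul' c t := Subtype.ext <| LinearMap.ext₂ fun X Y => by
    simp [genSym_apply, symValue, symMat, Fin.sum_univ_three]
    ring
  invFun b := symVec (symParam b.1)
  left_inv t := by
    change symVec (symParam (genSym (symMat t) (t 6))) = t
    rw [symParam_genSym, symVec_symMat]
  right_inv b := Subtype.ext (by
    change genSym (symMat (symVec (symParam b.1))) (symParam b.1).2 = b.1
    rw [symMat_symVec (symParam_isSymm b.2), genSym_symParam b.2])

end SpSphere
end

noncomputable section

namespace SpSphere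

/-! ### Block endomorphisms -/

/-- The block endomorphism of `𝔭` which is `N` on `span (e₁, e₂, e₃)` and `μ` on
`span (e₄, …, e₇)`. -/
def blockEnd (N : Matrix (Fin 3) (Fin 3) ℝ) (μ : ℝ) : 𝔭 →ₗ[ℝ] 𝔭 :=
  (∑ l : Fin 3, ∑ m : Fin 3, N l m •
    (coframe (Fin.castLE (by norm_num) m)).smulRight (frame (Fin.castLE (by norm_num) l))) +
  μ • ∑ k : Fin 4, (coframe (Fin.natAdd 3 k)).smulRight (frame (Fin.natAdd 3 k))

theorem blockMap_eq_blockEnd (a : ℝ) (D : Matrix (Fin 3) (Fin 3) ℝ) : blockMap a D =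
    blockEnd ((a / D⁻¹.det ^ (1 / 3 : ℝ)) • D⁻¹) (D⁻¹.det ^ (1 / 6 : ℝ) / a ^ (1 / 2 : ℝ)) := rfl

theorem coframe_blockEnd_low (N : Matrix (Fin 3) (Fin 3) ℝ) (μ : ℝ) (X : 𝔭) (l : Fin 3) :
    coframe (Fin.castLE (by norm_num) l) (blockEnd N μ X) =
      ∑ m : Fin 3, N l m * coframe (Fin.castLE (by norm_num) m) X := by
  have h : ∀ k : Fin 4, (Fin.castLE (by norm_num) l : Fin 7) ≠ Fin.natAdd 3 k := fun k h => by
    have := congrArg Fin.val h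
    simp at this
    omega
  have h' : ∀ k : Fin 3, ((Fin.castLE (by norm_num) l : Fin 7) = Fin.castLE (by norm_num) k) ↔
      l = k := fun k => by simp [Fin.ext_iff]
  simp [blockEnd, coframe_frame, h, h']

theorem coframe_blockEnd_high (N : Matrix (Fin 3) (Fin 3) ℝ) (μ : ℝ) (X : 𝔭) (k : Fin 4) :
    coframe (Fin.natAdd 3 k) (blockEnd N μ X) = μ * coframe (Fin.natAdd 3 k) X := by
  have h : ∀ l : Fin 3, (Fin.natAdd 3 k : Fin 7) ≠ Fin.castLE (by norm_num) l := fun l h => by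
    have := congrArg Fin.val h
    simp at this
    omega
  have h' : ∀ j : Fin 4, ((Fin.natAdd 3 k : Fin 7) = Fin.natAdd 3 j) ↔ k = j :=
    fun j => by simp [Fin.ext_iff]
  simp [blockEnd, coframe_frame, h, h']

theorem imc_blockEnd (N : Matrix (Fin 3) (Fin 3) ℝ) (μ : ℝ) (X : 𝔭) (l : Fin 3) :
    imc l ((blockEnd N μ X).1 1 1) = ∑ m : Fin 3, N l m * imc m (X.1 1 1) := by
  have h : ∀ (X : 𝔭) (m : Fin 3), coframe (Fin.castLE (by norm_num) m) X = imc m (X.1 1 1) :=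
    fun X m => by fin_cases m <;> rfl
  have := coframe_blockEnd_low N μ X l
  simpa only [h] using this

theorem blockEnd_01 (N : Matrix (Fin 3) (Fin 3) ℝ) (μ : ℝ) (X : 𝔭) :
    (blockEnd N μ X).1 0 1 = μ • X.1 0 1 := by
  have hs : (√2 : ℝ) ≠ 0 := by positivity
  have h : ∀ k : Fin 4, coframe (Fin.natAdd 3 k) (blockEnd N μ X) =
    coframe (Fin.natAdd 3 k) (μ • X) := fun k => by
      rw [coframe_blockEnd_high, map_smul, smul_eq_mul]
  have h0 := h 0
  have h1 := h 1
  have h2 := h 2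
  have h3 := h 3
  simp only [coframe, LinearMap.coe_mk, AddHom.coe_mk] at h0 h1 h2 h3
  change √2 * _ = √2 * _ at h0
  change √2 * _ = √2 * _ at h1
  change √2 * _ = √2 * _ at h2
  change √2 * _ = √2 * _ at h3
  ext
  · exact mul_left_cancel₀ hs h3
  · exact mul_left_cancel₀ hs h0
  · exact mul_left_cancel₀ hs h1
  · exact mul_left_cancel₀ hs h2

/-- Vertical components are multiplied by `N` and products `x* y` by `μ²`, so `e¹²³` acquires `det
N` and the mixed part acquires one factor of each kind. -/
theorem genForm_comp_blockEnd (p : ℝ) (M N : Matrix (Fin 3) (Fin 3) ℝ) (μ : ℝ) :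
    (genForm p M).compLinearMap (blockEnd N μ) = genForm (p * N.det) (μ ^ 2 • (M * N)) := by
  ext v
  rw [AlternatingMap.compLinearMap_apply, genForm_apply, genForm_apply, formValue, formValue]
  have h1 : (Matrix.of fun i l => imc l ((blockEnd N μ (v i)).1 1 1)) =
      (Matrix.of fun i l => imc l ((v i).1 1 1)) * Nᵀ := by
    ext i l
    rw [Matrix.of_apply, imc_blockEnd, Matrix.mul_apply]
    simp [mul_comm]
  have h2 : ∀ (l : Fin 3) (X Y : 𝔭), omegaC l (star ((blockEnd N μ X).1 0 1) *
      (blockEnd N μ Y).1 0 1) = μ ^ 2 * omegaC l (star (X.1 0 1) * Y.1 0 1) := by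
    intro l X Y
    have : star ((blockEnd N μ X).1 0 1) * (blockEnd N μ Y).1 0 1 =
        (μ ^ 2) • (star (X.1 0 1) * Y.1 0 1) := by
      rw [blockEnd_01, blockEnd_01, Quaternion.star_smul, smul_mul_smul_comm, sq]
    rw [this, omegaC, map_smul, omegaC, smul_eq_mul]
    ring
  rw [h1, Matrix.det_mul, Matrix.det_transpose]
  congr 1
  · rw [mul_assoc, mul_comm N.det]
  · refine Finset.sum_congr rfl fun l _ => ?_
    simp only [h2, imc_blockEnd, Matrix.smul_apply, Matrix.mul_apply, Fin.sum_univ_three, smul_eq_mul]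
    ring

theorem φ₀_eq_genForm : φ₀ = genForm 1 1 := by
  rw [φ₀, genForm, one_smul, Fin.sum_univ_three]
  simp [Fin.sum_univ_three]
  abel

theorem det_blockEnd (N : Matrix (Fin 3) (Fin 3) ℝ) (μ : ℝ) :
    LinearMap.det (blockEnd N μ) = N.det * μ ^ 4 := by
  rw [← LinearMap.det_toMatrix (frameBasis.reindex (finSumFinEquiv (m := 3) (n := 4)).symm)]
  have : LinearMap.toMatrix (frameBasis.reindex (finSumFinEquiv (m := 3) (n := 4)).symm)
      (frameBasis.reindex (finSumFinEquiv (m := 3) (n := 4)).symm) (blockEnd N μ) =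
      Matrix.fromBlocks N 0 0 (μ • 1) := by
    ext i j
    rw [LinearMap.toMatrix_apply, Basis.repr_reindex_apply, frameBasis_repr, Basis.reindex_apply,
      frameBasis_apply, Equiv.symm_symm]
    rcases i with i | i
    · have h : finSumFinEquiv (m := 3) (n := 4) (Sum.inl i) = Fin.castLE (by norm_num) i := rfl
      rw [h, coframe_blockEnd_low]
      rcases j with j | j
      · have h : finSumFinEquiv (m := 3) (n := 4) (Sum.inl j) = Fin.castLE (by norm_num) j := rfl
        simp [h, coframe_frame]
      · have h : finSumFinEquiv (m := 3) (n := 4) (Sum.inr j) = Fin.natAdd 3 j := rfl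
        have h' : ∀ k : Fin 3, (Fin.castLE (by norm_num) k : Fin 7) ≠ Fin.natAdd 3 j := fun k h => by
          have := congrArg Fin.val h
          simp at this
          omega
        rw [h]
        simp [coframe_frame, h']
    · have h : finSumFinEquiv (m := 3) (n := 4) (Sum.inr i) = Fin.natAdd 3 i := rfl
      rw [h, coframe_blockEnd_high]
      rcases j with j | j
      · have h : finSumFinEquiv (m := 3) (n := 4) (Sum.inl j) = Fin.castLE (by norm_num) j := rfl
        have h' : (Fin.natAdd 3 i : Fin 7) ≠ Fin.castLE (by norm_num) j := fun h => by
          have := congrArg Fin.val h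
          simp at this
          omega
        rw [h]
        simp [coframe_frame, h']
      · have h : finSumFinEquiv (m := 3) (n := 4) (Sum.inr j) = Fin.natAdd 3 j := rfl
        have h' : ((Fin.natAdd 3 i : Fin 7) = Fin.natAdd 3 j) ↔ i = j := by simp [Fin.ext_iff]
        rw [h]
        simp [coframe_frame, Matrix.one_apply, h']
  rw [this, Matrix.det_fromBlocks_zero₂₁, Matrix.det_smul, Matrix.det_one, Fintype.card_fin, mul_one]

/-! ### Positive invariant 3-forms -/

/-- The horizontal scale `c^(-1/2)` is the one whose square cancels the factor `c` in the vertical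
block `c M`; the coefficient of `e¹²³` then fixes `c`. -/
theorem genForm_eq_φ₀_comp {p : ℝ} {M : Matrix (Fin 3) (Fin 3) ℝ} {c : ℝ} (hc : 0 < c)
    (hp : p = c ^ 3 * M.det) :
    genForm p M = φ₀.compLinearMap (blockEnd (c • M) (√c)⁻¹) := by
  rw [φ₀_eq_genForm, genForm_comp_blockEnd, Matrix.det_smul, Fintype.card_fin, one_mul, one_mul,
    ← hp, smul_smul, inv_pow, Real.sq_sqrt hc.le, inv_mul_cancel₀ hc.ne', one_smul]

theorem det_inv_pos {D : Matrix (Fin 3) (Fin 3) ℝ} (hD : 0 < D.det) : 0 < D⁻¹.det := by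
  rw [Matrix.det_nonsing_inv, Ring.inverse_eq_inv']
  positivity

theorem phi_eq_comp_blockMap {a : ℝ} {D : Matrix (Fin 3) (Fin 3) ℝ} (ha : 0 < a) (hD : 0 < D.det) :
    phi a D = φ₀.compLinearMap (blockMap a D) := by
  have hd := det_inv_pos hD
  set d := D⁻¹.det with hd'
  have h3 : (d ^ (1 / 3 : ℝ)) ^ 3 = d := by
    rw [← Real.rpow_natCast, ← Real.rpow_mul hd.le]
    norm_num
  have h6 : (d ^ (1 / 6 : ℝ)) ^ 2 = d ^ (1 / 3 : ℝ) := by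
    rw [← Real.rpow_natCast, ← Real.rpow_mul hd.le]
    norm_num
  have h2 : (a ^ (1 / 2 : ℝ)) ^ 2 = a := by
    rw [← Real.rpow_natCast, ← Real.rpow_mul ha.le]
    norm_num
  have hd3 : 0 < d ^ (1 / 3 : ℝ) := by positivity
  rw [blockMap_eq_blockEnd, φ₀_eq_genForm, genForm_comp_blockEnd, phi_eq_genForm, ← hd',
    Matrix.det_smul, Fintype.card_fin, ← hd', one_mul, one_mul, smul_smul, div_pow, div_pow, h2, h3,
    h6]
  congr 1
  · field_simp
  · rw [div_mul_div_comm, mul_comm, div_self (by positivity), one_smul]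

theorem isPositive_of_pos {p : ℝ} {M : Matrix (Fin 3) (Fin 3) ℝ} (hp : 0 < p) (hM : 0 < M.det) :
    IsPositive (genForm p M) := by
  set c : ℝ := (p / M.det) ^ (1 / 3 : ℝ) with hc
  have hc0 : 0 < c := by positivity
  have hc3 : p = c ^ 3 * M.det := by
    have : c ^ 3 = p / M.det := by
      rw [hc, ← Real.rpow_natCast, ← Real.rpow_mul (by positivity)]
      norm_num
    rw [this]
    field_simp
  have hdet : 0 < LinearMap.det (blockEnd (c • M) (√c)⁻¹) := by
    rw [det_blockEnd, Matrix.det_smul]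
    positivity
  refine ⟨LinearMap.equivOfDetNeZero _ hdet.ne', hdet, genForm_eq_φ₀_comp hc0 hc3⟩

/-- The obstruction to being a `G₂`-form: independent `u`, `w` with `φ(u, w, ·) = 0` cannot exist.
-/
theorem dependent_of_isG2 {V : Type*} [AddCommGroup V] [Module ℝ V] (L : V ≃ₗ[ℝ] 𝔭) {u w : V}
    (h : ∀ z, φ₀ ![L u, L w, L z] = 0) (hu : u ≠ 0) : ∃ c : ℝ, w = c • u := by
  have h1 := smul_eq_smul_of_φ₀_eq_zero (L u) (L w) fun z => by
    simpa using h (L.symm z)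
  have h2 : stdIP (L u) (L u) ≠ 0 := (stdIP_self_pos (by simpa using hu)).ne'
  refine ⟨(stdIP (L u) (L u))⁻¹ * stdIP (L u) (L w), L.injective ?_⟩
  rw [map_smul, mul_smul, ← h1, smul_smul, inv_mul_cancel₀ h2, one_smul]

theorem apply_of_eq_comp {V : Type*} [AddCommGroup V] [Module ℝ V] {ψ : V [⋀^Fin 3]→ₗ[ℝ] ℝ}
    {L : V →ₗ[ℝ] 𝔭} (h : ψ = φ₀.compLinearMap L) (u w z : V) :
    φ₀ ![L u, L w, L z] = ψ ![u, w, z] := by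
  rw [h, AlternatingMap.compLinearMap_apply]
  congr 1
  funext i
  fin_cases i <;> rfl

/-- A kernel vector of `M` gives a vertical `U` for which all terms `eᵐ ∧ ωₗ` cancel against a
horizontal vector, while `e¹²³` vanishes on anything horizontal. Then `U` and `e₄` would have zero
contraction. -/
theorem det_ne_zero_of_genForm {p : ℝ} {M : Matrix (Fin 3) (Fin 3) ℝ} (L : 𝔭 ≃ₗ[ℝ] 𝔭)
    (h : genForm p M = φ₀.compLinearMap (L : 𝔭 →ₗ[ℝ] 𝔭)) : M.det ≠ 0 := by
  intro h0
  obtain ⟨u, hu, hMu⟩ := Matrix.exists_mulVec_eq_zero_iff.2 h0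
  set U : 𝔭 := ∑ m : Fin 3, u m • frame (Fin.castLE (by norm_num) m) with hU
  have hU11 : ∀ m, imc m (U.1 1 1) = u m := by
    intro m
    fin_cases m <;> simp [hU, Fin.sum_univ_three, frame_11]
  have hU01 : U.1 0 1 = 0 := by
    simp [hU, Fin.sum_univ_three, frame_00]
  have hU0 : U ≠ 0 := by
    intro h1
    apply hu
    funext m
    rw [← hU11, h1]
    simp
  obtain ⟨c, hc⟩ := dependent_of_isG2 L (u := U) (w := frame 3) (fun z => by
    have hM : ∀ l, ∑ m, M l m * u m = 0 := fun l => congrFun hMu l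
    refine (apply_of_eq_comp h _ _ _).trans ?_
    rw [genForm_apply, formValue, Matrix.det_fin_three]
    simp [hU11, hU01, frame_11]
    refine Finset.sum_eq_zero fun l _ => ?_
    have h3 : omegaC l 0 = 0 := by simp [omegaC]
    simp only [h3, mul_zero, add_zero, ← mul_assoc]
    rw [← Finset.sum_mul, hM, zero_mul]) hU0
  have h4 := congrArg (coframe 3) hc
  rw [map_smul, coframe_frame] at h4
  simp [coframe, hU01] at h4

/-- If `q = -α²`, the vectors `e₁ + α e₄` and `e₃ - α e₆` have zero contraction: the terms from `q
e¹²³` and `e²⁴⁶` cancel because `q + α² = 0`, and the mixed terms, from `e¹⁵⁶` and `e³⁴⁵`, cancel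
each other. -/
theorem pos_of_genForm_one {q : ℝ} (L : 𝔭 ≃ₗ[ℝ] 𝔭)
    (h : genForm q 1 = φ₀.compLinearMap (L : 𝔭 →ₗ[ℝ] 𝔭)) : 0 < q := by
  by_contra hq
  have hs : √(-q) * √(-q) = -q := Real.mul_self_sqrt (by linarith)
  set α := √(-q) with hα
  have hu : frame 0 + α • frame 3 ≠ 0 := by
    intro h1
    have := congrArg (coframe 0) h1
    rw [map_add, map_smul, coframe_frame, coframe_frame] at this
    simp at this
  have h2 : √2 * √2 = (2 : ℝ) := Real.mul_self_sqrt (by norm_num)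
  have h3 : (√2)⁻¹ * 2 = √2 := by
    rw [inv_mul_eq_div, div_eq_iff (by positivity), h2]
  obtain ⟨c, hc⟩ := dependent_of_isG2 L (u := frame 0 + α • frame 3) (w := frame 2 - α • frame 5)
    (fun z => by
      refine (apply_of_eq_comp h _ _ _).trans ?_
      rw [genForm_apply, formValue, Matrix.det_fin_three]
      simp [frame_00, frame_11, omegaC, Fin.sum_univ_three, Matrix.one_apply]
      have hsq : (√2)⁻¹ * (√2)⁻¹ = (2 : ℝ)⁻¹ := by rw [← mul_inv, h2]
      linear_combination (-(z.1 1 1).imJ) * hs - 2 * α ^ 2 * (z.1 1 1).imJ * hsq) hu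
  have h4 := congrArg (coframe 2) hc
  rw [map_sub, map_smul, map_smul, map_add, map_smul] at h4
  simp [coframe_frame] at h4

theorem isPositive_genForm_iff {p : ℝ} {M : Matrix (Fin 3) (Fin 3) ℝ} :
    IsPositive (genForm p M) ↔ 0 < p ∧ 0 < M.det := by
  refine ⟨?_, fun h => isPositive_of_pos h.1 h.2⟩
  rintro ⟨L, hL, h⟩
  have hM := det_ne_zero_of_genForm L h
  have hM1 : LinearMap.det (blockEnd M 1) ≠ 0 := by
    rw [det_blockEnd]
    simpa using hM
  -- Undoing the invertible block `(M, 1)` normalises `M` to the identity and `p` to `p / det M`.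
  have hq : 0 < p / M.det := by
    refine pos_of_genForm_one ((LinearMap.equivOfDetNeZero _ hM1).symm.trans L) ?_
    have h1 : genForm p M = (genForm (p / M.det) 1).compLinearMap (blockEnd M 1) := by
      rw [genForm_comp_blockEnd, one_mul, one_pow, one_smul, div_mul_cancel₀ _ hM]
    rw [h1] at h
    ext v
    have h2 := congrArg (fun f => f fun i => (LinearMap.equivOfDetNeZero _ hM1).symm (v i)) h
    simp only [AlternatingMap.compLinearMap_apply] at h2
    have h3 : ∀ X, blockEnd M 1 ((LinearMap.equivOfDetNeZero _ hM1).symm X) = X :=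
      (LinearMap.equivOfDetNeZero _ hM1).apply_symm_apply
    simp only [h3] at h2
    exact h2
  set c : ℝ := (p / M.det) ^ (1 / 3 : ℝ) with hc
  have hc0 : 0 < c := by positivity
  have hc3 : p = c ^ 3 * M.det := by
    have : c ^ 3 = p / M.det := by
      rw [hc, ← Real.rpow_natCast, ← Real.rpow_mul hq.le]
      norm_num
    rw [this, div_mul_cancel₀ _ hM]
  have hB := genForm_eq_φ₀_comp hc0 hc3
  set B := blockEnd (c • M) (√c)⁻¹ with hBdef
  have hdet : LinearMap.det B = c ^ 3 * M.det * (√c)⁻¹ ^ 4 := by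
    rw [hBdef, det_blockEnd, Matrix.det_smul, Fintype.card_fin]
  have hdet0 : LinearMap.det B ≠ 0 := by
    rw [hdet]
    positivity
  set E := LinearMap.equivOfDetNeZero B hdet0 with hE
  have hEB : ∀ X, B (E.symm X) = X := E.apply_symm_apply
  -- Two maps carry `φ₀` to the same form, `L` and the block map `B`; they differ by a stabiliser
  -- element, which has positive determinant. So `det B`, and with it `det M`, has the sign of `det
  -- L`.
  have hstab : φ₀.compLinearMap ((L : 𝔭 →ₗ[ℝ] 𝔭) ∘ₗ (E.symm : 𝔭 →ₗ[ℝ] 𝔭)) = φ₀ := by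
    ext v
    have h2 := congrArg (fun f => f fun i => E.symm (v i)) (h.symm.trans hB)
    simp only [AlternatingMap.compLinearMap_apply, hEB] at h2
    exact h2
  have h5 := det_pos_of_stabilizer _ hstab
  rw [LinearMap.det_comp] at h5
  have h6 : LinearMap.det (E.symm : 𝔭 →ₗ[ℝ] 𝔭) * LinearMap.det B = 1 := by
    rw [← LinearMap.det_comp]
    have : (E.symm : 𝔭 →ₗ[ℝ] 𝔭) ∘ₗ B = LinearMap.id := LinearMap.ext E.symm_apply_apply
    rw [this, LinearMap.det_id]
  have h7 : 0 < LinearMap.det (E.symm : 𝔭 →ₗ[ℝ] 𝔭) := pos_of_mul_pos_right h5 hL.le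
  have h8 : 0 < LinearMap.det B := by
    by_contra h9
    nlinarith
  have h9 : 0 < M.det := by
    rw [hdet] at h8
    have h10 : 0 < c ^ 3 * (√c)⁻¹ ^ 4 := by positivity
    have h11 : 0 < (c ^ 3 * (√c)⁻¹ ^ 4) * M.det := by linarith
    exact pos_of_mul_pos_right h11 h10.le
  exact ⟨by rw [hc3]; positivity, h9⟩

end SpSphere
end

/-! ### Smooth parametrisations by `(a, D)`: forms, metrics, fibres and sections. -/

noncomputable section

namespace SpSphere

/-! ### Smoothness of matrix operations -/

section

variable {E : Type*} [NormedAddCommGroup E] [NormedSpace ℝ E] {s : Set E}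
  {f : E → Matrix (Fin 3) (Fin 3) ℝ} {n : ℕ∞}

theorem contDiffOn_det (hf : ∀ i j, ContDiffOn ℝ n (fun x => f x i j) s) :
    ContDiffOn ℝ n (fun x => (f x).det) s := by
  simp only [Matrix.det_fin_three]
  fun_prop

theorem contDiffOn_inv (hf : ∀ i j, ContDiffOn ℝ n (fun x => f x i j) s)
    (h : ∀ x ∈ s, (f x).det ≠ 0) (i j : Fin 3) :
    ContDiffOn ℝ n (fun x => (f x)⁻¹ i j) s := by
  simp only [Matrix.inv_def, Ring.inverse_eq_inv', Matrix.smul_apply, smul_eq_mul]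
  refine ((contDiffOn_det hf).inv h).mul ?_
  simp only [Matrix.adjugate_fin_three]
  fin_cases i <;> fin_cases j <;> simp <;> fun_prop

end

/-! ### The diffeomorphism `Φ` -/

theorem isOpen_ParamDomain : IsOpen ParamDomain := by
  have h : Continuous fun q : ℝ × (Fin 3 → Fin 3 → ℝ) => (Matrix.of q.2).det := by
    simp only [Matrix.det_fin_three, Matrix.of_apply]
    fun_prop
  have h1 : IsOpen {q : ℝ × (Fin 3 → Fin 3 → ℝ) | 0 < q.1} :=
    isOpen_lt continuous_const continuous_fst
  have h2 : IsOpen {q : ℝ × (Fin 3 → Fin 3 → ℝ) | 0 < (Matrix.of q.2).det} :=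
    isOpen_lt continuous_const h
  exact h1.inter h2

theorem contDiff_tenEquiv_snd (l m : Fin 3) : ContDiff ℝ ∞ fun t => (tenEquiv t).2 l m :=
  contDiff_apply ℝ ℝ (Fin.succ (finProdFinEquiv (m := 3) (n := 3) (l, m)))

theorem contDiff_tenEquiv_fst : ContDiff ℝ ∞ fun t => (tenEquiv t).1 :=
  contDiff_apply ℝ ℝ (0 : Fin 10)

theorem contDiffOn_tenEquiv_symm {E : Type*} [NormedAddCommGroup E] [NormedSpace ℝ E] {s : Set E}
    {f : E → ℝ} {g : E → Matrix (Fin 3) (Fin 3) ℝ} (hf : ContDiffOn ℝ ∞ f s)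
    (hg : ∀ i j, ContDiffOn ℝ ∞ (fun x => g x i j) s) :
    ContDiffOn ℝ ∞ (fun x => tenEquiv.symm (f x, g x)) s := by
  refine contDiffOn_pi.2 fun i => ?_
  refine Fin.cases ?_ (fun k => ?_) i
  · exact hf
  · exact hg _ _

theorem isPositive_tenEquiv_iff (t : Fin 10 → ℝ) : IsPositive ((tenEquiv.trans formEquiv) t).1 ↔
    0 < (tenEquiv t).1 ∧ 0 < (tenEquiv t).2.det :=
  isPositive_genForm_iff

theorem isOpen_positive : IsOpen {t | IsPositive ((tenEquiv.trans formEquiv) t).1} := by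
  simp only [isPositive_tenEquiv_iff]
  have h : Continuous fun t => (tenEquiv t).2.det := by
    have := fun l m => (contDiff_tenEquiv_snd l m).continuous
    simp only [Matrix.det_fin_three]
    fun_prop
  have h1 : IsOpen {t | 0 < (tenEquiv t).1} :=
    isOpen_lt continuous_const contDiff_tenEquiv_fst.continuous
  have h2 : IsOpen {t | 0 < (tenEquiv t).2.det} := isOpen_lt continuous_const h
  exact h1.inter h2

theorem cube_rpow {a : ℝ} (ha : 0 ≤ a) : (a ^ 3) ^ (1 / 3 : ℝ) = a := by
  rw [← Real.rpow_natCast, ← Real.rpow_mul ha]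
  norm_num

theorem rpow_cube {a : ℝ} (ha : 0 ≤ a) : (a ^ (1 / 3 : ℝ)) ^ 3 = a := by
  rw [← Real.rpow_natCast, ← Real.rpow_mul ha]
  norm_num

theorem inv_inv_of_det_pos {D : Matrix (Fin 3) (Fin 3) ℝ} (hD : 0 < D.det) : D⁻¹⁻¹ = D :=
  Matrix.nonsing_inv_nonsing_inv D (isUnit_iff_ne_zero.2 hD.ne')

theorem contDiffOn_formCoord : ContDiffOn ℝ ∞
    (fun q : ℝ × (Fin 3 → Fin 3 → ℝ) => tenEquiv.symm (q.1 ^ 3, (Matrix.of q.2)⁻¹)) ParamDomain := by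
  refine contDiffOn_tenEquiv_symm (by fun_prop) (contDiffOn_inv (fun i j => ?_) fun q hq => hq.2.ne')
  simp only [Matrix.of_apply]
  fun_prop

theorem contDiffOn_formCoord_symm : ContDiffOn ℝ ∞
    (fun t => (((tenEquiv t).1 ^ (1 / 3 : ℝ), fun i j => ((tenEquiv t).2)⁻¹ i j) :
      ℝ × (Fin 3 → Fin 3 → ℝ))) {t | IsPositive ((tenEquiv.trans formEquiv) t).1} := by
  have h : ∀ t ∈ {t | IsPositive ((tenEquiv.trans formEquiv) t).1},
      0 < (tenEquiv t).1 ∧ 0 < (tenEquiv t).2.det := fun t ht => (isPositive_tenEquiv_iff t).1 ht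
  refine ContDiffOn.prodMk ?_ ?_
  · exact contDiff_tenEquiv_fst.contDiffOn.rpow_const_of_ne fun t ht => (h t ht).1.ne'
  · refine contDiffOn_pi.2 fun i => contDiffOn_pi.2 fun j => ?_
    exact contDiffOn_inv (fun i j => (contDiff_tenEquiv_snd i j).contDiffOn)
      (fun t ht => (h t ht).2.ne') i j

/-- The diffeomorphism `(a, D) ↦ φ_{a,D}` in coordinates. -/
def formChart : OpenPartialHomeomorph (ℝ × (Fin 3 → Fin 3 → ℝ)) (Fin 10 → ℝ) where
  toFun q := tenEquiv.symm (q.1 ^ 3, (Matrix.of q.2)⁻¹)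
  invFun t := ((tenEquiv t).1 ^ (1 / 3 : ℝ), fun i j => ((tenEquiv t).2)⁻¹ i j)
  source := ParamDomain
  target := {t | IsPositive ((tenEquiv.trans formEquiv) t).1}
  map_source' q hq := by
    rw [Set.mem_ofPred_eq, isPositive_tenEquiv_iff, LinearEquiv.apply_symm_apply]
    exact ⟨pow_pos hq.1 3, det_inv_pos hq.2⟩
  map_target' t ht := by
    rw [Set.mem_ofPred_eq, isPositive_tenEquiv_iff] at ht
    exact ⟨Real.rpow_pos_of_pos ht.1 _, det_inv_pos ht.2⟩
  left_inv' q hq := by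
    rw [LinearEquiv.apply_symm_apply]
    refine Prod.ext (cube_rpow hq.1.le) ?_
    funext i j
    exact congrFun (congrFun (inv_inv_of_det_pos hq.2) i) j
  right_inv' t ht := by
    rw [Set.mem_ofPred_eq, isPositive_tenEquiv_iff] at ht
    rw [LinearEquiv.symm_apply_eq]
    exact Prod.ext (rpow_cube ht.1.le) (inv_inv_of_det_pos ht.2)
  open_source := isOpen_ParamDomain
  open_target := isOpen_positive
  continuousOn_toFun := contDiffOn_formCoord.continuousOn
  continuousOn_invFun := contDiffOn_formCoord_symm.continuousOn

theorem exists_formChart : ∃ (c : (Fin 10 → ℝ) ≃ₗ[ℝ] InvForm𝔭)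
    (Φ : OpenPartialHomeomorph (ℝ × (Fin 3 → Fin 3 → ℝ)) (Fin 10 → ℝ)),
    Φ.source = ParamDomain ∧ Φ.target = {t | IsPositive (c t).1} ∧
    (∀ q ∈ ParamDomain, (c (Φ q)).1 = phi q.1 (Matrix.of q.2)) ∧
    ContDiffOn ℝ ∞ Φ Φ.source ∧ ContDiffOn ℝ ∞ Φ.symm Φ.target := by
  refine ⟨tenEquiv.trans formEquiv, formChart, rfl, rfl, fun q _ => ?_, contDiffOn_formCoord,
    contDiffOn_formCoord_symm⟩
  change (formEquiv (tenEquiv (tenEquiv.symm (q.1 ^ 3, (Matrix.of q.2)⁻¹)))).1 = _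
  rw [LinearEquiv.apply_symm_apply]
  rfl

/-! ### Cholesky decomposition of `3 × 3` matrices -/

/-- The leading `2 × 2` minor. -/
def minor2 (S : Matrix (Fin 3) (Fin 3) ℝ) : ℝ := S 0 0 * S 1 1 - S 0 1 ^ 2

/-- Positivity of the leading principal minors. -/
def MinorsPos (S : Matrix (Fin 3) (Fin 3) ℝ) : Prop := 0 < S 0 0 ∧ 0 < minor2 S ∧ 0 < S.det

/-- The upper triangular Cholesky factor. -/
def chol (S : Matrix (Fin 3) (Fin 3) ℝ) : Matrix (Fin 3) (Fin 3) ℝ :=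
  !![√(S 0 0), S 0 1 / √(S 0 0), S 0 2 / √(S 0 0);
    0, √(minor2 S / S 0 0), (S 1 2 - S 0 1 * S 0 2 / S 0 0) / √(minor2 S / S 0 0);
    0, 0, √(S.det / minor2 S)]

theorem chol_transpose_mul_chol {S : Matrix (Fin 3) (Fin 3) ℝ} (hS : S.IsSymm) (h : MinorsPos S) :
    (chol S)ᵀ * chol S = S := by
  obtain ⟨h1, h2, h3⟩ := h
  have hx : √(S 0 0) * √(S 0 0) = S 0 0 := Real.mul_self_sqrt h1.le
  have hy : √(minor2 S / S 0 0) * √(minor2 S / S 0 0) = minor2 S / S 0 0 :=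
    Real.mul_self_sqrt (by positivity)
  have hz : √(S.det / minor2 S) * √(S.det / minor2 S) = S.det / minor2 S :=
    Real.mul_self_sqrt (by positivity)
  have hx0 : 0 < √(S 0 0) := by positivity
  have hy0 : 0 < √(minor2 S / S 0 0) := by positivity
  have h01 := hS.apply 0 1
  have h02 := hS.apply 0 2
  have h12 := hS.apply 1 2
  set x := √(S 0 0) with hxd
  set y := √(minor2 S / S 0 0) with hyd
  set z := √(S.det / minor2 S) with hzd
  have e11 : S 0 1 / x * (S 0 1 / x) + y * y = S 1 1 := by
    rw [div_mul_div_comm, hx, hy, minor2]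
    field_simp
    ring
  have e12 : S 0 1 / x * (S 0 2 / x) + y * ((S 1 2 - S 0 1 * S 0 2 / S 0 0) / y) = S 1 2 := by
    rw [div_mul_div_comm, hx, mul_div_cancel₀ _ hy0.ne']
    ring
  have e22 : S 0 2 / x * (S 0 2 / x) +
      (S 1 2 - S 0 1 * S 0 2 / S 0 0) / y * ((S 1 2 - S 0 1 * S 0 2 / S 0 0) / y) + z * z =
      S 2 2 := by
    rw [div_mul_div_comm, div_mul_div_comm, hx, hy, hz, Matrix.det_fin_three, h01, h02, h12]
    field_simp
    rw [minor2]
    ring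
  have e01 : x * (S 0 1 / x) = S 0 1 := mul_div_cancel₀ _ hx0.ne'
  have e02 : x * (S 0 2 / x) = S 0 2 := mul_div_cancel₀ _ hx0.ne'
  ext i j
  rw [Matrix.mul_apply, Fin.sum_univ_three]
  fin_cases i <;> fin_cases j <;> simp [chol, ← hxd, ← hyd, ← hzd]
  · exact hx
  · exact e01
  · exact e02
  · rw [mul_comm, e01, h01]
  · exact e11
  · exact e12
  · rw [mul_comm, e02, h02]
  · linarith
  · linarith

theorem det_chol_pos {S : Matrix (Fin 3) (Fin 3) ℝ} (h : MinorsPos S) : 0 < (chol S).det := by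
  obtain ⟨h1, h2, h3⟩ := h
  rw [Matrix.det_fin_three]
  simp [chol]
  positivity

/-- The entries of `chol` use only square roots and quotients of quantities that are positive where
the leading minors are, so smoothness can be read off. -/
theorem contDiffOn_chol {E : Type*} [NormedAddCommGroup E] [NormedSpace ℝ E] {s : Set E}
    {f : E → Matrix (Fin 3) (Fin 3) ℝ} (hf : ∀ i j, ContDiffOn ℝ ∞ (fun x => f x i j) s)
    (h : ∀ x ∈ s, MinorsPos (f x)) (i j : Fin 3) :
    ContDiffOn ℝ ∞ (fun x => chol (f x) i j) s := by
  have hm : ContDiffOn ℝ ∞ (fun x => minor2 (f x)) s := by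
    unfold minor2
    fun_prop
  have hd := contDiffOn_det hf
  have hx : ContDiffOn ℝ ∞ (fun x => √(f x 0 0)) s := (hf 0 0).sqrt fun x hx => (h x hx).1.ne'
  have hy : ContDiffOn ℝ ∞ (fun x => √(minor2 (f x) / f x 0 0)) s :=
    (hm.div (hf 0 0) fun x hx => (h x hx).1.ne').sqrt fun x hx =>
      (div_pos (h x hx).2.1 (h x hx).1).ne'
  have hz : ContDiffOn ℝ ∞ (fun x => √((f x).det / minor2 (f x))) s :=
    (hd.div hm fun x hx => (h x hx).2.1.ne').sqrt fun x hx =>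
      (div_pos (h x hx).2.2 (h x hx).2.1).ne'
  have hx0 : ∀ x ∈ s, √(f x 0 0) ≠ 0 := fun x hx => (Real.sqrt_pos.2 (h x hx).1).ne'
  have hy0 : ∀ x ∈ s, √(minor2 (f x) / f x 0 0) ≠ 0 := fun x hx =>
    (Real.sqrt_pos.2 (div_pos (h x hx).2.1 (h x hx).1)).ne'
  fin_cases i <;> fin_cases j <;> simp [chol]
  · exact hx
  · exact (hf 0 1).div hx hx0
  · exact (hf 0 2).div hx hx0
  · exact contDiffOn_const
  · simpa using hy
  · exact ((hf 1 2).sub (((hf 0 1).mul (hf 0 2)).div (hf 0 0) fun x hx => (h x hx).1.ne')).div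
      hy hy0
  · exact contDiffOn_const
  · exact contDiffOn_const
  · simpa using hz

end SpSphere
end

noncomputable section

namespace SpSphere

/-! ### The metric of `φ_{a,D}` -/

theorem stdIP_blockEnd (N : Matrix (Fin 3) (Fin 3) ℝ) (μ : ℝ) (X Y : 𝔭) :
    stdIP (blockEnd N μ X) (blockEnd N μ Y) = genSym (Nᵀ * N) (μ ^ 2) X Y := by
  have h : ∀ (X : 𝔭) (m : Fin 3), imc m (X.1 1 1) = coframe (Fin.castLE (by norm_num) m) X :=
    fun X m => by fin_cases m <;> rfl
  have h1 : ∀ Z W : 𝔭, stdIP Z W = ∑ l : Fin 3, coframe (Fin.castLE (by norm_num) l) Z *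
      coframe (Fin.castLE (by norm_num) l) W +
      ∑ k : Fin 4, coframe (Fin.natAdd 3 k) Z * coframe (Fin.natAdd 3 k) W := fun Z W => by
    rw [stdIP_apply]
    exact Fin.sum_univ_add (a := 3) (b := 4) fun i => coframe i Z * coframe i W
  have h2 : coframe 3 X * coframe 3 Y + coframe 4 X * coframe 4 Y + coframe 5 X * coframe 5 Y +
      coframe 6 X * coframe 6 Y =
      ∑ k : Fin 4, coframe (Fin.natAdd 3 k) X * coframe (Fin.natAdd 3 k) Y := by
    rw [Fin.sum_univ_four]
    rfl
  rw [symValue_coframe, h1, h2]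
  simp only [coframe_blockEnd_low, coframe_blockEnd_high, h]
  congr 1
  · simp only [Matrix.mul_apply, Matrix.transpose_apply, Fin.sum_univ_three]
    ring
  · rw [Finset.mul_sum]
    exact Finset.sum_congr rfl fun k _ => by ring

/-- The parameters of the metric of `φ_{a,D}`. -/
def metricParam (a : ℝ) (D : Matrix (Fin 3) (Fin 3) ℝ) : Matrix (Fin 3) (Fin 3) ℝ × ℝ :=
  ((D⁻¹.det ^ (1 / 3 : ℝ) / a)⁻¹ ^ 2 • (D⁻¹ᵀ * D⁻¹), D⁻¹.det ^ (1 / 3 : ℝ) / a)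

theorem metricParam_isSymm (a : ℝ) (D : Matrix (Fin 3) (Fin 3) ℝ) :
    (metricParam a D).1.IsSymm := by
  rw [metricParam, Matrix.IsSymm, Matrix.transpose_smul, Matrix.isSymm_transpose_mul_self]

theorem det_blockMap_pos {a : ℝ} {D : Matrix (Fin 3) (Fin 3) ℝ} (ha : 0 < a) (hD : 0 < D.det) :
    0 < LinearMap.det (blockMap a D) := by
  have hd := det_inv_pos hD
  rw [blockMap_eq_blockEnd, det_blockEnd, Matrix.det_smul]
  positivity

/-- With `ν = det(D⁻¹)^(1/3) / a`, the block map scales horizontal vectors by `ν^(1/2)` and is `ν⁻¹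
D⁻¹` on vertical ones. -/
theorem stdIP_blockMap {a : ℝ} {D : Matrix (Fin 3) (Fin 3) ℝ} (ha : 0 < a) (hD : 0 < D.det)
    (X Y : 𝔭) : stdIP (blockMap a D X) (blockMap a D Y) =
      genSym (metricParam a D).1 (metricParam a D).2 X Y := by
  have hd := det_inv_pos hD
  have h6 : (D⁻¹.det ^ (1 / 6 : ℝ)) ^ 2 = D⁻¹.det ^ (1 / 3 : ℝ) := by
    rw [← Real.rpow_natCast, ← Real.rpow_mul hd.le]
    norm_num
  have h2 : (a ^ (1 / 2 : ℝ)) ^ 2 = a := by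
    rw [← Real.rpow_natCast, ← Real.rpow_mul ha.le]
    norm_num
  rw [blockMap_eq_blockEnd, stdIP_blockEnd, div_pow, h6, h2, Matrix.transpose_smul,
    Matrix.smul_mul, Matrix.mul_smul, smul_smul, metricParam, inv_div, ← sq]

theorem isMetricOf_phi {a : ℝ} {D : Matrix (Fin 3) (Fin 3) ℝ} (ha : 0 < a) (hD : 0 < D.det) :
    IsMetricOf (phi a D) fun X Y => genSym (metricParam a D).1 (metricParam a D).2 X Y := by
  have h := (isMetricOf_φ₀_comp (LinearMap.equivOfDetNeZero _ (det_blockMap_pos ha hD).ne')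
    (genSym (metricParam a D).1 (metricParam a D).2)).2 fun X Y => (stdIP_blockMap ha hD X Y).symm
  rw [phi_eq_comp_blockMap ha hD]
  exact h

theorem minorsPos_of_quadratic {S : Matrix (Fin 3) (Fin 3) ℝ} (hS : S.IsSymm)
    (h : ∀ x : Fin 3 → ℝ, x ≠ 0 → 0 < x ⬝ᵥ S *ᵥ x) : MinorsPos S := by
  have hpd : S.PosDef := by
    refine Matrix.PosDef.of_dotProduct_mulVec_pos ?_ fun x hx => ?_
    · rw [Matrix.IsHermitian, Matrix.conjTranspose_eq_transpose_of_trivial]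
      exact hS
    · simpa using h x hx
  have h1 : 0 < S 0 0 := by
    have := h ![1, 0, 0] (fun h => by simpa using congrFun h 0)
    simpa [Matrix.mulVec, dotProduct, Fin.sum_univ_three] using this
  refine ⟨h1, ?_, hpd.det_pos⟩
  -- On this vector the quadratic form equals `S₀₀ (S₀₀ S₁₁ - S₀₁²)`.
  have := h ![S 0 1, -S 0 0, 0] (fun h => h1.ne' (by simpa using congrFun h 1))
  simp [Matrix.mulVec, dotProduct, Fin.sum_univ_three, hS.apply 0 1] at this
  have h2 : 0 < S 0 0 * minor2 S := by
    rw [minor2]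
    nlinarith
  exact pos_of_mul_pos_right h2 h1.le

theorem minorsPos_of_posDef {S : Matrix (Fin 3) (Fin 3) ℝ} {ν : ℝ} (hS : S.IsSymm)
    (h : PosDef (genSym S ν)) : MinorsPos S ∧ 0 < ν := by
  constructor
  · refine minorsPos_of_quadratic hS fun x hx => ?_
    set U : 𝔭 := ∑ m : Fin 3, x m • frame (Fin.castLE (by norm_num) m) with hU
    have hU11 : ∀ m, imc m (U.1 1 1) = x m := by
      intro m
      fin_cases m <;> simp [hU, Fin.sum_univ_three, frame_11]
    have hU01 : U.1 0 1 = 0 := by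
      simp [hU, Fin.sum_univ_three, frame_00]
    have hU0 : U ≠ 0 := by
      intro h1
      apply hx
      funext m
      rw [← hU11, h1]
      simp
    have h1 := h U hU0
    rw [genSym_apply, symValue, hU01] at h1
    simp only [hU11] at h1
    simp [Fin.sum_univ_three] at h1
    simp [Matrix.mulVec, dotProduct, Fin.sum_univ_three]
    linarith
  · have h1 : frame 6 ≠ 0 := by
      intro h1
      have := congrArg (coframe 6) h1
      rw [coframe_frame] at this
      simp at this
    have := h _ h1
    rw [symValue_coframe] at this
    simpa [coframe_frame, frame_11] using this

theorem posDef_genSym {N : Matrix (Fin 3) (Fin 3) ℝ} {ν : ℝ} (hN : N.det ≠ 0) (hν : 0 < ν) :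
    PosDef (genSym (Nᵀ * N) ν) := by
  intro X hX
  have h : LinearMap.det (blockEnd N √ν) ≠ 0 := by
    rw [det_blockEnd]
    positivity
  have h1 := stdIP_blockEnd N √ν X X
  rw [Real.sq_sqrt hν.le] at h1
  rw [← h1]
  refine stdIP_self_pos fun h2 => hX ?_
  exact (LinearMap.equivOfDetNeZero _ h).map_eq_zero_iff.1 h2

/-- Sylvester's criterion; for the converse, Cholesky writes the form as the pullback of the
standard one by an invertible block map. -/
theorem posDef_genSym_iff {S : Matrix (Fin 3) (Fin 3) ℝ} {ν : ℝ} (hS : S.IsSymm) :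
    PosDef (genSym S ν) ↔ MinorsPos S ∧ 0 < ν := by
  refine ⟨minorsPos_of_posDef hS, fun h => ?_⟩
  rw [← chol_transpose_mul_chol hS h.1]
  exact posDef_genSym (det_chol_pos h.1).ne' h.2

theorem metricParam_pos {a : ℝ} {D : Matrix (Fin 3) (Fin 3) ℝ} (ha : 0 < a) (hD : 0 < D.det) :
    MinorsPos (metricParam a D).1 ∧ 0 < (metricParam a D).2 := by
  refine minorsPos_of_posDef (metricParam_isSymm a D) fun X hX => ?_
  rw [← stdIP_blockMap ha hD]
  refine stdIP_self_pos fun h2 => hX ?_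
  exact (LinearMap.equivOfDetNeZero _ (det_blockMap_pos ha hD).ne').map_eq_zero_iff.1 h2

/-- The inverse of the Cholesky factor of `ν² S`. -/
def cholD (S : Matrix (Fin 3) (Fin 3) ℝ) (ν : ℝ) : Matrix (Fin 3) (Fin 3) ℝ := (ν • chol S)⁻¹

/-- The parameter `a` of a metric. -/
def cholA (S : Matrix (Fin 3) (Fin 3) ℝ) (ν : ℝ) : ℝ := (ν • chol S).det ^ (1 / 3 : ℝ) / ν

section

variable {S : Matrix (Fin 3) (Fin 3) ℝ} {ν : ℝ}

theorem det_smul_chol_pos (h : MinorsPos S) (hν : 0 < ν) : 0 < (ν • chol S).det := by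
  rw [Matrix.det_smul]
  have := det_chol_pos h
  positivity

theorem det_cholD_pos (h : MinorsPos S) (hν : 0 < ν) : 0 < (cholD S ν).det :=
  det_inv_pos (det_smul_chol_pos h hν)

theorem cholA_pos (h : MinorsPos S) (hν : 0 < ν) : 0 < cholA S ν := by
  have := det_smul_chol_pos h hν
  rw [cholA]
  positivity

/-- Solving `S = ν⁻² D⁻ᵀ D⁻¹` for a triangular `D⁻¹` gives `D⁻¹ = ν chol S`; then `ν =
det(D⁻¹)^(1/3) / a` determines `a`. -/
theorem metricParam_chol (hS : S.IsSymm) (h : MinorsPos S) (hν : 0 < ν) :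
    metricParam (cholA S ν) (cholD S ν) = (S, ν) := by
  have hd := det_smul_chol_pos h hν
  have h1 : (cholD S ν)⁻¹ = ν • chol S := inv_inv_of_det_pos hd
  have h2 : (ν • chol S).det ^ (1 / 3 : ℝ) / cholA S ν = ν := by
    rw [cholA]
    have : 0 < (ν • chol S).det ^ (1 / 3 : ℝ) := by positivity
    field_simp
  rw [metricParam, h1, h2]
  refine Prod.ext ?_ rfl
  rw [Matrix.transpose_smul, Matrix.smul_mul, Matrix.mul_smul, chol_transpose_mul_chol hS h,
    smul_smul, smul_smul]
  have : ν⁻¹ ^ 2 * ν * ν = 1 := by field_simp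
  rw [this, one_smul]

end

theorem metricParam_mul {a : ℝ} {D A : Matrix (Fin 3) (Fin 3) ℝ}
    (hA : A ∈ Matrix.specialOrthogonalGroup (Fin 3) ℝ) : metricParam a (D * A) = metricParam a D := by
  obtain ⟨h1, h2⟩ := Matrix.mem_specialOrthogonalGroup_iff.1 hA
  have h3 := (Matrix.mem_orthogonalGroup_iff (Fin 3) ℝ).1 h1
  have h4 : A⁻¹ = Aᵀ := Matrix.inv_eq_right_inv h3
  have h5 : (D * A)⁻¹ = Aᵀ * D⁻¹ := by rw [Matrix.mul_inv_rev, h4]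
  have h6 : (Aᵀ * D⁻¹).det = D⁻¹.det := by rw [Matrix.det_mul, Matrix.det_transpose, h2, one_mul]
  have h7 : (Aᵀ * D⁻¹)ᵀ * (Aᵀ * D⁻¹) = D⁻¹ᵀ * D⁻¹ := by
    rw [Matrix.transpose_mul, Matrix.transpose_transpose, Matrix.mul_assoc, ← Matrix.mul_assoc A]
    have : A * Aᵀ = 1 := h3
    rw [this, Matrix.one_mul]
  rw [metricParam, h5, h6, h7, metricParam]

/-- Equal `ν` and equal `S` give equal Gram matrices `D⁻ᵀ D⁻¹`, so `D⁻¹ D'` is orthogonal. Its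
determinant is positive, hence `1`; then `det D = det D'`, and equality of `ν` gives `a = a'`. -/
theorem metricParam_eq_iff {a a' : ℝ} {D D' : Matrix (Fin 3) (Fin 3) ℝ} (ha : 0 < a) (ha' : 0 < a')
    (hD : 0 < D.det) (hD' : 0 < D'.det) : metricParam a D = metricParam a' D' ↔
      a' = a ∧ ∃ A ∈ Matrix.specialOrthogonalGroup (Fin 3) ℝ, D' = D * A := by
  constructor
  · intro h
    have hd := det_inv_pos hD
    have hd' := det_inv_pos hD'
    obtain ⟨h1, h2⟩ := Prod.ext_iff.1 h
    simp only [metricParam] at h1 h2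
    have hν : 0 < D'⁻¹.det ^ (1 / 3 : ℝ) / a' := by positivity
    rw [h2] at h1
    have h3 : D⁻¹ᵀ * D⁻¹ = D'⁻¹ᵀ * D'⁻¹ :=
      smul_right_injective _ (show (D'⁻¹.det ^ (1 / 3 : ℝ) / a')⁻¹ ^ 2 ≠ 0 by positivity) h1
    have hu : IsUnit D.det := isUnit_iff_ne_zero.2 hD.ne'
    have hu' : IsUnit D'.det := isUnit_iff_ne_zero.2 hD'.ne'
    have h4 : (D⁻¹ * D')ᵀ * (D⁻¹ * D') = 1 := by
      rw [Matrix.transpose_mul, Matrix.mul_assoc, ← Matrix.mul_assoc D⁻¹ᵀ, h3, Matrix.mul_assoc,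
        Matrix.nonsing_inv_mul _ hu', Matrix.mul_one, ← Matrix.transpose_mul,
        Matrix.nonsing_inv_mul _ hu', Matrix.transpose_one]
    have h5 : (D⁻¹ * D').det = 1 := by
      have h6 := congrArg Matrix.det h4
      rw [Matrix.det_mul, Matrix.det_transpose, Matrix.det_one] at h6
      have h7 : 0 < (D⁻¹ * D').det := by
        rw [Matrix.det_mul]
        positivity
      nlinarith
    have h8 : D' = D * (D⁻¹ * D') := by
      rw [← Matrix.mul_assoc, Matrix.mul_nonsing_inv _ hu, Matrix.one_mul]
    refine ⟨?_, D⁻¹ * D', ?_, h8⟩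
    · have h9 : D⁻¹.det = D'⁻¹.det := by
        rw [Matrix.det_mul] at h5
        rw [Matrix.det_nonsing_inv D', Ring.inverse_eq_inv']
        exact eq_inv_of_mul_eq_one_left h5
      rw [h9] at h2
      have h10 : 0 < D'⁻¹.det ^ (1 / 3 : ℝ) := by positivity
      field_simp at h2
      exact h2
    · exact Matrix.mem_specialOrthogonalGroup_iff.2
        ⟨(Matrix.mem_orthogonalGroup_iff' (Fin 3) ℝ).2 h4, h5⟩
  · rintro ⟨rfl, A, hA, rfl⟩
    exact (metricParam_mul hA).symm

/-! ### The metric as a submersion -/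

/-- The metric of `φ_{a,D}` in coordinates. -/
def metricCoord (q : ℝ × (Fin 3 → Fin 3 → ℝ)) : Fin 7 → ℝ :=
  symVec (metricParam q.1 (Matrix.of q.2))

/-- The coordinates of the positive definite invariant forms. -/
def posSet : Set (Fin 7 → ℝ) := {t | MinorsPos (symMat t) ∧ 0 < t 6}

theorem posDef_symEquiv_iff (t : Fin 7 → ℝ) : PosDef (symEquiv t).1 ↔ t ∈ posSet :=
  posDef_genSym_iff (symMat_isSymm t)

theorem contDiff_symMat (i j : Fin 3) : ContDiff ℝ ∞ fun t => symMat t i j := by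
  fin_cases i <;> fin_cases j <;> exact contDiff_apply ℝ ℝ _

theorem isOpen_posSet : IsOpen posSet := by
  have h := fun i j => (contDiff_symMat i j).continuous
  have h1 : Continuous fun t => minor2 (symMat t) := by
    unfold minor2
    fun_prop
  have h2 : Continuous fun t => (symMat t).det := by
    simp only [Matrix.det_fin_three]
    fun_prop
  have h3 : IsOpen {t | 0 < symMat t 0 0} := isOpen_lt continuous_const (h 0 0)
  have h4 : IsOpen {t | 0 < minor2 (symMat t)} := isOpen_lt continuous_const h1
  have h5 : IsOpen {t | 0 < (symMat t).det} := isOpen_lt continuous_const h2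
  have h6 : IsOpen {t : Fin 7 → ℝ | 0 < t 6} := isOpen_lt continuous_const (continuous_apply 6)
  exact (h3.inter (h4.inter h5)).inter h6

theorem symMat_metricCoord (q : ℝ × (Fin 3 → Fin 3 → ℝ)) :
    (symMat (metricCoord q), metricCoord q 6) = metricParam q.1 (Matrix.of q.2) :=
  Prod.ext (symMat_symVec (metricParam_isSymm _ _) _) rfl

theorem metricCoord_mem {q : ℝ × (Fin 3 → Fin 3 → ℝ)} (hq : q ∈ ParamDomain) :
    metricCoord q ∈ posSet := by
  have h := metricParam_pos hq.1 hq.2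
  rw [← symMat_metricCoord] at h
  exact h

theorem metricCoord_eq_iff {q q' : ℝ × (Fin 3 → Fin 3 → ℝ)} :
    metricCoord q = metricCoord q' ↔
      metricParam q.1 (Matrix.of q.2) = metricParam q'.1 (Matrix.of q'.2) := by
  refine ⟨fun h => ?_, fun h => ?_⟩
  · rw [← symMat_metricCoord, ← symMat_metricCoord, h]
  · rw [metricCoord, metricCoord, h]

theorem contDiffOn_metricCoord : ContDiffOn ℝ ∞ metricCoord ParamDomain := by
  have hD : ∀ i j, ContDiffOn ℝ ∞
      (fun q : ℝ × (Fin 3 → Fin 3 → ℝ) => (Matrix.of q.2)⁻¹ i j) ParamDomain :=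
    contDiffOn_inv (fun i j => by
      simp only [Matrix.of_apply]
      fun_prop) fun q hq => hq.2.ne'
  have hν : ContDiffOn ℝ ∞
      (fun q : ℝ × (Fin 3 → Fin 3 → ℝ) => (Matrix.of q.2)⁻¹.det ^ (1 / 3 : ℝ) / q.1) ParamDomain :=
    ((contDiffOn_det hD).rpow_const_of_ne fun q hq => (det_inv_pos hq.2).ne').div
      contDiff_fst.contDiffOn fun q hq => hq.1.ne'
  have hS : ∀ i j, ContDiffOn ℝ ∞
      (fun q : ℝ × (Fin 3 → Fin 3 → ℝ) => (metricParam q.1 (Matrix.of q.2)).1 i j) ParamDomain := by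
    intro i j
    simp only [metricParam, Matrix.smul_apply, Matrix.mul_apply, Matrix.transpose_apply, smul_eq_mul]
    refine ((hν.inv fun q hq => ?_).pow 2).mul (ContDiffOn.sum fun k _ => (hD k i).mul (hD k j))
    have := det_inv_pos hq.2
    have := hq.1
    positivity
  refine contDiffOn_pi.2 fun i => ?_
  fin_cases i
  · exact hS 0 0
  · exact hS 0 1
  · exact hS 0 2
  · exact hS 1 1
  · exact hS 1 2
  · exact hS 2 2
  · exact hν

/-- A section of the map `(a, D) ↦ g_{φ_{a,D}}`, twisted by a matrix. -/
def cholCoord (A : Matrix (Fin 3) (Fin 3) ℝ) (t : Fin 7 → ℝ) : ℝ × (Fin 3 → Fin 3 → ℝ) :=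
  (cholA (symMat t) (t 6), fun i j => (cholD (symMat t) (t 6) * A) i j)

theorem contDiffOn_smul_chol (i j : Fin 3) :
    ContDiffOn ℝ ∞ (fun t : Fin 7 → ℝ => (t 6 • chol (symMat t)) i j) posSet :=
  (contDiff_apply ℝ ℝ (6 : Fin 7)).contDiffOn.mul
    (contDiffOn_chol (fun i j => (contDiff_symMat i j).contDiffOn) (fun _ ht => ht.1) i j)

theorem contDiffOn_cholD (i j : Fin 3) :
    ContDiffOn ℝ ∞ (fun t : Fin 7 → ℝ => cholD (symMat t) (t 6) i j) posSet :=
  contDiffOn_inv contDiffOn_smul_chol (fun _ ht => (det_smul_chol_pos ht.1 ht.2).ne') i j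

theorem contDiffOn_cholA : ContDiffOn ℝ ∞ (fun t : Fin 7 → ℝ => cholA (symMat t) (t 6)) posSet :=
  ((contDiffOn_det contDiffOn_smul_chol).rpow_const_of_ne fun _ ht =>
    (det_smul_chol_pos ht.1 ht.2).ne').div (contDiff_apply ℝ ℝ (6 : Fin 7)).contDiffOn
      fun _ ht => ht.2.ne'

theorem contDiffOn_cholCoord (A : Matrix (Fin 3) (Fin 3) ℝ) :
    ContDiffOn ℝ ∞ (cholCoord A) posSet := by
  refine contDiffOn_cholA.prodMk (contDiffOn_pi.2 fun i => contDiffOn_pi.2 fun j => ?_)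
  simp only [Matrix.mul_apply]
  exact ContDiffOn.sum fun k _ => (contDiffOn_cholD i k).mul contDiffOn_const

theorem metricCoord_cholCoord {A : Matrix (Fin 3) (Fin 3) ℝ}
    (hA : A ∈ Matrix.specialOrthogonalGroup (Fin 3) ℝ) {t : Fin 7 → ℝ} (ht : t ∈ posSet) :
    metricCoord (cholCoord A t) = t := by
  have h : metricParam (cholA (symMat t) (t 6)) (cholD (symMat t) (t 6) * A) = (symMat t, t 6) := by
    rw [metricParam_mul hA, metricParam_chol (symMat_isSymm t) ht.1 ht.2]
  change symVec (metricParam (cholA (symMat t) (t 6)) (cholD (symMat t) (t 6) * A)) = t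
  rw [h, symVec_symMat]

theorem cholCoord_mem {A : Matrix (Fin 3) (Fin 3) ℝ}
    (hA : A ∈ Matrix.specialOrthogonalGroup (Fin 3) ℝ) {t : Fin 7 → ℝ} (ht : t ∈ posSet) :
    cholCoord A t ∈ ParamDomain := by
  refine ⟨cholA_pos ht.1 ht.2, ?_⟩
  change 0 < (cholD (symMat t) (t 6) * A).det
  rw [Matrix.det_mul, (Matrix.mem_specialOrthogonalGroup_iff.1 hA).2, mul_one]
  exact det_cholD_pos ht.1 ht.2

theorem metricCoord_image : metricCoord '' ParamDomain = posSet := by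
  refine Set.Subset.antisymm ?_ fun t ht => ?_
  · rintro _ ⟨q, hq, rfl⟩
    exact metricCoord_mem hq
  · exact ⟨_, cholCoord_mem (one_mem _) ht, metricCoord_cholCoord (one_mem _) ht⟩

theorem metricCoord_fibre {q q' : ℝ × (Fin 3 → Fin 3 → ℝ)} (hq : q ∈ ParamDomain)
    (hq' : q' ∈ ParamDomain) : metricCoord q = metricCoord q' ↔
      q'.1 = q.1 ∧ ∃ A ∈ Matrix.specialOrthogonalGroup (Fin 3) ℝ,
        Matrix.of q'.2 = Matrix.of q.2 * A := by
  rw [metricCoord_eq_iff, metricParam_eq_iff hq.1 hq'.1 hq.2 hq'.2]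

/-- The Cholesky section meets the fibre of `q` in a point differing from `q` by some `A ∈ SO(3)`.
Twisted by `A`, it is a smooth local section through `q`, and its derivative is a right inverse. -/
theorem surjective_fderiv_metricCoord {q : ℝ × (Fin 3 → Fin 3 → ℝ)} (hq : q ∈ ParamDomain) :
    Function.Surjective (fderiv ℝ metricCoord q) := by
  set t := metricCoord q with ht
  have htp : t ∈ posSet := metricCoord_mem hq
  obtain ⟨h1, A, hA, h2⟩ := (metricCoord_fibre (cholCoord_mem (one_mem _) htp) hq).1
    (metricCoord_cholCoord (one_mem _) htp)
  have h3 : cholCoord A t = q := by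
    refine Prod.ext h1.symm ?_
    change (fun i j => (cholD (symMat t) (t 6) * A) i j) = q.2
    have h4 : Matrix.of (cholCoord 1 t).2 = cholD (symMat t) (t 6) :=
      Matrix.mul_one (cholD (symMat t) (t 6))
    rw [h4] at h2
    rw [← h2]
    rfl
  have hd1 : DifferentiableAt ℝ (cholCoord A) t :=
    ((contDiffOn_cholCoord A).contDiffAt (isOpen_posSet.mem_nhds htp)).differentiableAt (by simp)
  have hd2 : DifferentiableAt ℝ metricCoord (cholCoord A t) := by
    rw [h3]
    exact (contDiffOn_metricCoord.contDiffAt (isOpen_ParamDomain.mem_nhds hq)).differentiableAt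
      (by simp)
  have h5 : fderiv ℝ (metricCoord ∘ cholCoord A) t = ContinuousLinearMap.id ℝ _ := by
    have : metricCoord ∘ cholCoord A =ᶠ[nhds t] id := by
      filter_upwards [isOpen_posSet.mem_nhds htp] with u hu
      exact metricCoord_cholCoord hA hu
    rw [this.fderiv_eq, fderiv_id]
  rw [fderiv_comp t hd2 hd1, h3] at h5
  intro v
  exact ⟨fderiv ℝ (cholCoord A) t v, congrArg (fun f => f v) h5⟩

theorem exists_metricCoord :
    ∃ (c : (Fin 7 → ℝ) ≃ₗ[ℝ] InvSym𝔭) (m : ℝ × (Fin 3 → Fin 3 → ℝ) → (Fin 7 → ℝ)),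
      IsOpen {t | PosDef (c t).1} ∧ m '' ParamDomain = {t | PosDef (c t).1} ∧
      ContDiffOn ℝ ∞ m ParamDomain ∧
      (∀ q ∈ ParamDomain, Function.Surjective (fderiv ℝ m q)) ∧
      (∀ q ∈ ParamDomain,
        IsMetricOf (phi q.1 (Matrix.of q.2)) (fun X Y => (c (m q)).1 X Y)) ∧
      ∀ q ∈ ParamDomain, ∀ q' ∈ ParamDomain, m q = m q' ↔
        q'.1 = q.1 ∧ ∃ A ∈ Matrix.specialOrthogonalGroup (Fin 3) ℝ,
          Matrix.of q'.2 = Matrix.of q.2 * A := by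
  have hset : {t | PosDef (symEquiv t).1} = posSet := Set.ext posDef_symEquiv_iff
  refine ⟨symEquiv, metricCoord, ?_, ?_, contDiffOn_metricCoord,
    fun q hq => surjective_fderiv_metricCoord hq, fun q hq => ?_,
    fun q hq q' hq' => metricCoord_fibre hq hq'⟩
  · rw [hset]
    exact isOpen_posSet
  · rw [hset, metricCoord_image]
  · have h := isMetricOf_phi hq.1 hq.2
    rw [← symMat_metricCoord] at h
    exact h

end SpSphere
end

/-! ### From `𝔭` to the sphere: invariant forms and metrics. -/

noncomputable section

namespace SpSphere

/-! ### The action of `Sp(2)` on the sphere -/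

theorem coe_smul (A : Sp2) (x : S7) : ((A • x : S7) : H2) = act A x := rfl

theorem act_apply (A : Matrix (Fin 2) (Fin 2) ℍ[ℝ]) (x : H2) (i : Fin 2) :
    act A x i = A i 0 * x 0 + A i 1 * x 1 := by
  change (A *ᵥ x.ofLp) i = _
  simp [Matrix.mulVec, dotProduct, Fin.sum_univ_two]

theorem o_zero : (o : H2) 0 = 0 := rfl

theorem o_one : (o : H2) 1 = 1 := rfl

theorem ext_H2 {x y : H2} (h0 : x 0 = y 0) (h1 : x 1 = y 1) : x = y := by
  refine PiLp.ext fun i => ?_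
  fin_cases i
  exacts [h0, h1]

theorem act_o (A : Matrix (Fin 2) (Fin 2) ℍ[ℝ]) (i : Fin 2) : act A o i = A i 1 := by
  rw [act_apply, o_zero, o_one, mul_zero, mul_one, zero_add]

/-- The real-bilinear map underlying the hermitian product `x* y` on `ℍ²`. -/
def herm : H2 →ₗ[ℝ] H2 →ₗ[ℝ] ℍ[ℝ] :=
  LinearMap.mk₂ ℝ (fun x y => star (x 0) * y 0 + star (x 1) * y 1)
    (fun x x' y => by simp [add_mul]; abel) (fun c x y => by simp)
    (fun x y y' => by simp [mul_add]; abel) (fun c x y => by simp)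

theorem herm_apply (x y : H2) : herm x y = star (x 0) * y 0 + star (x 1) * y 1 := rfl

theorem herm_eq_dotProduct (x y : H2) : herm x y = star x.ofLp ⬝ᵥ y.ofLp := by
  simp [herm_apply, dotProduct, Fin.sum_univ_two]

theorem herm_act (A : Sp2) (x y : H2) : herm (act A x) (act A y) = herm x y := by
  have hA : (A : Matrix (Fin 2) (Fin 2) ℍ[ℝ])ᴴ * (A : Matrix (Fin 2) (Fin 2) ℍ[ℝ]) = 1 :=
    A.2.1
  rw [herm_eq_dotProduct, herm_eq_dotProduct, act, act]
  simp only [Matrix.star_mulVec]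
  rw [← Matrix.dotProduct_mulVec, Matrix.mulVec_mulVec, hA, Matrix.one_mulVec]

theorem herm_self (x : S7) : herm x x = 1 := by
  have hx : ‖(x : H2)‖ = 1 := by simp
  rw [herm_eq_dotProduct, ← norm_sq_eq, hx]
  simp

theorem herm_re (x y : H2) : (herm x y).re = inner ℝ x y := by
  simp [herm_apply, PiLp.inner_apply, Fin.sum_univ_two, Quaternion.inner_def]

theorem herm_o (y : H2) : herm o y = y 1 := by
  simp [herm_apply, o_zero, o_one]

theorem act_inv_act (A : Sp2) (x : H2) : act (A⁻¹ : Sp2) (act A x) = x := by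
  have hA : ((A⁻¹ : Sp2) : Matrix (Fin 2) (Fin 2) ℍ[ℝ]) * (A : Matrix (Fin 2) (Fin 2) ℍ[ℝ]) = 1 :=
    A.2.1
  rw [act, act, Matrix.mulVec_mulVec, hA, Matrix.one_mulVec]

theorem act_act_inv (A : Sp2) (x : H2) : act A (act (A⁻¹ : Sp2) x) = x := by
  simpa using act_inv_act A⁻¹ x

theorem exists_smul_o (x : S7) : ∃ A : Sp2, A • o = x := by
  -- Polar form of the second coordinate; when that coordinate is zero any unit `y` will do, and `1`
  -- is taken.
  obtain ⟨y, hy, hxy⟩ : ∃ y : ℍ[ℝ], star y * y = 1 ∧ (x : H2) 1 = ‖(x : H2) 1‖ • y := by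
    by_cases h : (x : H2) 1 = 0
    · exact ⟨1, by simp, by simp [h]⟩
    · have hn : ‖(x : H2) 1‖ ≠ 0 := norm_ne_zero_iff.2 h
      refine ⟨‖(x : H2) 1‖⁻¹ • (x : H2) 1, ?_, by rw [smul_smul, mul_inv_cancel₀ hn, one_smul]⟩
      rw [Quaternion.star_smul, smul_mul_smul_comm, Quaternion.star_mul_self,
        Quaternion.normSq_eq_norm_mul_self]
      rw [← Quaternion.coe_smul, smul_eq_mul, ← mul_inv, inv_mul_cancel₀ (mul_ne_zero hn hn),
        Quaternion.coe_one]
  have hs := herm_self x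
  rw [herm_apply] at hs
  set r := ‖(x : H2) 1‖
  have hr : star ((x : H2) 1) * (x : H2) 1 = (r : ℍ[ℝ]) * r := by
    rw [hxy, Quaternion.star_smul, smul_mul_smul_comm, hy, ← Quaternion.coe_mul]
    exact (Algebra.algebraMap_eq_smul_one (r * r)).symm
  -- The second column is `x`. The first, `(r, -y x₀*)`, is a unit vector orthogonal to it because
  -- `y* x₁ = r`.
  let A : Matrix (Fin 2) (Fin 2) ℍ[ℝ] :=
    !![(r : ℍ[ℝ]), (x : H2) 0; -(y * star ((x : H2) 0)), (x : H2) 1]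
  have h2 : (x : H2) 1 = (r : ℍ[ℝ]) * y := by rw [hxy, Quaternion.coe_mul_eq_smul]
  have hA : star A * A = 1 := by
    ext i j : 1
    rw [Matrix.mul_apply, Fin.sum_univ_two]
    simp only [Matrix.star_apply]
    fin_cases i <;> fin_cases j
    · have : (x : H2) 0 * star y * (y * star ((x : H2) 0)) = star ((x : H2) 0) * (x : H2) 0 := by
        rw [mul_assoc, ← mul_assoc (star y), hy, one_mul, Quaternion.star_mul_self,
          Quaternion.self_mul_star]
      simp [A, this, ← hs, hr, add_comm]
    · simp [A, mul_assoc]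
      rw [h2, Quaternion.coe_commutes r y, ← mul_assoc (star y), hy, one_mul,
        Quaternion.coe_commutes, add_neg_cancel]
    · simp [A]
      rw [h2, star_mul, ← mul_assoc, mul_assoc (star y), Quaternion.star_coe,
        Quaternion.coe_commutes, ← mul_assoc, hy, one_mul, Quaternion.coe_commutes]
      simp
    · simpa [A] using hs
  refine ⟨⟨A, hA, mul_eq_one_comm.1 hA⟩, Subtype.ext (ext_H2 ?_ ?_)⟩
  · rw [coe_smul, act_o]; rfl
  · rw [coe_smul, act_o]; rfl

theorem isPretransitive : MulAction.IsPretransitive Sp2 S7 where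
  exists_smul_eq x y := by
    obtain ⟨A, rfl⟩ := exists_smul_o x
    obtain ⟨B, rfl⟩ := exists_smul_o y
    exact ⟨B * A⁻¹, by simp [mul_smul]⟩

theorem stabilizer_o : MulAction.stabilizer Sp2 o = Sp1 := by
  ext A
  rw [MulAction.mem_stabilizer_iff]
  constructor
  · intro h
    have h1 : ∀ i, (A : Matrix (Fin 2) (Fin 2) ℍ[ℝ]) i 1 = (o : H2) i := fun i => by
      rw [← act_o (A : Matrix (Fin 2) (Fin 2) ℍ[ℝ]), ← coe_smul, h]
    have h0 : (A : Matrix (Fin 2) (Fin 2) ℍ[ℝ]) 1 0 = 0 := by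
      -- The second column is `(0, 1)`, so orthogonality to the first column kills the lower left
      -- entry.
      have := congrFun (congrFun A.2.1 1) 0
      simpa [Matrix.mul_apply, Fin.sum_univ_two, Matrix.star_apply, h1, o_zero, o_one] using this
    refine ⟨A.1 0 0, ?_⟩
    ext i j : 1
    fin_cases i <;> fin_cases j <;> simp [h0, h1, o_zero, o_one]
  · rintro ⟨q, hq⟩
    refine Subtype.ext (ext_H2 ?_ ?_) <;> rw [coe_smul, act_o, hq] <;> rfl

/-! ### Derivatives of maps of the sphere induced by linear maps -/

/-- A matrix acting on `ℍ²`, as a continuous real-linear map. -/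
def actL (A : Matrix (Fin 2) (Fin 2) ℍ[ℝ]) : H2 →L[ℝ] H2 :=
  LinearMap.toContinuousLinearMap
    { toFun := act A
      map_add' := fun x y => by
        rw [act, WithLp.ofLp_add, Matrix.mulVec_add, WithLp.toLp_add]; rfl
      map_smul' := fun c x => by
        rw [act, WithLp.ofLp_smul, Matrix.mulVec_smul, WithLp.toLp_smul]; rfl }

theorem contMDiff_of_linear {f : S7 → S7} (L : H2 →L[ℝ] H2) (h : ∀ x, (f x : H2) = L x) :
    ContMDiff (𝓡 7) (𝓡 7) ∞ f := by
  have h1 : ContMDiff (𝓡 7) 𝓘(ℝ, H2) ∞ fun x : S7 => L x :=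
    L.contDiff.contMDiff.comp contMDiff_coe_sphere
  have h2 : ∀ x : S7, L x ∈ Metric.sphere (0 : H2) 1 := fun x => by
    rw [← h]
    exact (f x).2
  have h3 := h1.codRestrict_sphere (n := 7) h2
  have h4 : f = Set.codRestrict (fun x : S7 => L x) _ h2 := funext fun x => Subtype.ext (h x)
  rw [h4]
  exact h3

theorem mdifferentiableAt_coe (x : S7) :
    MDifferentiableAt (𝓡 7) 𝓘(ℝ, H2) (Subtype.val : S7 → H2) x :=
  (contMDiff_coe_sphere (m := 1) x).mdifferentiableAt one_ne_zero

/-- The inclusion intertwines `f` with `L`, and a linear map is its own derivative. Since `dIncl` is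
injective, derivatives of such maps are handled in `ℍ²` and no charts of the sphere are needed. -/
theorem dIncl_mfderiv {f : S7 → S7} (L : H2 →L[ℝ] H2) (h : ∀ x, (f x : H2) = L x) (x : S7)
    (v : T x) : dIncl (f x) (mfderiv (𝓡 7) (𝓡 7) f x v) = L (dIncl x v) := by
  have hf : MDifferentiableAt (𝓡 7) (𝓡 7) f x :=
    (contMDiff_of_linear L h).mdifferentiable (by simp) x
  have h1 := mfderiv_comp_apply x (mdifferentiableAt_coe (f x)) hf v
  have hL : MDifferentiableAt 𝓘(ℝ, H2) 𝓘(ℝ, H2) L (x : H2) := L.mdifferentiableAt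
  have h2 := mfderiv_comp_apply x hL (mdifferentiableAt_coe x) v
  have h3 : (Subtype.val : S7 → H2) ∘ f = L ∘ (Subtype.val : S7 → H2) := funext h
  rw [h3] at h1
  rw [ContinuousLinearMap.mfderiv_eq] at h2
  exact h1.symm.trans h2

theorem dIncl_dAct (A : Sp2) (x : S7) (v : T x) : dIncl (A • x) (dAct A x v) = act A (dIncl x v) :=
  dIncl_mfderiv (f := fun y => A • y) (actL A) (fun _ => rfl) x v

theorem herm_dIncl_re (x : S7) (v : T x) : (herm x (dIncl x v)).re = 0 := by
  have h : LinearMap.range (dIncl x) = (Submodule.span ℝ {(x : H2)})ᗮ :=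
    range_mvfderiv_subtypeVal x
  have h1 : dIncl x v ∈ LinearMap.range (dIncl x) := ⟨v, rfl⟩
  rw [h, Submodule.mem_orthogonal_singleton_iff_inner_right] at h1
  rw [herm_re, h1]

end SpSphere

end

noncomputable section

namespace SpSphere

/-! ### Moving tangent vectors to the base point -/

/-- The projection `ℍ² → 𝔭` which is a left inverse of `X ↦ X o`. -/
def toFrame : H2 →ₗ[ℝ] 𝔭 where
  toFun y := ⟨!![0, y 0; -star (y 0), (y 1).im], by
    refine ⟨?_, rfl⟩
    ext i j : 1
    fin_cases i <;> fin_cases j <;> simp [Matrix.conjTranspose_apply]⟩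
  map_add' x y := ext_entries (Quaternion.im_add _ _) rfl
  map_smul' c x := ext_entries (Quaternion.im_smul _ _) rfl

theorem velocity_apply (X : 𝔭) (i : Fin 2) : velocity X i = X.1 i 1 := act_o X.1 i

theorem toFrame_velocity (X : 𝔭) : toFrame (velocity X) = X := by
  refine ext_entries ?_ ?_
  · change (velocity X 1).im = X.1 1 1
    rw [velocity_apply]
    have := mem_𝔭_im X.2
    ext <;> simp_all
  · change velocity X 0 = X.1 0 1
    rw [velocity_apply]

theorem velocity_toFrame {y : H2} (hy : (y 1).re = 0) : velocity (toFrame y) = y := by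
  refine ext_H2 (velocity_apply _ _) ((velocity_apply _ _).trans ?_)
  change (y 1).im = y 1
  ext <;> simp [hy]

/-- An element of `Sp(2)` which takes `o` to `x`. -/
def lift (x : S7) : Sp2 := (exists_smul_o x).choose

theorem lift_smul (x : S7) : lift x • o = x := (exists_smul_o x).choose_spec

/-- `T_x S⁷ → T_o S⁷ ≃ 𝔭`, the derivative of the action of `A⁻¹`, where `A o = x`. -/
def toP (A : Sp2) (x : S7) : T x →ₗ[ℝ] 𝔭 :=
  toFrame ∘ₗ (actL (A⁻¹ : Sp2) : H2 →ₗ[ℝ] H2) ∘ₗ dIncl x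

/-- `toFrame` discards the real part of the second coordinate; it is zero here since tangent vectors
at `x` are orthogonal to `x`. -/
theorem velocity_toP {A : Sp2} {x : S7} (h : A • o = x) (v : T x) :
    velocity (toP A x v) = act (A⁻¹ : Sp2) (dIncl x v) := by
  refine velocity_toFrame ?_
  change (act (A⁻¹ : Sp2) (dIncl x v) 1).re = 0
  rw [← herm_o, ← herm_act A, act_act_inv, ← coe_smul, h, herm_dIncl_re]

theorem act_velocity_toP {A : Sp2} {x : S7} (h : A • o = x) (v : T x) :
    act A (velocity (toP A x v)) = dIncl x v := by
  rw [velocity_toP h, act_act_inv]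

theorem velocity_injective : Function.Injective velocity :=
  Function.LeftInverse.injective toFrame_velocity

theorem toP_injective {A : Sp2} {x : S7} (h : A • o = x) : Function.Injective (toP A x) := by
  intro v w hvw
  apply dIncl_injective x
  rw [← act_velocity_toP h, hvw, act_velocity_toP h]

theorem finrank_T (x : S7) : finrank ℝ (T x) = 7 := by
  change finrank ℝ (EuclideanSpace ℝ (Fin 7)) = 7
  simp

instance (x : S7) : FiniteDimensional ℝ (T x) :=
  inferInstanceAs (FiniteDimensional ℝ (EuclideanSpace ℝ (Fin 7)))

theorem finrank_𝔭 : finrank ℝ 𝔭 = 7 := by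
  rw [finrank_eq_card_basis frameBasis]
  simp

/-- `toP` as a linear equivalence. -/
def toPEquiv {A : Sp2} {x : S7} (h : A • o = x) : T x ≃ₗ[ℝ] 𝔭 :=
  haveI : FiniteDimensional ℝ 𝔭 := frameBasis.finiteDimensional_of_finite
  LinearMap.linearEquivOfInjective (toP A x) (toP_injective h) (by rw [finrank_T, finrank_𝔭])

theorem toP_one_θ (X : 𝔭) : toP 1 o (θ X) = X := by
  apply velocity_injective
  rw [velocity_toP (one_smul _ _), dIncl_θ]
  simp [act]

/-- The vertical component of a vector `u` at `x`. -/
def vert (x u : H2) : ℍ[ℝ] := herm x u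

/-- The hermitian product of the horizontal components of two vectors at `x`. -/
def horProd (x u w : H2) : ℍ[ℝ] := herm u w - star (herm x u) * herm x w

theorem toP_11 {A : Sp2} {x : S7} (h : A • o = x) (v : T x) :
    (toP A x v).1 1 1 = vert x (dIncl x v) := by
  rw [← velocity_apply, velocity_toP h, ← herm_o, ← herm_act A, act_act_inv, ← coe_smul, h, vert]

/-- `A` preserves hermitian products. Removing the vertical contribution from `u* w` leaves the
horizontal one, in an expression free of `A`. -/
theorem toP_01 {A : Sp2} {x : S7} (h : A • o = x) (v w : T x) :
    star ((toP A x v).1 0 1) * (toP A x w).1 0 1 = horProd x (dIncl x v) (dIncl x w) := by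
  have h1 := herm_act A (velocity (toP A x v)) (velocity (toP A x w))
  rw [act_velocity_toP h, act_velocity_toP h, herm_apply (velocity _)] at h1
  simp only [velocity_apply, toP_11 h, vert] at h1
  rw [horProd, h1, add_sub_cancel_right]

theorem vert_act (A : Sp2) (x u : H2) : vert (act A x) (act A u) = vert x u := herm_act A x u

theorem horProd_act (A : Sp2) (x u w : H2) :
    horProd (act A x) (act A u) (act A w) = horProd x u w := by
  simp only [horProd, herm_act]

/-! ### Invariant 3-forms on the sphere -/

/-- The value at `x` of the invariant 3-form with parameters `p`, `M`. -/
def formAt (p : ℝ) (M : Matrix (Fin 3) (Fin 3) ℝ) (x : S7) : T x [⋀^Fin 3]→ₗ[ℝ] ℝ :=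
  (genForm p M).compLinearMap (toP (lift x) x)

theorem genForm_toP (p : ℝ) (M : Matrix (Fin 3) (Fin 3) ℝ) {A : Sp2} {x : S7} (h : A • o = x)
    (v : Fin 3 → T x) : genForm p M (fun i => toP A x (v i)) =
      formValue p M (fun i => vert x (dIncl x (v i)))
        (fun i j => horProd x (dIncl x (v i)) (dIncl x (v j))) := by
  rw [genForm_apply]
  simp only [toP_11 h, toP_01 h]

/-- `lift` is an arbitrary, possibly discontinuous choice, but the value does not depend on it.
Smoothness and invariance are both read off from this formula. -/
theorem formAt_apply (p : ℝ) (M : Matrix (Fin 3) (Fin 3) ℝ) (x : S7) (v : Fin 3 → T x) :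
    formAt p M x v = formValue p M (fun i => vert x (dIncl x (v i)))
        (fun i j => horProd x (dIncl x (v i)) (dIncl x (v j))) :=
  genForm_toP p M (lift_smul x) v

theorem formAt_dAct (p : ℝ) (M : Matrix (Fin 3) (Fin 3) ℝ) (A : Sp2) (x : S7) (v : Fin 3 → T x) :
    formAt p M (A • x) (fun i => dAct A x (v i)) = formAt p M x v := by
  rw [formAt_apply, formAt_apply]
  simp only [dIncl_dAct, coe_smul, vert_act, horProd_act]

theorem contMDiffAt_dIncl {X : ∀ x : S7, T x} {z : S7}
    (hX : ContMDiffAt (𝓡 7) (𝓡 7).tangent ∞ (fun x => (⟨x, X x⟩ : TangentBundle (𝓡 7) S7)) z) :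
    ContMDiffAt (𝓡 7) 𝓘(ℝ, H2) ∞ (fun x => dIncl x (X x)) z := by
  have h1 : ContMDiff (𝓡 7).tangent 𝓘(ℝ, H2).tangent ∞
      (tangentMap (𝓡 7) 𝓘(ℝ, H2) (Subtype.val : S7 → H2)) :=
    (contMDiff_coe_sphere (m := ∞)).contMDiff_tangentMap (by simp)
  exact ((contMDiff_snd_tangentBundle_modelSpace H2 𝓘(ℝ, H2)).comp h1).contMDiffAt.comp z hX

/-- The hermitian product as a continuous bilinear map. -/
def hermL : H2 →L[ℝ] H2 →L[ℝ] ℍ[ℝ] := LinearMap.toContinuousBilinearMap herm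

/-- The map `(q, r) ↦ q* r` on quaternions as a continuous bilinear map. -/
def starMulL : ℍ[ℝ] →L[ℝ] ℍ[ℝ] →L[ℝ] ℍ[ℝ] :=
  LinearMap.toContinuousBilinearMap <| LinearMap.mk₂ ℝ (fun q r => star q * r)
    (fun _ _ _ => by rw [star_add, add_mul])
    (fun _ _ _ => by rw [Quaternion.star_smul, smul_mul_assoc])
    (fun _ _ _ => by rw [mul_add]) (fun _ _ _ => by rw [mul_smul_comm])

theorem contMDiffAt_bilin {E F G : Type*} [NormedAddCommGroup E] [NormedSpace ℝ E]
    [NormedAddCommGroup F] [NormedSpace ℝ F] [NormedAddCommGroup G] [NormedSpace ℝ G]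
    (B : E →L[ℝ] F →L[ℝ] G) {f : S7 → E} {g : S7 → F} {z : S7}
    (hf : ContMDiffAt (𝓡 7) 𝓘(ℝ, E) ∞ f z) (hg : ContMDiffAt (𝓡 7) 𝓘(ℝ, F) ∞ g z) :
    ContMDiffAt (𝓡 7) 𝓘(ℝ, G) ∞ (fun x => B (f x) (g x)) z :=
  (B.contMDiff.contMDiffAt.comp z hf).clm_apply hg

theorem contMDiffAt_vert {F : S7 → H2} {z : S7} (hF : ContMDiffAt (𝓡 7) 𝓘(ℝ, H2) ∞ F z) :
    ContMDiffAt (𝓡 7) 𝓘(ℝ, ℍ[ℝ]) ∞ (fun x : S7 => vert x (F x)) z :=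
  contMDiffAt_bilin hermL contMDiff_coe_sphere.contMDiffAt hF

theorem contMDiffAt_horProd {F G : S7 → H2} {z : S7} (hF : ContMDiffAt (𝓡 7) 𝓘(ℝ, H2) ∞ F z)
    (hG : ContMDiffAt (𝓡 7) 𝓘(ℝ, H2) ∞ G z) :
    ContMDiffAt (𝓡 7) 𝓘(ℝ, ℍ[ℝ]) ∞ (fun x : S7 => horProd x (F x) (G x)) z :=
  (contMDiffAt_bilin hermL hF hG).sub
    (contMDiffAt_bilin starMulL (contMDiffAt_vert hF) (contMDiffAt_vert hG))

theorem contMDiffAt_imc {Q : S7 → ℍ[ℝ]} {z : S7} (hQ : ContMDiffAt (𝓡 7) 𝓘(ℝ, ℍ[ℝ]) ∞ Q z)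
    (l : Fin 3) : ContMDiffAt (𝓡 7) 𝓘(ℝ, ℝ) ∞ (fun x => imc l (Q x)) z :=
  (LinearMap.toContinuousLinearMap (imc l)).contMDiff.contMDiffAt.comp z hQ

theorem contMDiffAt_formValue (p : ℝ) (M : Matrix (Fin 3) (Fin 3) ℝ) {η : S7 → Fin 3 → ℍ[ℝ]}
    {χ : S7 → Fin 3 → Fin 3 → ℍ[ℝ]} {z : S7}
    (hη : ∀ i, ContMDiffAt (𝓡 7) 𝓘(ℝ, ℍ[ℝ]) ∞ (fun x => η x i) z)
    (hχ : ∀ i j, ContMDiffAt (𝓡 7) 𝓘(ℝ, ℍ[ℝ]) ∞ (fun x => χ x i j) z) :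
    ContMDiffAt (𝓡 7) 𝓘(ℝ, ℝ) ∞ (fun x => formValue p M (η x) (χ x)) z := by
  have h1 : ∀ i l, ContMDiffAt (𝓡 7) 𝓘(ℝ, ℝ) ∞ (fun x => imc l (η x i)) z :=
    fun i l => contMDiffAt_imc (hη i) l
  have h2 : ∀ i j l, ContMDiffAt (𝓡 7) 𝓘(ℝ, ℝ) ∞ (fun x => omegaC l (χ x i j)) z :=
    fun i j l => contMDiffAt_const.mul (contMDiffAt_imc (hχ i j) l)
  have h3 : ∀ i j k l m n, ContMDiffAt (𝓡 7) 𝓘(ℝ, ℝ) ∞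
      (fun x => imc i (η x l) * imc j (η x m) * imc k (η x n)) z :=
    fun i j k l m n => ((h1 _ _).mul (h1 _ _)).mul (h1 _ _)
  simp only [formValue, Matrix.det_fin_three, Matrix.of_apply]
  refine (contMDiffAt_const.mul ?_).add (contMDiffAt_finsetSum fun l _ =>
    contMDiffAt_finsetSum fun m _ => contMDiffAt_const.mul
      ((((h1 _ _).mul (h2 _ _ _)).sub ((h1 _ _).mul (h2 _ _ _))).add ((h1 _ _).mul (h2 _ _ _))))
  exact (((((h3 _ _ _ _ _ _).sub (h3 _ _ _ _ _ _)).sub (h3 _ _ _ _ _ _)).add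
    (h3 _ _ _ _ _ _)).add (h3 _ _ _ _ _ _)).sub (h3 _ _ _ _ _ _)

/-- The invariant 3-form on the sphere with parameters `p`, `M`. -/
def invForm (p : ℝ) (M : Matrix (Fin 3) (Fin 3) ℝ) : InvForm where
  val := formAt p M
  property := by
    refine ⟨fun X hX => ?_, formAt_dAct p M⟩
    simp only [formAt_apply]
    exact fun x => contMDiffAt_formValue p M
      (fun i => contMDiffAt_vert (contMDiffAt_dIncl (hX i x)))
      fun i j => contMDiffAt_horProd (contMDiffAt_dIncl (hX i x)) (contMDiffAt_dIncl (hX j x))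

/-- Tangent spaces at points that are equal but not definitionally so have different types; their
vectors are compared by their images in `ℍ²`. -/
theorem form_eq_of_dIncl (φ : ∀ x : S7, T x [⋀^Fin 3]→ₗ[ℝ] ℝ) {x y : S7} (hxy : x = y)
    {u : Fin 3 → T x} {w : Fin 3 → T y} (h : ∀ i, dIncl x (u i) = dIncl y (w i)) :
    φ x u = φ y w := by
  subst hxy
  congr 1
  funext i
  exact dIncl_injective x (h i)

/-- As `h⁻¹` fixes `o`, one has `(h X h⁻¹) o = h (X o)`: the derivative of the action at `o` is the
isotropy representation. -/
theorem velocity_Ad (h : Sp1) (X : 𝔭) : velocity (Ad h X) = act (h : Sp2) (velocity X) := by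
  obtain ⟨q, hq⟩ := h.2
  have h10 : (h : Sp2).1 1 0 = 0 := by rw [hq]; rfl
  have h01 : (h : Sp2).1 0 1 = 0 := by rw [hq]; rfl
  have h11 : (h : Sp2).1 1 1 = 1 := by rw [hq]; rfl
  refine ext_H2 ?_ ?_
  · rw [velocity_apply, act_apply, Ad_apply_01, velocity_apply, velocity_apply, h01, zero_mul,
      add_zero]
  · rw [velocity_apply, act_apply, Ad_apply_11, velocity_apply, velocity_apply, h10, h11, zero_mul,
      zero_add, one_mul]

theorem Sp1_smul_o (h : Sp1) : (h : Sp2) • o = o :=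
  MulAction.mem_stabilizer_iff.1 (by rw [stabilizer_o]; exact h.2)

theorem invForm_restrict_mem (φ : InvForm) : (φ.1 o).compLinearMap θ ∈ InvForm𝔭 := by
  intro h
  ext v
  simp only [AlternatingMap.compLinearMap_apply]
  rw [← φ.2.2 (h : Sp2) o fun i => θ (v i)]
  refine form_eq_of_dIncl φ.1 (Sp1_smul_o h).symm fun i => ?_
  rw [dIncl_dAct, dIncl_θ, dIncl_θ, velocity_Ad]

theorem invForm_apply_eq (φ : InvForm) {A : Sp2} {x : S7} (h : A • o = x) (v : Fin 3 → T x) :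
    φ.1 x v = φ.1 o (fun i => θ (toP A x (v i))) := by
  rw [← φ.2.2 A o]
  refine form_eq_of_dIncl φ.1 h.symm fun i => ?_
  rw [dIncl_dAct, dIncl_θ, act_velocity_toP h]

theorem invForm_eq_compLinearMap (φ : InvForm) {A : Sp2} {x : S7} (h : A • o = x) :
    φ.1 x = ((φ.1 o).compLinearMap θ).compLinearMap (toP A x) := by
  ext v
  exact invForm_apply_eq φ h v

/-- Restriction of invariant 3-forms to `𝔭`. -/
def restrictForm : InvForm →ₗ[ℝ] InvForm𝔭 where
  toFun φ := ⟨(φ.1 o).compLinearMap θ, (invForm_restrict_mem φ)⟩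
  map_add' _ _ := rfl
  map_smul' _ _ := rfl

theorem invForm_restrict (p : ℝ) (M : Matrix (Fin 3) (Fin 3) ℝ) :
    ((invForm p M).1 o).compLinearMap θ = genForm p M := by
  ext v
  change formAt p M o (fun i => θ (v i)) = _
  rw [formAt_apply, ← genForm_toP p M (one_smul Sp2 o)]
  simp only [toP_one_θ]

/-- Transitivity gives injectivity; the explicit global formula gives an extension of every
invariant form on `𝔭`. -/
theorem restrictForm_bijective : Function.Bijective restrictForm := by
  refine ⟨fun φ ψ h => ?_, fun ψ => ?_⟩
  · have h1 : (φ.1 o).compLinearMap θ = (ψ.1 o).compLinearMap θ := congrArg Subtype.val h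
    refine Subtype.ext (funext fun x => ?_)
    rw [invForm_eq_compLinearMap φ (lift_smul x), invForm_eq_compLinearMap ψ (lift_smul x), h1]
  · exact ⟨invForm _ _, Subtype.ext ((invForm_restrict _ _).trans (genForm_formParam ψ.2))⟩

theorem isG2Structure_iff (φ : InvForm) :
    IsG2Structure φ ↔ IsPositive ((φ.1 o).compLinearMap θ) := by
  refine ⟨fun h => h.2, fun h => ⟨fun x => ?_, h⟩⟩
  obtain ⟨L, -, hL⟩ := h
  refine ⟨(toPEquiv (lift_smul x)).trans L, ?_⟩
  rw [invForm_eq_compLinearMap φ (lift_smul x), hL]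
  rfl

theorem exists_restrictForm : ∃ ρ : InvForm ≃ₗ[ℝ] InvForm𝔭,
    (∀ φ : InvForm, (ρ φ).1 = (φ.1 o).compLinearMap θ) ∧
    ∀ φ : InvForm, IsG2Structure φ ↔ IsPositive (ρ φ).1 :=
  ⟨LinearEquiv.ofBijective restrictForm restrictForm_bijective, fun _ => rfl, isG2Structure_iff⟩

end SpSphere

end

noncomputable section

namespace SpSphere

/-! ### Invariant metrics on the sphere -/

theorem contMDiffAt_clm_of_apply {E G : Type*} [NormedAddCommGroup E] [NormedSpace ℝ E]
    [FiniteDimensional ℝ E] [NormedAddCommGroup G] [NormedSpace ℝ G] {f : S7 → E →L[ℝ] G} {z : S7}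
    (h : ∀ v, ContMDiffAt (𝓡 7) 𝓘(ℝ, G) ∞ (fun x => f x v) z) :
    ContMDiffAt (𝓡 7) 𝓘(ℝ, E →L[ℝ] G) ∞ f z := by
  let b := finBasis ℝ E
  have h1 : f = fun x => ∑ i,
      ContinuousLinearMap.smulRightL ℝ E G (LinearMap.toContinuousLinearMap (b.coord i))
        (f x (b i)) := by
    funext x
    ext v
    conv_lhs => rw [← b.sum_repr v, map_sum]
    simp
  rw [h1]
  exact contMDiffAt_finsetSum fun i _ => (ContinuousLinearMap.contMDiff _).contMDiffAt.comp z (h _)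

/-- By compactness `B` has a positive minimum `m` on the unit sphere, and `B v v < 1` then forces
`‖v‖² ≤ 1/m`. -/
theorem isVonNBounded_of_pos {E : Type*} [NormedAddCommGroup E] [NormedSpace ℝ E]
    [FiniteDimensional ℝ E] (B : E →L[ℝ] E →L[ℝ] ℝ) (hB : ∀ v, v ≠ 0 → 0 < B v v) :
    Bornology.IsVonNBounded ℝ {v : E | B v v < 1} := by
  rw [NormedSpace.isVonNBounded_iff']
  rcases subsingleton_or_nontrivial E with hE | hE
  · exact ⟨0, fun v _ => by simp [Subsingleton.elim v 0]⟩
  have hc : Continuous fun v => B v v := by fun_prop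
  have hne : (Metric.sphere (0 : E) 1).Nonempty := NormedSpace.sphere_nonempty.2 zero_le_one
  obtain ⟨u, hu, hmin⟩ := (isCompact_sphere (0 : E) 1).exists_isMinOn hne hc.continuousOn
  have hu0 : u ≠ 0 := by
    rintro rfl
    simp at hu
  have hpos := hB u hu0
  refine ⟨√((B u u)⁻¹), fun v hv => ?_⟩
  apply Real.le_sqrt_of_sq_le
  rcases eq_or_ne v 0 with rfl | hv0
  · simpa using hpos.le
  have hn : 0 < ‖v‖ := norm_pos_iff.2 hv0
  have h1 : B u u ≤ B (‖v‖⁻¹ • v) (‖v‖⁻¹ • v) := hmin (by simp [norm_smul, hn.ne'])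
  have h2 : B (‖v‖⁻¹ • v) (‖v‖⁻¹ • v) = B v v / ‖v‖ ^ 2 := by
    simp
    field_simp
  have hv' : B v v < 1 := hv
  rw [h2, le_div_iff₀ (by positivity)] at h1
  rw [← one_div, le_div_iff₀ hpos]
  linarith [mul_comm (B u u) (‖v‖ ^ 2)]

instance (x : S7) : T2Space (T x) := inferInstanceAs (T2Space (EuclideanSpace ℝ (Fin 7)))

/-- The value at `x` of the invariant metric with parameters `S`, `ν`. -/
def innerAt (S : Matrix (Fin 3) (Fin 3) ℝ) (ν : ℝ) (x : S7) : T x →L[ℝ] T x →L[ℝ] ℝ :=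
  LinearMap.toContinuousBilinearMap
    ((genSym S ν).compl₁₂ (toP (lift x) x) (toP (lift x) x))

theorem genSym_toP (S : Matrix (Fin 3) (Fin 3) ℝ) (ν : ℝ) {A : Sp2} {x : S7} (h : A • o = x)
    (v w : T x) : genSym S ν (toP A x v) (toP A x w) =
      symValue S ν (vert x (dIncl x v)) (vert x (dIncl x w))
        (horProd x (dIncl x v) (dIncl x w)) := by
  rw [genSym_apply, toP_11 h, toP_11 h, toP_01 h]

theorem innerAt_apply (S : Matrix (Fin 3) (Fin 3) ℝ) (ν : ℝ) (x : S7) (v w : T x) :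
    innerAt S ν x v w = symValue S ν (vert x (dIncl x v)) (vert x (dIncl x w))
        (horProd x (dIncl x v) (dIncl x w)) :=
  genSym_toP S ν (lift_smul x) v w

theorem innerAt_dAct (S : Matrix (Fin 3) (Fin 3) ℝ) (ν : ℝ) (A : Sp2) (x : S7) (v w : T x) :
    innerAt S ν (A • x) (dAct A x v) (dAct A x w) = innerAt S ν x v w := by
  rw [innerAt_apply, innerAt_apply]
  simp only [dIncl_dAct, coe_smul, vert_act, horProd_act]

/-- The real part as a linear map. -/
def reₗ : ℍ[ℝ] →ₗ[ℝ] ℝ where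
  toFun q := q.re
  map_add' _ _ := rfl
  map_smul' _ _ := rfl

theorem contMDiffAt_symValue (S : Matrix (Fin 3) (Fin 3) ℝ) (ν : ℝ) {η η' χ : S7 → ℍ[ℝ]} {z : S7}
    (hη : ContMDiffAt (𝓡 7) 𝓘(ℝ, ℍ[ℝ]) ∞ η z) (hη' : ContMDiffAt (𝓡 7) 𝓘(ℝ, ℍ[ℝ]) ∞ η' z)
    (hχ : ContMDiffAt (𝓡 7) 𝓘(ℝ, ℍ[ℝ]) ∞ χ z) :
    ContMDiffAt (𝓡 7) 𝓘(ℝ, ℝ) ∞ (fun x => symValue S ν (η x) (η' x) (χ x)) z := by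
  have h1 : ContMDiffAt (𝓡 7) 𝓘(ℝ, ℝ) ∞ (fun x => (χ x).re) z :=
    (LinearMap.toContinuousLinearMap reₗ).contMDiff.contMDiffAt.comp z hχ
  exact (contMDiffAt_finsetSum fun l _ => contMDiffAt_finsetSum fun m _ =>
    contMDiffAt_const.mul ((contMDiffAt_imc hη l).mul (contMDiffAt_imc hη' m))).add
    (contMDiffAt_const.mul h1)

/-- Fields constant in a local trivialisation serve as test fields: the local coefficients of a
metric are its values on them. -/
theorem contMDiffAt_symm (z : S7) (v : EuclideanSpace ℝ (Fin 7)) :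
    ContMDiffAt (𝓡 7) (𝓡 7).tangent ∞ (fun x : S7 => (⟨x,
      (trivializationAt (EuclideanSpace ℝ (Fin 7)) (fun x : S7 => T x) z).symm x v⟩ :
        TangentBundle (𝓡 7) S7)) z := by
  set e := trivializationAt (EuclideanSpace ℝ (Fin 7)) (fun x : S7 => T x) z with he
  have hz : z ∈ e.baseSet := FiberBundle.mem_baseSet_trivializationAt' z
  have h1 := (e.contMDiffOn_symm (IB := 𝓡 7) (n := ∞)).contMDiffAt (x := (z, v))
    (e.open_target.mem_nhds (by rw [e.target_eq]; exact ⟨hz, trivial⟩))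
  have h2 : ContMDiffAt (𝓡 7) ((𝓡 7).prod 𝓘(ℝ, EuclideanSpace ℝ (Fin 7))) ∞
      (fun x : S7 => (x, v)) z := contMDiffAt_id.prodMk contMDiffAt_const
  refine (h1.comp z h2).congr_of_eventuallyEq ?_
  filter_upwards [e.open_baseSet.mem_nhds hz] with x hx
  exact e.mk_symm hx v

theorem contMDiff_innerAt (S : Matrix (Fin 3) (Fin 3) ℝ) (ν : ℝ) :
    ContMDiff (𝓡 7) ((𝓡 7).prod 𝓘(ℝ, EuclideanSpace ℝ (Fin 7) →L[ℝ]
      EuclideanSpace ℝ (Fin 7) →L[ℝ] ℝ)) ∞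
      (fun x : S7 => Bundle.TotalSpace.mk' (EuclideanSpace ℝ (Fin 7) →L[ℝ]
        EuclideanSpace ℝ (Fin 7) →L[ℝ] ℝ) (E := fun x : S7 => T x →L[ℝ] T x →L[ℝ] ℝ)
        x (innerAt S ν x)) := by
  intro z
  rw [Bundle.contMDiffAt_section]
  refine contMDiffAt_clm_of_apply fun v => contMDiffAt_clm_of_apply fun w => ?_
  set e := trivializationAt (EuclideanSpace ℝ (Fin 7)) (fun x : S7 => T x) z with he
  have hz : z ∈ e.baseSet := FiberBundle.mem_baseSet_trivializationAt' z
  have h1 := contMDiffAt_symValue S ν (contMDiffAt_vert (contMDiffAt_dIncl (contMDiffAt_symm z v)))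
    (contMDiffAt_vert (contMDiffAt_dIncl (contMDiffAt_symm z w)))
    (contMDiffAt_horProd (contMDiffAt_dIncl (contMDiffAt_symm z v))
      (contMDiffAt_dIncl (contMDiffAt_symm z w)))
  refine h1.congr_of_eventuallyEq ?_
  filter_upwards [e.open_baseSet.mem_nhds hz] with x hx
  rw [hom_trivializationAt_apply]
  rw [inCoordinates_apply_eq₂ hx hx (by simp)]
  rw [innerAt_apply]
  simp

/-- The invariant metric on the sphere with parameters `S`, `ν`. -/
def invMetric {S : Matrix (Fin 3) (Fin 3) ℝ} {ν : ℝ} (hS : S.IsSymm) (h : PosDef (genSym S ν)) :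
    InvMetric where
  val :=
    have hpos : ∀ (x : S7) (v : T x), v ≠ 0 → 0 < innerAt S ν x v v := fun x _ hv =>
      h _ fun h0 => hv (toP_injective (lift_smul x) (h0.trans (map_zero _).symm))
    { inner := innerAt S ν
      symm := fun _ _ _ => (genSym_mem hS ν).1 _ _
      pos := hpos
      isVonNBounded := fun x =>
        isVonNBounded_of_pos (E := EuclideanSpace ℝ (Fin 7)) (innerAt S ν x) (hpos x)
      contMDiff := contMDiff_innerAt S ν }
  property := innerAt_dAct S ν

theorem invMetric_inner_o {S : Matrix (Fin 3) (Fin 3) ℝ} {ν : ℝ} (hS : S.IsSymm)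
    (h : PosDef (genSym S ν)) (X Y : 𝔭) :
    (invMetric hS h).1.inner o (θ X) (θ Y) = genSym S ν X Y := by
  change innerAt S ν o (θ X) (θ Y) = _
  rw [innerAt_apply, ← genSym_toP S ν (one_smul Sp2 o), toP_one_θ, toP_one_θ]

theorem metric7_ext {g g' : Metric7} (h : ∀ x (v w : T x), g.inner x v w = g'.inner x v w) :
    g = g' := by
  have h1 : g.inner = g'.inner := by
    funext x
    ext v w
    exact h x v w
  cases g
  cases g'
  congr

theorem inner_eq_of_dIncl (g : Metric7) {x y : S7} (hxy : x = y) {v w : T x} {v' w' : T y}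
    (hv : dIncl x v = dIncl y v') (hw : dIncl x w = dIncl y w') :
    g.inner x v w = g.inner y v' w' := by
  subst hxy
  rw [dIncl_injective x hv, dIncl_injective x hw]

theorem invMetric_apply_eq (g : InvMetric) {A : Sp2} {x : S7} (h : A • o = x) (v w : T x) :
    g.1.inner x v w = g.1.inner o (θ (toP A x v)) (θ (toP A x w)) := by
  rw [← g.2 A o]
  refine inner_eq_of_dIncl g.1 h.symm ?_ ?_ <;> rw [dIncl_dAct, dIncl_θ, act_velocity_toP h]

/-- Restriction of an invariant metric to `𝔭`, as a bilinear form. -/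
def restrictBilin (g : InvMetric) : LinearMap.BilinForm ℝ 𝔭 :=
  LinearMap.mk₂ ℝ (fun X Y => g.1.inner o (θ X) (θ Y)) (fun _ _ _ => by simp) (fun _ _ _ => by simp)
    (fun _ _ _ => by simp) (fun _ _ _ => by simp)

theorem restrictBilin_apply (g : InvMetric) (X Y : 𝔭) :
    restrictBilin g X Y = g.1.inner o (θ X) (θ Y) := rfl

theorem restrictBilin_mem (g : InvMetric) : restrictBilin g ∈ InvSym𝔭 := by
  refine ⟨fun X Y => g.1.symm o _ _, fun h X Y => ?_⟩
  rw [restrictBilin_apply, restrictBilin_apply, ← g.2 (h : Sp2) o (θ X)]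
  refine inner_eq_of_dIncl g.1 (Sp1_smul_o h).symm ?_ ?_ <;>
    rw [dIncl_dAct, dIncl_θ, dIncl_θ, velocity_Ad]

theorem restrictBilin_posDef (g : InvMetric) : PosDef (restrictBilin g) := by
  intro X hX
  refine g.1.pos o _ fun h0 => hX ?_
  rw [← toP_one_θ X, h0, map_zero]

theorem invMetric_ext {g g' : InvMetric} (h : restrictBilin g = restrictBilin g') : g = g' := by
  refine Subtype.ext (metric7_ext fun x v w => ?_)
  rw [invMetric_apply_eq g (lift_smul x), invMetric_apply_eq g' (lift_smul x),
    ← restrictBilin_apply, h, restrictBilin_apply]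

theorem restrictBilin_invMetric {S : Matrix (Fin 3) (Fin 3) ℝ} {ν : ℝ} (hS : S.IsSymm)
    (h : PosDef (genSym S ν)) : restrictBilin (invMetric hS h) = genSym S ν :=
  LinearMap.ext₂ fun X Y => invMetric_inner_o hS h X Y

/-- Invariant metrics are the invariant inner products on `𝔭`. -/
def restrictMetric : InvMetric ≃ {b : InvSym𝔭 // PosDef b.1} where
  toFun g := ⟨⟨restrictBilin g, restrictBilin_mem g⟩, restrictBilin_posDef g⟩
  invFun b := invMetric (symParam_isSymm b.1.2) (ν := (symParam b.1.1).2) (by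
    rw [genSym_symParam b.1.2]
    exact b.2)
  left_inv g := invMetric_ext <| by
    rw [restrictBilin_invMetric]
    exact genSym_symParam (restrictBilin_mem g)
  right_inv b := Subtype.ext <| Subtype.ext <| by
    change restrictBilin _ = _
    rw [restrictBilin_invMetric, genSym_symParam b.1.2]

/-! ### The metric of an invariant `G₂`-structure -/

theorem exists_phi_of_isPositive {ψ : 𝔭 [⋀^Fin 3]→ₗ[ℝ] ℝ} (hψ : ψ ∈ InvForm𝔭)
    (h : IsPositive ψ) :
    ∃ (a : ℝ) (D : Matrix (Fin 3) (Fin 3) ℝ), 0 < a ∧ 0 < D.det ∧ ψ = phi a D := by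
  obtain ⟨c, Φ, hs, ht, hc, -⟩ := exists_formChart
  have h1 : c.symm ⟨ψ, hψ⟩ ∈ Φ.target := by
    rw [ht]
    change IsPositive (c (c.symm ⟨ψ, hψ⟩)).1
    rw [LinearEquiv.apply_symm_apply]
    exact h
  have h2 := Φ.map_target h1
  rw [hs] at h2
  have h3 := hc _ h2
  rw [Φ.right_inv h1, LinearEquiv.apply_symm_apply] at h3
  exact ⟨_, _, h2.1, h2.2, h3⟩

/-- Transport to `o` followed by the block map of `(a, D)` carries `φ₀` to the form at `x`, so the
metric there can only be the pullback of the standard inner product. -/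
theorem isMetricOf_iff_of_restrict {φ : InvForm} {a : ℝ} {D : Matrix (Fin 3) (Fin 3) ℝ}
    (ha : 0 < a) (hD : 0 < D.det) (h : (φ.1 o).compLinearMap θ = phi a D) (g : Metric7) (x : S7) :
    IsMetricOf (φ.1 x) (fun v w => g.inner x v w) ↔
      ∀ v w, g.inner x v w = genSym (metricParam a D).1 (metricParam a D).2
        (toP (lift x) x v) (toP (lift x) x w) := by
  have h1 := isMetricOf_φ₀_comp ((toPEquiv (lift_smul x)).trans
    (LinearMap.equivOfDetNeZero _ (det_blockMap_pos ha hD).ne')) (g.inner x).toLinearMap₁₂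
  have h2 : φ.1 x = φ₀.compLinearMap ((toPEquiv (lift_smul x)).trans
      (LinearMap.equivOfDetNeZero _ (det_blockMap_pos ha hD).ne') : T x →ₗ[ℝ] 𝔭) := by
    rw [invForm_eq_compLinearMap φ (lift_smul x), h, phi_eq_comp_blockMap ha hD]
    rfl
  rw [h2]
  refine h1.trans (forall_congr' fun v => forall_congr' fun w => ?_)
  rw [← stdIP_blockMap ha hD]
  rfl

theorem exists_metric_of_isG2Structure (φ : InvForm) (hφ : IsG2Structure φ) :
    ∃ g : InvMetric, ∀ g' : Metric7,
      (∀ x, IsMetricOf (φ.1 x) (fun v w => g'.inner x v w)) ↔ g' = g.1 := by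
  obtain ⟨a, D, ha, hD, h⟩ := exists_phi_of_isPositive (invForm_restrict_mem φ) hφ.2
  refine ⟨invMetric (metricParam_isSymm a D) ((posDef_genSym_iff (metricParam_isSymm a D)).2
    (metricParam_pos ha hD)), fun g' => ?_⟩
  simp only [isMetricOf_iff_of_restrict ha hD h]
  refine ⟨fun h1 => metric7_ext h1, ?_⟩
  rintro rfl x v w
  rfl

end SpSphere

end

/-! ### Equivariant diffeomorphisms, cosets and the moduli space. -/

noncomputable section

namespace SpSphere

/-! ### Unit quaternions and `SO(3)` -/

/-- The matrix of `η ↦ q* η q` on the imaginary quaternions. -/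
def rotMat (q : ℍ[ℝ]) : Matrix (Fin 3) (Fin 3) ℝ :=
  Matrix.of fun l m => imc l (star q * (unitQuat (Fin.succ m) : ℍ[ℝ]) * q)

theorem imc_conj {q : ℍ[ℝ]} (hq : star q * q = 1) (l : Fin 3) (η : ℍ[ℝ]) :
    imc l (star q * η * q) = ∑ m, rotMat q l m * imc m η := by
  have h1 : η = (η.re : ℍ[ℝ]) + ∑ m, imc m η • (unitQuat (Fin.succ m) : ℍ[ℝ]) := by
    rw [Fin.sum_univ_three]
    ext <;> simp [unitQuat]
  have h2 : star q * η * q =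
      (η.re : ℍ[ℝ]) + ∑ m, imc m η • (star q * (unitQuat (Fin.succ m) : ℍ[ℝ]) * q) := by
    conv_lhs => rw [h1]
    rw [mul_add, add_mul, ← Quaternion.coe_commutes, mul_assoc, hq, mul_one, Finset.mul_sum,
      Finset.sum_mul]
    simp only [mul_smul_comm, smul_mul_assoc]
  have h3 : imc l (η.re : ℍ[ℝ]) = 0 := by fin_cases l <;> simp
  rw [h2, map_add, h3, zero_add, map_sum]
  refine Finset.sum_congr rfl fun m _ => ?_
  rw [map_smul, smul_eq_mul, mul_comm]
  rfl

theorem rotMat_eq (q : ℍ[ℝ]) : rotMat q =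
    !![q.re ^ 2 + q.imI ^ 2 - q.imJ ^ 2 - q.imK ^ 2, 2 * (q.imI * q.imJ + q.re * q.imK),
        2 * (q.imI * q.imK - q.re * q.imJ);
      2 * (q.imI * q.imJ - q.re * q.imK), q.re ^ 2 - q.imI ^ 2 + q.imJ ^ 2 - q.imK ^ 2,
        2 * (q.imJ * q.imK + q.re * q.imI);
      2 * (q.imI * q.imK + q.re * q.imJ), 2 * (q.imJ * q.imK - q.re * q.imI),
        q.re ^ 2 - q.imI ^ 2 - q.imJ ^ 2 + q.imK ^ 2] := by
  ext l m
  fin_cases l <;> fin_cases m <;> simp [rotMat, unitQuat] <;> ring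

theorem normSq_of_star_mul {q : ℍ[ℝ]} (hq : star q * q = 1) :
    q.re ^ 2 + q.imI ^ 2 + q.imJ ^ 2 + q.imK ^ 2 = 1 := by
  have := congrArg (fun q : ℍ[ℝ] => q.re) hq
  simp at this
  linarith

theorem rotMat_mem {q : ℍ[ℝ]} (hq : star q * q = 1) :
    rotMat q ∈ Matrix.specialOrthogonalGroup (Fin 3) ℝ := by
  have h := normSq_of_star_mul hq
  refine Matrix.mem_specialOrthogonalGroup_iff.2 ⟨(Matrix.mem_orthogonalGroup_iff' (Fin 3) ℝ).2 ?_,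
    ?_⟩
  · have h1 : (rotMat q)ᵀ * rotMat q =
        (q.re ^ 2 + q.imI ^ 2 + q.imJ ^ 2 + q.imK ^ 2) ^ 2 • (1 : Matrix (Fin 3) (Fin 3) ℝ) := by
      rw [rotMat_eq]
      ext l m
      fin_cases l <;> fin_cases m <;>
        simp [Matrix.mul_apply, Fin.sum_univ_three] <;> ring
    rw [h1, h, one_pow, one_smul]
  · have h1 : (rotMat q).det = (q.re ^ 2 + q.imI ^ 2 + q.imJ ^ 2 + q.imK ^ 2) ^ 3 := by
      rw [rotMat_eq, Matrix.det_fin_three]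
      simp
      ring
    rw [h1, h, one_pow]

/-- The extension of a linear map of the imaginary quaternions which fixes `1`. -/
def rotExt (R : Matrix (Fin 3) (Fin 3) ℝ) (p : ℍ[ℝ]) : ℍ[ℝ] :=
  quat p.re (R 0 0 * p.imI + R 0 1 * p.imJ + R 0 2 * p.imK)
    (R 1 0 * p.imI + R 1 1 * p.imJ + R 1 2 * p.imK) (R 2 0 * p.imI + R 2 1 * p.imJ + R 2 2 * p.imK)

/-- Rotations extend to automorphisms of `ℍ`: the real part uses the preserved dot product, the
imaginary part the preserved cross product, which holds since the cofactor matrix of `R` is `R`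
itself. -/
theorem rotExt_mul {R : Matrix (Fin 3) (Fin 3) ℝ} (hR : R ∈ Matrix.specialOrthogonalGroup (Fin 3) ℝ)
    (p q : ℍ[ℝ]) : rotExt R (p * q) = rotExt R p * rotExt R q := by
  obtain ⟨h1, h2⟩ := Matrix.mem_specialOrthogonalGroup_iff.1 hR
  have h3 : Rᵀ * R = 1 := (Matrix.mem_orthogonalGroup_iff' (Fin 3) ℝ).1 h1
  have h4 : R.adjugate = Rᵀ := by
    have h5 : R * Rᵀ = 1 := (Matrix.mem_orthogonalGroup_iff (Fin 3) ℝ).1 h1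
    calc R.adjugate = R.adjugate * (R * Rᵀ) := by rw [h5, Matrix.mul_one]
      _ = Rᵀ := by rw [← Matrix.mul_assoc, Matrix.adjugate_mul, h2, one_smul, Matrix.one_mul]
  have ho : ∀ i j, R 0 i * R 0 j + R 1 i * R 1 j + R 2 i * R 2 j =
      (1 : Matrix (Fin 3) (Fin 3) ℝ) i j := fun i j => by
    rw [← h3, Matrix.mul_apply, Fin.sum_univ_three]
    rfl
  have hc : ∀ i j, R.adjugate i j = R j i := fun i j => by rw [h4]; rfl
  rw [Matrix.adjugate_fin_three] at hc
  have o00 := ho 0 0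
  have o01 := ho 0 1
  have o02 := ho 0 2
  have o11 := ho 1 1
  have o12 := ho 1 2
  have o22 := ho 2 2
  have c00 := hc 0 0
  have c01 := hc 0 1
  have c02 := hc 0 2
  have c10 := hc 1 0
  have c11 := hc 1 1
  have c12 := hc 1 2
  have c20 := hc 2 0
  have c21 := hc 2 1
  have c22 := hc 2 2
  simp at o00 o01 o02 o11 o12 o22 c00 c01 c02 c10 c11 c12 c20 c21 c22
  ext
  · simp [rotExt]
    linear_combination p.imI * q.imI * o00 + p.imJ * q.imJ * o11 + p.imK * q.imK * o22 +
      (p.imI * q.imJ + p.imJ * q.imI) * o01 + (p.imI * q.imK + p.imK * q.imI) * o02 +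
      (p.imJ * q.imK + p.imK * q.imJ) * o12
  · simp [rotExt]
    linear_combination -(p.imJ * q.imK - p.imK * q.imJ) * c00 -
      (p.imK * q.imI - p.imI * q.imK) * c10 - (p.imI * q.imJ - p.imJ * q.imI) * c20
  · simp [rotExt]
    linear_combination -(p.imJ * q.imK - p.imK * q.imJ) * c01 -
      (p.imK * q.imI - p.imI * q.imK) * c11 - (p.imI * q.imJ - p.imJ * q.imI) * c21
  · simp [rotExt]
    linear_combination -(p.imJ * q.imK - p.imK * q.imJ) * c02 -
      (p.imK * q.imI - p.imI * q.imK) * c12 - (p.imI * q.imJ - p.imJ * q.imI) * c22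

/-- Skolem–Noether by averaging: with `ρ = rotExt R`, the sum of `ρ(u) x u⁻¹` over `u = 1, i, j, k`
intertwines `ρ(u)` with `u` for every `x`. -/
theorem exists_intertwiner {R : Matrix (Fin 3) (Fin 3) ℝ}
    (hR : R ∈ Matrix.specialOrthogonalGroup (Fin 3) ℝ) :
    ∃ q : ℍ[ℝ], q ≠ 0 ∧ ∀ m : Fin 3, rotExt R (unitQuat (Fin.succ m) : ℍ[ℝ]) * q =
      q * (unitQuat (Fin.succ m) : ℍ[ℝ]) := by
  let i : ℍ[ℝ] := quat 0 1 0 0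
  let j : ℍ[ℝ] := quat 0 0 1 0
  let k : ℍ[ℝ] := quat 0 0 0 1
  have ii : i * i = -1 := by ext <;> simp [i]
  have jj : j * j = -1 := by ext <;> simp [j]
  have kk : k * k = -1 := by ext <;> simp [k]
  have ij : i * j = k := by ext <;> simp [i, j, k]
  have ji : j * i = -k := by ext <;> simp [i, j, k]
  have jk : j * k = i := by ext <;> simp [i, j, k]
  have kj : k * j = -i := by ext <;> simp [i, j, k]
  have ki : k * i = j := by ext <;> simp [i, j, k]
  have ik : i * k = -j := by ext <;> simp [i, j, k]
  have hneg : ∀ p, rotExt R (-p) = -rotExt R p := fun p => by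
    ext <;> simp [rotExt] <;> ring
  have h1 : rotExt R 1 = 1 := by ext <;> simp [rotExt]
  -- The minus signs are the inverses `u⁻¹ = -u` of the imaginary units.
  let T : ℍ[ℝ] → ℍ[ℝ] := fun x => x - rotExt R i * x * i - rotExt R j * x * j - rotExt R k * x * k
  have hr : ∀ y p q r : ℍ[ℝ], p * q = r → y * p * q = y * r := fun y p q r h => by
    rw [mul_assoc, h]
  have hl : ∀ p q r : ℍ[ℝ], p * q = r → rotExt R p * rotExt R q = rotExt R r := fun p q r h => by
    rw [← rotExt_mul hR, h]
  have hi : ∀ x, rotExt R i * T x = T x * i := fun x => by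
    simp only [T, mul_sub, sub_mul, ← mul_assoc, hl _ _ _ ii, hl _ _ _ ij, hl _ _ _ ik,
      hr _ _ _ _ ii, hr _ _ _ _ ji, hr _ _ _ _ ki, hneg, h1]
    simp only [mul_neg, neg_mul, mul_one, one_mul]
    abel
  have hj : ∀ x, rotExt R j * T x = T x * j := fun x => by
    simp only [T, mul_sub, sub_mul, ← mul_assoc, hl _ _ _ ji, hl _ _ _ jj, hl _ _ _ jk,
      hr _ _ _ _ ij, hr _ _ _ _ jj, hr _ _ _ _ kj, hneg, h1]
    simp only [mul_neg, neg_mul, mul_one, one_mul]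
    abel
  have hk : ∀ x, rotExt R k * T x = T x * k := fun x => by
    rw [← ij, rotExt_mul hR, mul_assoc, hj, ← mul_assoc, hi, mul_assoc]
  -- The four components add up to the real trace of `T`. This is `4`: the identity contributes `4`,
  -- and the other three terms have trace `0`, because `ρ(u)` and `u` are imaginary.
  obtain ⟨x, hx⟩ : ∃ x, T x ≠ 0 := by
    by_contra! h
    have e1 := congrArg (fun q : ℍ[ℝ] => q.re) (h 1)
    have e2 := congrArg (fun q : ℍ[ℝ] => q.imI) (h i)
    have e3 := congrArg (fun q : ℍ[ℝ] => q.imJ) (h j)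
    have e4 := congrArg (fun q : ℍ[ℝ] => q.imK) (h k)
    simp [T, rotExt, i, j, k] at e1 e2 e3 e4
    linarith
  refine ⟨T x, hx, fun m => ?_⟩
  fin_cases m
  exacts [hi x, hj x, hk x]

theorem exists_rotMat_eq {R : Matrix (Fin 3) (Fin 3) ℝ}
    (hR : R ∈ Matrix.specialOrthogonalGroup (Fin 3) ℝ) :
    ∃ q : unitary ℍ[ℝ], rotMat q = R := by
  obtain ⟨p, hp, h⟩ := exists_intertwiner hR
  have hn : ‖p‖ ≠ 0 := norm_ne_zero_iff.2 hp
  set u : ℍ[ℝ] := ‖p‖⁻¹ • p with hu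
  have hu2 : Quaternion.normSq u = 1 := by
    rw [Quaternion.normSq_eq_norm_mul_self, hu, norm_smul, norm_inv, norm_norm,
      inv_mul_cancel₀ hn, one_mul]
  have h1 : star u * u = 1 := by rw [Quaternion.star_mul_self, hu2, Quaternion.coe_one]
  have h2 : u * star u = 1 := by rw [Quaternion.self_mul_star, hu2, Quaternion.coe_one]
  -- `rotMat q` is conjugation by `q*` on the left, whereas the intertwiner gives `R η = u η u*`;
  -- hence `q = u*`.
  refine ⟨⟨star u, by rw [star_star]; exact h2, by rw [star_star]; exact h1⟩, ?_⟩
  ext l m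
  change imc l (star (star u) * (unitQuat (Fin.succ m) : ℍ[ℝ]) * star u) = _
  rw [star_star, hu, smul_mul_assoc, ← h m, ← mul_smul_comm, ← hu, mul_assoc, h2, mul_one]
  fin_cases l <;> fin_cases m <;> simp [rotExt, unitQuat]

/-! ### Equivariant diffeomorphisms -/

/-- Right multiplication by a quaternion on `ℍ²`. -/
def rightMul (q : ℍ[ℝ]) : H2 →ₗ[ℝ] H2 where
  toFun x := WithLp.toLp 2 fun i => x i * q
  map_add' _ _ := PiLp.ext fun _ => add_mul _ _ _
  map_smul' c x := PiLp.ext fun i => smul_mul_assoc c (x i) q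

theorem rightMul_apply (q : ℍ[ℝ]) (x : H2) (i : Fin 2) : rightMul q x i = x i * q := rfl

theorem herm_rightMul (q : ℍ[ℝ]) (x y : H2) :
    herm (rightMul q x) (rightMul q y) = star q * herm x y * q := by
  simp only [herm_apply, rightMul_apply, star_mul]
  noncomm_ring

theorem rightMul_act (q : ℍ[ℝ]) (A : Matrix (Fin 2) (Fin 2) ℍ[ℝ]) (x : H2) :
    rightMul q (act A x) = act A (rightMul q x) := by
  refine PiLp.ext fun i => ?_
  rw [rightMul_apply, act_apply, act_apply, rightMul_apply, rightMul_apply, add_mul, mul_assoc,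
    mul_assoc]

theorem rightMul_rightMul (p q : ℍ[ℝ]) (x : H2) : rightMul q (rightMul p x) = rightMul (p * q) x :=
  PiLp.ext fun i => mul_assoc (x i) p q

theorem vert_rightMul (q : ℍ[ℝ]) (x u : H2) :
    vert (rightMul q x) (rightMul q u) = star q * vert x u * q := herm_rightMul q x u

theorem horProd_rightMul {q : ℍ[ℝ]} (hq : q * star q = 1) (x u w : H2) :
    horProd (rightMul q x) (rightMul q u) (rightMul q w) = star q * horProd x u w * q := by
  have h : star (star q * herm x u * q) * (star q * herm x w * q) =
      star q * (star (herm x u) * herm x w) * q := by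
    simp only [star_mul, star_star, mul_assoc]
    rw [← mul_assoc q (star q), hq, one_mul]
  rw [horProd, herm_rightMul, herm_rightMul, herm_rightMul, h, horProd, mul_sub, sub_mul]

/-- Right multiplication by a unit quaternion on the sphere. -/
def sphereMul (q : unitary ℍ[ℝ]) (x : S7) : S7 := ⟨rightMul q x, by
  have h := norm_sq_eq (rightMul (q : ℍ[ℝ]) x)
  rw [← herm_eq_dotProduct, herm_rightMul, herm_self, mul_one, q.2.1, ← Quaternion.coe_one] at h
  have h2 : ‖rightMul (q : ℍ[ℝ]) x‖ ^ 2 = 1 := Quaternion.coe_injective h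
  rw [mem_sphere_zero_iff_norm]
  exact (pow_eq_one_iff_of_nonneg (norm_nonneg _) two_ne_zero).1 h2⟩

theorem sphereMul_sphereMul (p q : unitary ℍ[ℝ]) (x : S7) :
    sphereMul q (sphereMul p x) = sphereMul (p * q) x :=
  Subtype.ext (rightMul_rightMul p q x)

theorem sphereMul_one (x : S7) : sphereMul 1 x = x :=
  Subtype.ext (PiLp.ext fun i => mul_one ((x : H2) i))

/-- Right multiplication by a unit quaternion as a diffeomorphism. -/
def sphereMulDiffeo (q : unitary ℍ[ℝ]) : Diffeomorph (𝓡 7) (𝓡 7) S7 S7 ∞ where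
  toFun := sphereMul q
  invFun := sphereMul q⁻¹
  left_inv x := by rw [sphereMul_sphereMul, mul_inv_cancel, sphereMul_one]
  right_inv x := by rw [sphereMul_sphereMul, inv_mul_cancel, sphereMul_one]
  contMDiff_toFun :=
    contMDiff_of_linear (LinearMap.toContinuousLinearMap (rightMul q)) fun _ => rfl
  contMDiff_invFun :=
    contMDiff_of_linear (LinearMap.toContinuousLinearMap (rightMul (q⁻¹ : unitary ℍ[ℝ])))
      fun _ => rfl

theorem isEquivariant_sphereMul (q : unitary ℍ[ℝ]) : IsEquivariant (sphereMulDiffeo q) :=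
  fun A x => Subtype.ext (rightMul_act q A x)

/-- `f o` is fixed by `Sp(1)`; already `diag(-1, 1)` forces its first coordinate to vanish, so `f o
= (0, q)`. Then `f (A o) = A f o = (A o) q` determines `f`. -/
theorem eq_sphereMul_of_isEquivariant {f : Diffeomorph (𝓡 7) (𝓡 7) S7 S7 ∞} (hf : IsEquivariant f) :
    ∃ q : unitary ℍ[ℝ], f = sphereMulDiffeo q := by
  have h0 : (f o : H2) 0 = 0 := by
    have h1 := hf (toSp1 (-1) : Sp1) o
    rw [Sp1_smul_o] at h1
    have h2 : (f o : H2) 0 = act ((toSp1 (-1) : Sp1) : Sp2) (f o) 0 :=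
      congrArg (fun x : S7 => (x : H2) 0) h1
    have h4 : ((toSp1 (-1) : Sp1) : Sp2).1 0 1 = 0 := rfl
    have h5 : ((-1 : unitary ℍ[ℝ]) : ℍ[ℝ]) = -1 := rfl
    rw [act_apply, toSp1_apply, h4, zero_mul, add_zero, h5, neg_one_mul] at h2
    have h3 : (2 : ℝ) • (f o : H2) 0 = 0 := by
      rw [two_smul]
      nth_rewrite 1 [h2]
      simp
    simpa using h3
  have h1 := herm_self (f o)
  rw [herm_apply, h0, mul_zero, zero_add] at h1
  refine ⟨⟨(f o : H2) 1, h1, mul_eq_one_comm.1 h1⟩, Diffeomorph.ext fun x => ?_⟩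
  obtain ⟨A, rfl⟩ := exists_smul_o x
  rw [hf, isEquivariant_sphereMul]
  congr 1
  refine Subtype.ext (ext_H2 ?_ ?_)
  · exact h0.trans (zero_mul ((f o : H2) 1)).symm
  · exact (one_mul ((f o : H2) 1)).symm

/-! ### The action of equivariant diffeomorphisms on invariant metrics -/

/-- The parameters of an invariant metric. -/
def metricData (g : InvMetric) : Matrix (Fin 3) (Fin 3) ℝ × ℝ := symParam (restrictBilin g)

theorem genSym_metricData (g : InvMetric) :
    genSym (metricData g).1 (metricData g).2 = restrictBilin g :=
  genSym_symParam (restrictBilin_mem g)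

theorem metricData_isSymm (g : InvMetric) : (metricData g).1.IsSymm :=
  symParam_isSymm (restrictBilin_mem g)

theorem metricData_pos (g : InvMetric) : MinorsPos (metricData g).1 ∧ 0 < (metricData g).2 := by
  rw [← posDef_genSym_iff (metricData_isSymm g), genSym_metricData]
  exact restrictBilin_posDef g

theorem metricData_invMetric {S : Matrix (Fin 3) (Fin 3) ℝ} {ν : ℝ} (hS : S.IsSymm)
    (h : PosDef (genSym S ν)) : metricData (invMetric hS h) = (S, ν) := by
  rw [metricData, restrictBilin_invMetric, symParam_genSym]

theorem metricData_injective : Function.Injective metricData := fun g g' h => by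
  apply invMetric_ext
  rw [← genSym_metricData, h, genSym_metricData]

theorem inner_eq_symValue (g : InvMetric) (x : S7) (v w : T x) : g.1.inner x v w =
    symValue (metricData g).1 (metricData g).2 (vert x (dIncl x v)) (vert x (dIncl x w))
      (horProd x (dIncl x v) (dIncl x w)) := by
  rw [invMetric_apply_eq g (lift_smul x), ← restrictBilin_apply, ← genSym_metricData,
    genSym_toP _ _ (lift_smul x)]

theorem sum_mul_conj (S R : Matrix (Fin 3) (Fin 3) ℝ) (a b : Fin 3 → ℝ) :
    ∑ l, ∑ m, S l m * ((∑ i, R l i * a i) * ∑ j, R m j * b j) =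
      ∑ i, ∑ j, (Rᵀ * S * R) i j * (a i * b j) := by
  simp only [Matrix.mul_apply, Matrix.transpose_apply, Fin.sum_univ_three]
  ring

/-- Conjugation by a unit quaternion preserves the real part and rotates the imaginary one, so only
`S` changes. -/
theorem symValue_conj {q : ℍ[ℝ]} (hq : star q * q = 1) (S : Matrix (Fin 3) (Fin 3) ℝ) (ν : ℝ)
    (η η' χ : ℍ[ℝ]) : symValue S ν (star q * η * q) (star q * η' * q) (star q * χ * q) =
      symValue ((rotMat q)ᵀ * S * rotMat q) ν η η' χ := by
  have h1 : (star q * χ * q).re = χ.re := by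
    have h := normSq_of_star_mul hq
    simp
    linear_combination χ.re * h
  rw [symValue, h1, symValue, ← sum_mul_conj]
  simp only [imc_conj hq]

theorem dIncl_mfderiv_sphereMul (q : unitary ℍ[ℝ]) (x : S7) (v : T x) :
    dIncl (sphereMulDiffeo q x) (mfderiv (𝓡 7) (𝓡 7) (sphereMulDiffeo q) x v) =
      rightMul q (dIncl x v) :=
  dIncl_mfderiv (f := sphereMulDiffeo q) (LinearMap.toContinuousLinearMap (rightMul q))
    (fun _ => rfl) x v

theorem inner_mfderiv_sphereMul (q : unitary ℍ[ℝ]) (g : InvMetric) (x : S7) (v w : T x) :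
    g.1.inner (sphereMulDiffeo q x) (mfderiv (𝓡 7) (𝓡 7) (sphereMulDiffeo q) x v)
      (mfderiv (𝓡 7) (𝓡 7) (sphereMulDiffeo q) x w) =
    symValue ((rotMat q)ᵀ * (metricData g).1 * rotMat q) (metricData g).2 (vert x (dIncl x v))
      (vert x (dIncl x w)) (horProd x (dIncl x v) (dIncl x w)) := by
  have hx : ((sphereMulDiffeo q x : S7) : H2) = rightMul q x := rfl
  rw [inner_eq_symValue, dIncl_mfderiv_sphereMul, dIncl_mfderiv_sphereMul, hx, vert_rightMul,
    vert_rightMul, horProd_rightMul q.2.2, symValue_conj q.2.1]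

theorem isPullback_sphereMul_iff (q : unitary ℍ[ℝ]) (g g' : InvMetric) :
    IsPullback (sphereMulDiffeo q) g g' ↔
      metricData g = ((rotMat q)ᵀ * (metricData g').1 * rotMat q, (metricData g').2) := by
  constructor
  · intro h
    have h1 : restrictBilin g =
        genSym ((rotMat q)ᵀ * (metricData g').1 * rotMat q) (metricData g').2 := by
      refine LinearMap.ext₂ fun X Y => ?_
      rw [restrictBilin_apply, ← h, inner_mfderiv_sphereMul, ← genSym_toP _ _ (one_smul Sp2 o),
        toP_one_θ, toP_one_θ]
    rw [metricData, h1, symParam_genSym]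
  · intro h x v w
    rw [inner_mfderiv_sphereMul, inner_eq_symValue g, h]

theorem autSetoid_iff (g g' : InvMetric) : autSetoid.r g g' ↔
    ∃ R ∈ Matrix.specialOrthogonalGroup (Fin 3) ℝ,
      metricData g = (Rᵀ * (metricData g').1 * R, (metricData g').2) := by
  constructor
  · rintro ⟨f, h1, h2⟩
    obtain ⟨q, rfl⟩ := eq_sphereMul_of_isEquivariant h1
    exact ⟨_, rotMat_mem q.2.1, (isPullback_sphereMul_iff q g g').1 h2⟩
  · rintro ⟨R, hR, h⟩
    obtain ⟨q, rfl⟩ := exists_rotMat_eq hR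
    exact ⟨_, isEquivariant_sphereMul q, (isPullback_sphereMul_iff q g g').2 h⟩

theorem metricParam_mul_left {a : ℝ} {D R : Matrix (Fin 3) (Fin 3) ℝ}
    (hR : R ∈ Matrix.specialOrthogonalGroup (Fin 3) ℝ) :
    metricParam a (R * D) = (R * (metricParam a D).1 * Rᵀ, (metricParam a D).2) := by
  obtain ⟨h1, h2⟩ := Matrix.mem_specialOrthogonalGroup_iff.1 hR
  have h3 := (Matrix.mem_orthogonalGroup_iff (Fin 3) ℝ).1 h1
  have h4 : R⁻¹ = Rᵀ := Matrix.inv_eq_right_inv h3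
  have h5 : (R * D)⁻¹ = D⁻¹ * Rᵀ := by rw [Matrix.mul_inv_rev, h4]
  have h6 : (D⁻¹ * Rᵀ).det = D⁻¹.det := by rw [Matrix.det_mul, Matrix.det_transpose, h2, mul_one]
  simp only [metricParam, h5, h6, Matrix.transpose_mul, Matrix.transpose_transpose,
    Matrix.mul_smul, Matrix.smul_mul, Matrix.mul_assoc]

end SpSphere

end

noncomputable section

namespace SpSphere

/-! ### Invariant metrics as cosets -/

/-- The underlying matrix of an element of `GL⁺(3, ℝ)`. -/
abbrev toMat (D : GL(3, ℝ)⁺) : Matrix (Fin 3) (Fin 3) ℝ := ((D : GL (Fin 3) ℝ) : Matrix _ _ ℝ)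

theorem det_toMat_pos (D : GL(3, ℝ)⁺) : 0 < (toMat D).det := D.2

theorem toMat_injective : Function.Injective toMat := fun _ _ h => Subtype.ext (Units.ext h)

theorem toMat_mul (D E : GL(3, ℝ)⁺) : toMat (D * E) = toMat D * toMat E := rfl

theorem toMat_inv (D : GL(3, ℝ)⁺) : toMat D⁻¹ = (toMat D)⁻¹ := Matrix.coe_units_inv _

/-- A matrix of positive determinant as an element of `GL⁺(3, ℝ)`. -/
def toGLPos (D : Matrix (Fin 3) (Fin 3) ℝ) (h : 0 < D.det) : GL(3, ℝ)⁺ :=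
  ⟨Matrix.GeneralLinearGroup.mkOfDetNeZero D h.ne', h⟩

theorem toMat_toGLPos {D : Matrix (Fin 3) (Fin 3) ℝ} (h : 0 < D.det) : toMat (toGLPos D h) = D := rfl

theorem continuous_toMat : Continuous toMat := Units.continuous_val.comp continuous_subtype_val

theorem continuous_toMat_inv : Continuous fun D : GL(3, ℝ)⁺ => (toMat D)⁻¹ := by
  have h : (fun D : GL(3, ℝ)⁺ => (toMat D)⁻¹) = fun D => toMat D⁻¹ := funext fun D =>
    (toMat_inv D).symm
  rw [h]
  exact continuous_toMat.comp continuous_inv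

/-- The topology on units also records the inverse, which is continuous by Cramer's rule. -/
theorem continuous_toGLPos {X : Type*} [TopologicalSpace X] {f : X → Matrix (Fin 3) (Fin 3) ℝ}
    (hf : Continuous f) (h : ∀ x, 0 < (f x).det) : Continuous fun x => toGLPos (f x) (h x) := by
  have h0 : Continuous (Units.val ∘ fun x =>
      Matrix.GeneralLinearGroup.mkOfDetNeZero (f x) (h x).ne') := hf
  refine Continuous.subtype_mk (Units.continuous_iff.2 ⟨h0, ?_⟩) _
  have h1 : (fun x => (f x).det⁻¹ • (f x).adjugate) = Units.val ∘ fun x =>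
      (Matrix.GeneralLinearGroup.mkOfDetNeZero (f x) (h x).ne')⁻¹ := by
    funext x
    rw [Function.comp_apply, Matrix.coe_units_inv, Matrix.inv_def, Ring.inverse_eq_inv']
    rfl
  exact h1 ▸ (hf.matrix_det.inv₀ fun x => (h x).ne').smul hf.matrix_adjugate

/-- The metric of the invariant `G₂`-structure with parameters `a`, `D`. -/
def paramMetric (a : Rpos) (D : GL(3, ℝ)⁺) : InvMetric :=
  invMetric (metricParam_isSymm a (toMat D)) ((posDef_genSym_iff (metricParam_isSymm a _)).2
    (metricParam_pos a.2 (det_toMat_pos D)))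

theorem metricData_paramMetric (a : Rpos) (D : GL(3, ℝ)⁺) :
    metricData (paramMetric a D) = metricParam a (toMat D) := metricData_invMetric _ _

theorem paramMetric_eq_iff (a a' : Rpos) (D D' : GL(3, ℝ)⁺) :
    paramMetric a D = paramMetric a' D' ↔ a = a' ∧ (D : GLmodSO) = D' := by
  rw [← metricData_injective.eq_iff, metricData_paramMetric, metricData_paramMetric,
    metricParam_eq_iff a.2 a'.2 (det_toMat_pos D) (det_toMat_pos D'), QuotientGroup.eq,
    Subtype.ext_iff, eq_comm]
  refine and_congr_right fun _ => ⟨?_, fun h => ⟨_, h, ?_⟩⟩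
  · rintro ⟨A, hA, h⟩
    have h1 : toMat (D⁻¹ * D') = A := by
      rw [toMat_mul, toMat_inv, h, ← Matrix.mul_assoc,
        Matrix.nonsing_inv_mul _ (isUnit_iff_ne_zero.2 (det_toMat_pos D).ne'), Matrix.one_mul]
    change toMat (D⁻¹ * D') ∈ Matrix.specialOrthogonalGroup (Fin 3) ℝ
    rw [h1]
    exact hA
  · change toMat D' = toMat D * toMat (D⁻¹ * D')
    rw [← toMat_mul, mul_inv_cancel_left]

theorem continuous_paramMetric : Continuous fun p : Rpos × GL(3, ℝ)⁺ => paramMetric p.1 p.2 := by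
  refine continuous_induced_rng.2 (continuous_pi fun z => ?_)
  change Continuous fun p : Rpos × GL(3, ℝ)⁺ => genSym (metricParam p.1 (toMat p.2)).1
    (metricParam p.1 (toMat p.2)).2 (toP (lift z.1) z.1 z.2.1) (toP (lift z.1) z.1 z.2.2)
  have h1 : Continuous fun p : Rpos × GL(3, ℝ)⁺ => (toMat p.2)⁻¹ :=
    continuous_toMat_inv.comp continuous_snd
  have h2 : Continuous fun p : Rpos × GL(3, ℝ)⁺ => (metricParam p.1 (toMat p.2)).2 :=
    (h1.matrix_det.rpow_const fun _ => Or.inr (by norm_num)).div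
      (continuous_subtype_val.comp continuous_fst) fun p => (ne_of_gt p.1.2)
  have h3 : Continuous fun p : Rpos × GL(3, ℝ)⁺ => (metricParam p.1 (toMat p.2)).1 :=
    ((h2.inv₀ fun p => (metricParam_pos p.1.2 (det_toMat_pos p.2)).2.ne').pow 2).smul
      (h1.matrix_transpose.matrix_mul h1)
  simp only [genSym_apply, symValue]
  refine (continuous_finsetSum _ fun l _ => continuous_finsetSum _ fun m _ =>
    (h3.matrix_elem l m).mul continuous_const).add ((continuous_const.mul h2).mul continuous_const)

/-- The metric belonging to `a` and a coset `D · SO(3)`. -/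
def cosetMetric (p : Rpos × GLmodSO) : InvMetric :=
  Quotient.liftOn' p.2 (paramMetric p.1) fun D D' h =>
    (paramMetric_eq_iff p.1 p.1 D D').2 ⟨rfl, Quotient.sound' h⟩

/-- A product of quotient maps need not be one, but open quotient maps are stable under products.
This is what allows continuity on `ℝ⁺ × GL⁺/SO(3)` to be tested before passing to cosets. -/
theorem isOpenQuotientMap_coset : IsOpenQuotientMap
    fun p : Rpos × GL(3, ℝ)⁺ => ((p.1, (p.2 : GLmodSO)) : Rpos × GLmodSO) :=
  IsOpenQuotientMap.id.prodMap QuotientGroup.isOpenQuotientMap_mk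

theorem continuous_cosetMetric : Continuous cosetMetric :=
  isOpenQuotientMap_coset.isQuotientMap.continuous_iff.2 continuous_paramMetric

/-- The parameters are evaluations at `o`, which are continuous for pointwise convergence; the whole
metric is then controlled through seven of its values. -/
theorem continuous_metricData : Continuous metricData := by
  have h : ∀ X Y : 𝔭, Continuous fun g : InvMetric => restrictBilin g X Y := fun X Y => by
    have h0 : Continuous fun (g : InvMetric) (p : Σ x : S7, T x × T x) =>
      g.1.inner p.1 p.2.1 p.2.2 := continuous_induced_dom
    exact continuous_pi_iff.1 h0 ⟨o, θ X, θ Y⟩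
  exact (continuous_pi fun l => continuous_pi fun m => h _ _).prodMk (h _ _)

theorem continuous_metricVec : Continuous fun g => symVec (metricData g) := by
  refine continuous_pi fun i => ?_
  have h1 : ∀ l m, Continuous fun g => (metricData g).1 l m := fun l m =>
    (continuous_fst.comp continuous_metricData).matrix_elem l m
  have h2 : Continuous fun g => (metricData g).2 := continuous_snd.comp continuous_metricData
  fin_cases i
  exacts [h1 0 0, h1 0 1, h1 0 2, h1 1 1, h1 1 2, h1 2 2, h2]

theorem metricVec_mem (g : InvMetric) : symVec (metricData g) ∈ posSet := by
  have h := metricData_pos g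
  exact ⟨by rw [symMat_symVec (metricData_isSymm g)]; exact h.1, h.2⟩

/-- The coset which belongs to an invariant metric. -/
def metricCoset (g : InvMetric) : Rpos × GL(3, ℝ)⁺ :=
  (⟨cholA (metricData g).1 (metricData g).2,
    cholA_pos (metricData_pos g).1 (metricData_pos g).2⟩,
    toGLPos (cholD (metricData g).1 (metricData g).2)
      (det_cholD_pos (metricData_pos g).1 (metricData_pos g).2))

theorem continuous_metricCoset : Continuous metricCoset := by
  have hS : ∀ g, symMat (symVec (metricData g)) = (metricData g).1 := fun g =>
    symMat_symVec (metricData_isSymm g) _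
  refine Continuous.prodMk (Continuous.subtype_mk ?_ _) (continuous_toGLPos ?_ _)
  · have h := contDiffOn_cholA.continuousOn.comp_continuous continuous_metricVec metricVec_mem
    refine h.congr fun g => ?_
    rw [Function.comp_apply, hS]
    rfl
  · refine continuous_pi fun i => continuous_pi fun j => ?_
    have h := (contDiffOn_cholD i j).continuousOn.comp_continuous continuous_metricVec metricVec_mem
    refine h.congr fun g => ?_
    rw [Function.comp_apply, hS]
    rfl

theorem paramMetric_metricCoset (g : InvMetric) :
    paramMetric (metricCoset g).1 (metricCoset g).2 = g := by
  apply metricData_injective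
  rw [metricData_paramMetric]
  exact metricParam_chol (metricData_isSymm g) (metricData_pos g).1 (metricData_pos g).2

/-- Invariant metrics are parametrised by `ℝ⁺ × GL⁺(3, ℝ) / SO(3)`. -/
def metricHomeo : InvMetric ≃ₜ Rpos × GLmodSO where
  toFun g := ((metricCoset g).1, ((metricCoset g).2 : GLmodSO))
  invFun := cosetMetric
  left_inv g := paramMetric_metricCoset g
  right_inv p := by
    obtain ⟨a, E⟩ := p
    obtain ⟨D, rfl⟩ := QuotientGroup.mk_surjective E
    obtain ⟨h1, h2⟩ := (paramMetric_eq_iff _ _ _ _).1 (paramMetric_metricCoset (paramMetric a D))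
    exact Prod.ext h1 h2
  continuous_toFun := isOpenQuotientMap_coset.continuous.comp continuous_metricCoset
  continuous_invFun := continuous_cosetMetric

theorem isMetricOf_metricHomeo_symm (φ : InvForm) (a : Rpos) (D : GL(3, ℝ)⁺)
    (h : (φ.1 o).compLinearMap θ = phi a (toMat D)) (x : S7) :
    IsMetricOf (φ.1 x) (fun v w => (metricHomeo.symm (a, (D : GLmodSO))).1.inner x v w) :=
  (isMetricOf_iff_of_restrict a.2 (det_toMat_pos D) h _ x).2 fun _ _ => rfl

/-! ### The moduli space -/

/-- Replacing `S` by `Rᵀ S R` amounts to multiplying `D` by `Rᵀ` on the left, as `S` is a multiple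
of `D⁻ᵀ D⁻¹`. -/
theorem autSetoid_paramMetric (a a' : Rpos) (D D' : GL(3, ℝ)⁺) :
    autSetoid.r (paramMetric a D) (paramMetric a' D') ↔
      a = a' ∧ (MulAction.orbitRel SO3 GLmodSO).r (D : GLmodSO) (D' : GLmodSO) := by
  rw [autSetoid_iff, metricData_paramMetric, metricData_paramMetric]
  constructor
  · rintro ⟨R, hR, h⟩
    have hd : 0 < Rᵀ.det := by
      rw [Matrix.det_transpose, (Matrix.mem_specialOrthogonalGroup_iff.1 hR).2]
      exact one_pos
    have hR' : Rᵀ ∈ Matrix.specialOrthogonalGroup (Fin 3) ℝ := by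
      obtain ⟨h1, h2⟩ := Matrix.mem_specialOrthogonalGroup_iff.1 hR
      exact Matrix.mem_specialOrthogonalGroup_iff.2 ⟨Unitary.star_mem h1, by
        rw [Matrix.det_transpose, h2]⟩
    have h1 : paramMetric a D = paramMetric a' (toGLPos Rᵀ hd * D') := by
      apply metricData_injective
      rw [metricData_paramMetric, metricData_paramMetric, toMat_mul, toMat_toGLPos,
        metricParam_mul_left hR', Matrix.transpose_transpose, h]
    obtain ⟨h2, h3⟩ := (paramMetric_eq_iff _ _ _ _).1 h1
    exact ⟨h2, ⟨⟨toGLPos Rᵀ hd, hR'⟩, h3.symm⟩⟩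
  · rintro ⟨rfl, ⟨⟨R, hR⟩, h⟩⟩
    have h1 : ((R * D' : GL(3, ℝ)⁺) : GLmodSO) = D := h
    have h2 := (paramMetric_eq_iff a a _ _).2 ⟨rfl, h1⟩
    have h3 := congrArg metricData h2
    rw [metricData_paramMetric, metricData_paramMetric, toMat_mul, metricParam_mul_left hR] at h3
    have hR' : (toMat R)ᵀ ∈ Matrix.specialOrthogonalGroup (Fin 3) ℝ := by
      obtain ⟨h1, h2⟩ := Matrix.mem_specialOrthogonalGroup_iff.1 hR
      exact Matrix.mem_specialOrthogonalGroup_iff.2 ⟨Unitary.star_mem h1, by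
        rw [Matrix.det_transpose, h2]⟩
    refine ⟨_, hR', ?_⟩
    rw [← h3, Matrix.transpose_transpose]

theorem autSetoid_iff_metricHomeo (g g' : InvMetric) : autSetoid.r g g' ↔
    (metricHomeo g).1 = (metricHomeo g').1 ∧
      (MulAction.orbitRel SO3 GLmodSO).r (metricHomeo g).2 (metricHomeo g').2 := by
  have h := autSetoid_paramMetric (metricCoset g).1 (metricCoset g').1 (metricCoset g).2
    (metricCoset g').2
  rwa [paramMetric_metricCoset, paramMetric_metricCoset] at h

instance : ContinuousConstSMul SO3 GLmodSO :=
  ⟨fun R => continuous_const_smul (R : GL(3, ℝ)⁺)⟩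

theorem isOpenQuotientMap_orbit : IsOpenQuotientMap
    fun p : Rpos × GLmodSO => ((p.1, Quotient.mk _ p.2) : Rpos × SOGLmodSO) :=
  IsOpenQuotientMap.id.prodMap MulAction.isOpenQuotientMap_quotientMk

/-- The moduli space of invariant metrics. -/
def moduliHomeo : Moduli ≃ₜ Rpos × SOGLmodSO where
  toFun := Quotient.lift (fun g => ((metricHomeo g).1, Quotient.mk _ (metricHomeo g).2))
    fun g g' h => Prod.ext ((autSetoid_iff_metricHomeo g g').1 h).1
      (Quotient.sound ((autSetoid_iff_metricHomeo g g').1 h).2)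
  invFun p := Quotient.lift (fun E => Quotient.mk autSetoid (metricHomeo.symm (p.1, E)))
    (fun E E' h => Quotient.sound <| (autSetoid_iff_metricHomeo _ _).2 (by
      rw [Homeomorph.apply_symm_apply, Homeomorph.apply_symm_apply]
      exact ⟨rfl, h⟩)) p.2
  left_inv z := by
    obtain ⟨g, rfl⟩ := Quotient.exists_rep z
    exact congrArg (Quotient.mk autSetoid) (metricHomeo.symm_apply_apply g)
  right_inv p := by
    obtain ⟨a, z⟩ := p
    obtain ⟨E, rfl⟩ := Quotient.exists_rep z
    change ((metricHomeo (metricHomeo.symm (a, E))).1,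
      (Quotient.mk _ (metricHomeo (metricHomeo.symm (a, E))).2 : SOGLmodSO)) = _
    rw [Homeomorph.apply_symm_apply]
  continuous_toFun :=
    (isOpenQuotientMap_orbit.continuous.comp metricHomeo.continuous).quotient_lift _
  continuous_invFun := isOpenQuotientMap_orbit.isQuotientMap.continuous_iff.2
    (continuous_quotient_mk'.comp metricHomeo.symm.continuous)

end SpSphere

end

/-! ### Double cosets of `SO(3)` and singular values. -/

noncomputable section

namespace SpSphere

/-! ### Singular values -/

section SingularValues

open scoped Matrix.Norms.L2Operator

/-- The largest singular value of a matrix. -/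
def specNorm (A : Matrix (Fin 3) (Fin 3) ℝ) : ℝ := ‖A‖

theorem continuous_specNorm : Continuous specNorm := continuous_norm

theorem specNorm_mul_left {U : Matrix (Fin 3) (Fin 3) ℝ}
    (hU : U ∈ Matrix.specialOrthogonalGroup (Fin 3) ℝ) (A : Matrix (Fin 3) (Fin 3) ℝ) :
    specNorm (U * A) = specNorm A :=
  CStarRing.norm_mem_unitary_mul A (Matrix.mem_specialOrthogonalGroup_iff.1 hU).1

theorem specNorm_mul_right {U : Matrix (Fin 3) (Fin 3) ℝ}
    (hU : U ∈ Matrix.specialOrthogonalGroup (Fin 3) ℝ) (A : Matrix (Fin 3) (Fin 3) ℝ) :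
    specNorm (A * U) = specNorm A :=
  CStarRing.norm_mul_mem_unitary A (Matrix.mem_specialOrthogonalGroup_iff.1 hU).1

theorem specNorm_pos {A : Matrix (Fin 3) (Fin 3) ℝ} (hA : A.det ≠ 0) : 0 < specNorm A := by
  refine norm_pos_iff.2 ?_
  rintro rfl
  simp at hA

theorem specNorm_diagonal {v : Fin 3 → ℝ} {i : Fin 3} (h : ∀ j, |v j| ≤ v i) :
    specNorm (Matrix.diagonal v) = v i := by
  rw [specNorm, Matrix.l2_opNorm_diagonal]
  have hi : 0 ≤ v i := (abs_nonneg _).trans (h i)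
  refine le_antisymm ((pi_norm_le_iff_of_nonneg hi).2 h) ?_
  exact (le_abs_self _).trans (norm_le_pi_norm v i)

end SingularValues

theorem inv_mem_specialOrthogonalGroup {R : Matrix (Fin 3) (Fin 3) ℝ}
    (hR : R ∈ Matrix.specialOrthogonalGroup (Fin 3) ℝ) :
    R⁻¹ = Rᵀ ∧ Rᵀ ∈ Matrix.specialOrthogonalGroup (Fin 3) ℝ := by
  obtain ⟨h1, h2⟩ := Matrix.mem_specialOrthogonalGroup_iff.1 hR
  exact ⟨Matrix.inv_eq_right_inv ((Matrix.mem_orthogonalGroup_iff (Fin 3) ℝ).1 h1),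
    Matrix.mem_specialOrthogonalGroup_iff.2 ⟨Unitary.star_mem h1, by
      rw [Matrix.det_transpose, h2]⟩⟩

/-- The singular values of a `3 × 3` matrix of positive determinant, in decreasing order. -/
def singVals (D : Matrix (Fin 3) (Fin 3) ℝ) : Fin 3 → ℝ :=
  -- The extreme values are operator norms of `D` and `D⁻¹`, and the middle one is forced by the
  -- determinant. Continuity and invariance under `SO(3)` on both sides then need no perturbation
  -- theory of eigenvalues.
  ![specNorm D, D.det * specNorm D⁻¹ / specNorm D, (specNorm D⁻¹)⁻¹]

theorem singVals_mul_mul {R R' : Matrix (Fin 3) (Fin 3) ℝ}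
    (hR : R ∈ Matrix.specialOrthogonalGroup (Fin 3) ℝ)
    (hR' : R' ∈ Matrix.specialOrthogonalGroup (Fin 3) ℝ) (D : Matrix (Fin 3) (Fin 3) ℝ) :
    singVals (R * D * R') = singVals D := by
  have h1 : specNorm (R * D * R') = specNorm D := by
    rw [specNorm_mul_right hR', specNorm_mul_left hR]
  have h2 : specNorm (R * D * R')⁻¹ = specNorm D⁻¹ := by
    rw [Matrix.mul_inv_rev, Matrix.mul_inv_rev, (inv_mem_specialOrthogonalGroup hR).1,
      (inv_mem_specialOrthogonalGroup hR').1,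
      specNorm_mul_left (inv_mem_specialOrthogonalGroup hR').2,
      specNorm_mul_right (inv_mem_specialOrthogonalGroup hR).2]
  have h3 : (R * D * R').det = D.det := by
    rw [Matrix.det_mul, Matrix.det_mul, (Matrix.mem_specialOrthogonalGroup_iff.1 hR).2,
      (Matrix.mem_specialOrthogonalGroup_iff.1 hR').2, one_mul, mul_one]
  rw [singVals, h1, h2, h3, singVals]

theorem singVals_diagonal (r : Chamber) : singVals (Matrix.diagonal r.1) = r.1 := by
  obtain ⟨r, h1, h2, h3⟩ := r
  have h4 : 0 < r 1 := h3.trans_le h2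
  have h5 : 0 < r 0 := h4.trans_le h1
  have hr : ∀ j, 0 < r j := by
    intro j
    fin_cases j
    exacts [h5, h4, h3]
  have hinv : (Matrix.diagonal r)⁻¹ = Matrix.diagonal fun j => (r j)⁻¹ := by
    refine Matrix.inv_eq_right_inv ?_
    rw [Matrix.diagonal_mul_diagonal, ← Matrix.diagonal_one]
    congr 1
    funext j
    exact mul_inv_cancel₀ (hr j).ne'
  have e1 : specNorm (Matrix.diagonal r) = r 0 := by
    refine specNorm_diagonal fun j => ?_
    rw [abs_of_pos (hr j)]
    fin_cases j
    exacts [le_rfl, h1, h2.trans h1]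
  have e2 : specNorm (Matrix.diagonal r)⁻¹ = (r 2)⁻¹ := by
    rw [hinv]
    refine specNorm_diagonal (i := 2) fun j => ?_
    rw [abs_of_pos (inv_pos.2 (hr j))]
    refine inv_anti₀ h3 ?_
    fin_cases j
    exacts [h2.trans h1, h2, le_rfl]
  have e3 : (Matrix.diagonal r).det = r 0 * r 1 * r 2 := by
    rw [Matrix.det_diagonal, Fin.prod_univ_three]
  change singVals (Matrix.diagonal r) = r
  rw [singVals, e1, e2, e3]
  funext j
  fin_cases j
  · rfl
  · change r 0 * r 1 * r 2 * (r 2)⁻¹ / r 0 = r 1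
    field_simp
  · exact inv_inv (r 2)

theorem exists_antitone_diagonalization {A : Matrix (Fin 3) (Fin 3) ℝ} (hA : A.PosDef) :
    ∃ U ∈ Matrix.specialOrthogonalGroup (Fin 3) ℝ, ∃ l : Fin 3 → ℝ, Antitone l ∧ (∀ i, 0 < l i) ∧
      Uᵀ * A * U = Matrix.diagonal l := by
  set V : Matrix (Fin 3) (Fin 3) ℝ := hA.isHermitian.eigenvectorUnitary.1
  have hVV : Vᵀ * V = 1 := hA.isHermitian.eigenvectorUnitary.2.1
  have hdiag : Vᵀ * A * V = Matrix.diagonal hA.isHermitian.eigenvalues := by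
    have h := hA.isHermitian.spectral_theorem
    rw [Unitary.conjStarAlgAut_apply] at h
    have h' : A = V * Matrix.diagonal hA.isHermitian.eigenvalues * Vᵀ := h
    have h2 := congrArg (fun B => Vᵀ * B * V) h'
    simp only [← Matrix.mul_assoc, hVV, Matrix.one_mul] at h2
    rwa [Matrix.mul_assoc _ Vᵀ V, hVV, Matrix.mul_one] at h2
  -- Sorting the negatives increasingly puts the eigenvalues in decreasing order.
  set σ := Tuple.sort fun i => -hA.isHermitian.eigenvalues i
  have hmono := Tuple.monotone_sort fun i => -hA.isHermitian.eigenvalues i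
  set W := V.submatrix id σ
  have hWW : Wᵀ * W = 1 := by
    have : Wᵀ * W = (Vᵀ * V).submatrix σ σ := rfl
    rw [this, hVV, Matrix.submatrix_one_equiv]
  have hWA : Wᵀ * A * W = Matrix.diagonal (hA.isHermitian.eigenvalues ∘ σ) := by
    have : Wᵀ * A * W = (Vᵀ * A * V).submatrix σ σ := rfl
    rw [this, hdiag, Matrix.submatrix_diagonal_equiv]
  have hdet : W.det * W.det = 1 := by
    have := congrArg Matrix.det hWW
    rwa [Matrix.det_mul, Matrix.det_transpose, Matrix.det_one] at this
  -- In odd dimension the sign of an orthogonal matrix can be corrected by a scalar: `det (det W ·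
  -- W) = (det W)⁴ = 1`, and the scalar cancels in the conjugation.
  refine ⟨W.det • W, Matrix.mem_specialOrthogonalGroup_iff.2
    ⟨(Matrix.mem_orthogonalGroup_iff' (Fin 3) ℝ).2 ?_, ?_⟩, hA.isHermitian.eigenvalues ∘ σ, ?_,
    fun i => hA.eigenvalues_pos _, ?_⟩
  · change (W.det • W)ᵀ * (W.det • W) = 1
    rw [Matrix.transpose_smul, Matrix.smul_mul, Matrix.mul_smul, smul_smul, hdet, one_smul, hWW]
  · rw [Matrix.det_smul, Fintype.card_fin]
    linear_combination (W.det * W.det + 1) * hdet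
  · intro i j hij
    exact neg_le_neg_iff.1 (hmono hij)
  · rw [Matrix.transpose_smul, Matrix.smul_mul, Matrix.smul_mul, Matrix.mul_smul, smul_smul, hdet,
      one_smul, hWA]

theorem exists_singular_value_decomposition {D : Matrix (Fin 3) (Fin 3) ℝ} (hD : 0 < D.det) :
    ∃ R ∈ Matrix.specialOrthogonalGroup (Fin 3) ℝ, ∃ R' ∈ Matrix.specialOrthogonalGroup (Fin 3) ℝ,
      ∃ r : Chamber, D = R * Matrix.diagonal r.1 * R' := by
  have hu : IsUnit D := (Matrix.isUnit_iff_isUnit_det D).2 (isUnit_iff_ne_zero.2 hD.ne')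
  have hpd : (Dᵀ * D).PosDef := Matrix.PosDef.conjTranspose_mul_self D
    (Matrix.mulVec_injective_of_isUnit hu)
  obtain ⟨U, hU, l, hl, hpos, h⟩ := exists_antitone_diagonalization hpd
  have hUU : U * Uᵀ = 1 := (Matrix.mem_orthogonalGroup_iff (Fin 3) ℝ).1
    (Matrix.mem_specialOrthogonalGroup_iff.1 hU).1
  have hs : ∀ i, 0 < √(l i) := fun i => Real.sqrt_pos.2 (hpos i)
  -- From `Uᵀ (Dᵀ D) U = diag l`, the matrix `D U l^(-1/2)` is orthogonal, with positive determinant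
  -- as `det D > 0`; it is the left factor of the decomposition.
  let d : Matrix (Fin 3) (Fin 3) ℝ := Matrix.diagonal fun i => (√(l i))⁻¹
  have hdt : dᵀ = d := Matrix.diagonal_transpose _
  have h1 : (D * U * d)ᵀ * (D * U * d) = 1 := by
    rw [Matrix.transpose_mul, Matrix.transpose_mul, hdt]
    have : d * (Uᵀ * Dᵀ) * (D * U * d) = d * (Uᵀ * (Dᵀ * D) * U) * d := by
      simp only [Matrix.mul_assoc]
    rw [this, h, Matrix.diagonal_mul_diagonal, Matrix.diagonal_mul_diagonal, ← Matrix.diagonal_one]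
    congr 1
    funext i
    have := Real.mul_self_sqrt (hpos i).le
    have h0 := (hs i).ne'
    field_simp
    rw [sq, this]
  have hdd : 0 < d.det := by
    rw [Matrix.det_diagonal]
    exact Finset.prod_pos fun i _ => inv_pos.2 (hs i)
  have h2 : (D * U * d).det = 1 := by
    have h3 := congrArg Matrix.det h1
    rw [Matrix.det_mul, Matrix.det_transpose, Matrix.det_one] at h3
    have h4 : 0 < (D * U * d).det := by
      rw [Matrix.det_mul, Matrix.det_mul, (Matrix.mem_specialOrthogonalGroup_iff.1 hU).2]
      positivity
    nlinarith
  refine ⟨D * U * d, Matrix.mem_specialOrthogonalGroup_iff.2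
    ⟨(Matrix.mem_orthogonalGroup_iff' (Fin 3) ℝ).2 h1, h2⟩, Uᵀ,
    (inv_mem_specialOrthogonalGroup hU).2, ⟨fun i => √(l i),
      Real.sqrt_le_sqrt (hl (by decide)), Real.sqrt_le_sqrt (hl (by decide)), hs 2⟩, ?_⟩
  have h5 : d * Matrix.diagonal (fun i => √(l i)) = 1 := by
    rw [Matrix.diagonal_mul_diagonal, ← Matrix.diagonal_one]
    congr 1
    funext i
    exact inv_mul_cancel₀ (hs i).ne'
  rw [Matrix.mul_assoc (D * U), h5, Matrix.mul_one, Matrix.mul_assoc, hUU, Matrix.mul_one]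

theorem singVals_mem {D : Matrix (Fin 3) (Fin 3) ℝ} (hD : 0 < D.det) :
    singVals D 1 ≤ singVals D 0 ∧ singVals D 2 ≤ singVals D 1 ∧ 0 < singVals D 2 := by
  obtain ⟨R, hR, R', hR', r, rfl⟩ := exists_singular_value_decomposition hD
  rw [singVals_mul_mul hR hR', singVals_diagonal]
  exact r.2

theorem continuous_singVals : Continuous fun D : GL(3, ℝ)⁺ => singVals (toMat D) := by
  have h1 : Continuous fun D : GL(3, ℝ)⁺ => specNorm (toMat D) :=
    continuous_specNorm.comp continuous_toMat
  have h2 : Continuous fun D : GL(3, ℝ)⁺ => specNorm (toMat D)⁻¹ :=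
    continuous_specNorm.comp continuous_toMat_inv
  have hn : ∀ D : GL(3, ℝ)⁺, specNorm (toMat D) ≠ 0 := fun D =>
    (specNorm_pos (det_toMat_pos D).ne').ne'
  have hn' : ∀ D : GL(3, ℝ)⁺, specNorm (toMat D)⁻¹ ≠ 0 := fun D =>
    (specNorm_pos (det_inv_pos (det_toMat_pos D)).ne').ne'
  refine continuous_pi fun i => ?_
  fin_cases i
  exacts [h1, (continuous_toMat.matrix_det.mul h2).div h1 hn, h2.inv₀ hn']

/-- The singular values as a map to the chamber. -/
def toChamber (D : GL(3, ℝ)⁺) : Chamber := ⟨singVals (toMat D), singVals_mem (det_toMat_pos D)⟩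

theorem toChamber_mul_mul (R D R' : GL(3, ℝ)⁺) (hR : R ∈ SO3) (hR' : R' ∈ SO3) :
    toChamber (R * D * R') = toChamber D :=
  Subtype.ext (singVals_mul_mul hR hR' (toMat D))

theorem det_diagonal_pos (r : Chamber) : 0 < (Matrix.diagonal r.1).det := by
  obtain ⟨r, h1, h2, h3⟩ := r
  have h4 : 0 < r 1 := h3.trans_le h2
  have h5 : 0 < r 0 := h4.trans_le h1
  rw [Matrix.det_diagonal, Fin.prod_univ_three]
  positivity

/-- The diagonal matrix with the given entries. -/
def chamberDiag (r : Chamber) : GL(3, ℝ)⁺ := toGLPos (Matrix.diagonal r.1) (det_diagonal_pos r)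

theorem continuous_chamberDiag : Continuous chamberDiag :=
  continuous_toGLPos continuous_subtype_val.matrix_diagonal det_diagonal_pos

theorem exists_eq_mul_chamberDiag_mul (D : GL(3, ℝ)⁺) : ∃ R ∈ SO3, ∃ R' ∈ SO3,
    D = R * chamberDiag (toChamber D) * R' := by
  obtain ⟨R, hR, R', hR', r, h⟩ := exists_singular_value_decomposition (det_toMat_pos D)
  have hr : toChamber D = r := by
    refine Subtype.ext ?_
    change singVals (toMat D) = r.1
    rw [h, singVals_mul_mul hR hR', singVals_diagonal]
  have hp : ∀ {Q : Matrix (Fin 3) (Fin 3) ℝ}, Q ∈ Matrix.specialOrthogonalGroup (Fin 3) ℝ →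
      0 < Q.det := fun hQ => by
    rw [(Matrix.mem_specialOrthogonalGroup_iff.1 hQ).2]
    exact one_pos
  refine ⟨toGLPos R (hp hR), hR, toGLPos R' (hp hR'), hR', toMat_injective ?_⟩
  rw [hr]
  exact h

/-- `SO(3) \ GL⁺(3, ℝ) / SO(3)` is the space of singular values. -/
def chamberHomeo : Chamber ≃ₜ SOGLmodSO where
  toFun r := Quotient.mk _ (chamberDiag r : GLmodSO)
  invFun := Quotient.lift (fun E : GLmodSO => Quotient.liftOn' E toChamber fun D D' h => by
      have h1 : D⁻¹ * D' ∈ SO3 := QuotientGroup.leftRel_apply.1 h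
      -- `D' = 1 · D · (D⁻¹ D')`, so invariance under right multiplication gives independence of the
      -- representative.
      have h2 := toChamber_mul_mul 1 D (D⁻¹ * D') SO3.one_mem h1
      rwa [one_mul, mul_inv_cancel_left, eq_comm] at h2) <| by
    intro E E' h
    obtain ⟨D, rfl⟩ := QuotientGroup.mk_surjective E
    obtain ⟨D', rfl⟩ := QuotientGroup.mk_surjective E'
    obtain ⟨R, hR⟩ := h
    have h1 : ((R * D' : GL(3, ℝ)⁺) : GLmodSO) = D := hR
    have h3 := toChamber_mul_mul R D' ((R * D')⁻¹ * D) R.2 (QuotientGroup.eq.1 h1)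
    rw [mul_inv_cancel_left] at h3
    exact h3
  left_inv r := Subtype.ext (singVals_diagonal r)
  right_inv z := by
    obtain ⟨E, rfl⟩ := Quotient.exists_rep z
    obtain ⟨D, rfl⟩ := QuotientGroup.mk_surjective E
    obtain ⟨R, hR, R', hR', h⟩ := exists_eq_mul_chamberDiag_mul D
    refine Quotient.sound ⟨⟨R⁻¹, SO3.inv_mem hR⟩, ?_⟩
    change ((R⁻¹ * D : GL(3, ℝ)⁺) : GLmodSO) = (chamberDiag (toChamber D) : GLmodSO)
    refine QuotientGroup.eq.2 ?_
    have h1 : (R⁻¹ * D)⁻¹ * chamberDiag (toChamber D) = R'⁻¹ := by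
      nth_rewrite 1 [h]
      group
    rw [h1]
    exact SO3.inv_mem hR'
  continuous_toFun := continuous_quotient_mk'.comp
    (QuotientGroup.continuous_mk.comp continuous_chamberDiag)
  continuous_invFun :=
    (Continuous.quotient_liftOn' (continuous_singVals.subtype_mk _) _).quotient_lift _

/-- The moduli space is parametrised by `ℝ⁺` and the chamber. -/
def moduliChart : Rpos × Chamber ≃ₜ Moduli :=
  ((Homeomorph.refl Rpos).prodCongr chamberHomeo).trans moduliHomeo.symm

theorem moduliChart_apply (a : Rpos) (r : Chamber) (D : GL(3, ℝ)⁺)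
    (h : toMat D = Matrix.diagonal r.1) :
    moduliChart (a, r) = Quotient.mk _ (metricHomeo.symm (a, (D : GLmodSO))) := by
  have h1 : D = chamberDiag r := toMat_injective h
  rw [h1]
  rfl

end SpSphere

end

open SpSphere in
theorem theorem1 :
    -- `S⁷ = Sp(2)/Sp(1)`
    (MulAction.IsPretransitive Sp2 S7 ∧ MulAction.stabilizer Sp2 o = Sp1) ∧
    -- restriction to `𝔭` identifies `Ω³₊(S⁷)^{Sp(2)}` with `Λ³₊(𝔭*)^{Ad(Sp(1))}`
    (∃ ρ : InvForm ≃ₗ[ℝ] InvForm𝔭,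
      (∀ φ : InvForm, (ρ φ).1 = (φ.1 o).compLinearMap θ) ∧
      ∀ φ : InvForm, IsG2Structure φ ↔ IsPositive (ρ φ).1) ∧
    -- `φ_{a,D}` is the pullback of `φ₀` by the block map of `(a, D)`
    (∀ (a : ℝ) (D : Matrix (Fin 3) (Fin 3) ℝ), 0 < a → 0 < D.det →
      phi a D = φ₀.compLinearMap (blockMap a D)) ∧
    -- `Φ(a, D) = φ_{a,D}` is a diffeomorphism from `ℝ⁺ × GL⁺(3, ℝ)` onto `Λ³₊(𝔭*)^{Ad(Sp(1))}`,
    -- an open subset of the 10-dimensional space `Λ³(𝔭*)^{Ad(Sp(1))}`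
    (∃ (c : (Fin 10 → ℝ) ≃ₗ[ℝ] InvForm𝔭)
        (Φ : OpenPartialHomeomorph (ℝ × (Fin 3 → Fin 3 → ℝ)) (Fin 10 → ℝ)),
      Φ.source = ParamDomain ∧ Φ.target = {t | IsPositive (c t).1} ∧
      (∀ q ∈ ParamDomain, (c (Φ q)).1 = phi q.1 (Matrix.of q.2)) ∧
      ContDiffOn ℝ ∞ Φ Φ.source ∧ ContDiffOn ℝ ∞ Φ.symm Φ.target) ∧
    -- every invariant `G₂`-structure has exactly one associated metric, and it is invariant
    (∀ φ : InvForm, IsG2Structure φ → ∃ g : InvMetric, ∀ g' : Metric7,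
      (∀ x, IsMetricOf (φ.1 x) (fun v w => g'.inner x v w)) ↔ g' = g.1) ∧
    -- invariant metrics on `S⁷` are the `Ad(Sp(1))`-invariant inner products on `𝔭`
    (∃ σ : InvMetric ≃ {b : InvSym𝔭 // PosDef b.1},
      ∀ (g : InvMetric) (X Y : 𝔭), (σ g).1.1 X Y = g.1.inner o (θ X) (θ Y)) ∧
    -- these form an open subset of the 7-dimensional space `Sym²(𝔭*)^{Ad(Sp(1))}`, and
    -- `(a, D) ↦ g_{φ_{a,D}}` is a smooth submersion onto it with fibres the `SO(3)`-orbits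
    (∃ (c : (Fin 7 → ℝ) ≃ₗ[ℝ] InvSym𝔭) (m : ℝ × (Fin 3 → Fin 3 → ℝ) → (Fin 7 → ℝ)),
      IsOpen {t | PosDef (c t).1} ∧ m '' ParamDomain = {t | PosDef (c t).1} ∧
      ContDiffOn ℝ ∞ m ParamDomain ∧
      (∀ q ∈ ParamDomain, Function.Surjective (fderiv ℝ m q)) ∧
      (∀ q ∈ ParamDomain,
        IsMetricOf (phi q.1 (Matrix.of q.2)) (fun X Y => (c (m q)).1 X Y)) ∧
      ∀ q ∈ ParamDomain, ∀ q' ∈ ParamDomain, m q = m q' ↔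
        q'.1 = q.1 ∧ ∃ A ∈ Matrix.specialOrthogonalGroup (Fin 3) ℝ,
          Matrix.of q'.2 = Matrix.of q.2 * A) ∧
    -- `Sym²₊(T*S⁷)^{Sp(2)} ≃ ℝ⁺ × GL⁺(3, ℝ)/SO(3)`, with `(a, D SO(3))` corresponding to the
    -- metric of the invariant `G₂`-structure `φ_{a,D}`
    ∃ Θ : InvMetric ≃ₜ Rpos × GLmodSO,
      (∀ φ : InvForm, IsG2Structure φ → ∀ (a : Rpos) (D : GL(3, ℝ)⁺),
        (φ.1 o).compLinearMap θ = phi a ((D : GL (Fin 3) ℝ) : Matrix (Fin 3) (Fin 3) ℝ) →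
        ∀ x, IsMetricOf (φ.1 x)
          (fun v w => (Θ.symm (a, (D : GLmodSO))).1.inner x v w)) ∧
      -- `Aut(S⁷) \ Sym²₊(T*S⁷)^{Sp(2)} ≃ ℝ⁺ × SO(3) \ (GL⁺(3, ℝ)/SO(3))`
      (∃ Ξ : Moduli ≃ₜ Rpos × SOGLmodSO,
        ∀ g : InvMetric, Ξ (Quotient.mk _ g) = ((Θ g).1, Quotient.mk _ (Θ g).2)) ∧
      -- the moduli space is 4-dimensional, with parameters `a > 0`, `r₁ ≥ r₂ ≥ r₃ > 0`
      ∃ Λ : Rpos × Chamber ≃ₜ Moduli, ∀ (a : Rpos) (r : Chamber) (D : GL(3, ℝ)⁺),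
        ((D : GL (Fin 3) ℝ) : Matrix (Fin 3) (Fin 3) ℝ) = Matrix.diagonal r.1 →
        Λ (a, r) = Quotient.mk _ (Θ.symm (a, (D : GLmodSO))) := by
  refine ⟨⟨isPretransitive, stabilizer_o⟩, exists_restrictForm,
    fun a D ha hD => phi_eq_comp_blockMap ha hD, exists_formChart, exists_metric_of_isG2Structure,
    ⟨restrictMetric, fun g X Y => rfl⟩, exists_metricCoord,
    metricHomeo, fun φ _ a D h x => isMetricOf_metricHomeo_symm φ a D h x,
    ⟨moduliHomeo, fun _ => rfl⟩, moduliChart, fun a r D h => moduliChart_apply a r D h⟩
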